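/- A weighted graph $G=(V,E,w)$ is a simple graph with a weight function $w\colon V\cup E\to\{1,2,3,\dots\}$. For an integer $k\ge 0$, a connected $k$-search strategy for $G$ consists of a starting vertex $v_0$ and a finite sequence of moves. Initially all edges are contaminated and $k$ searchers are on $v_0$. A move slides $j\ge 1$ searchers, all of them located at $u$, along an edge $uv$ to $v$; if $uv$ is contaminated, then $j\ge w(uv)$ is required, and $uv$ becomes clear. After each move contamination spreads as long as possible: a clear edge $uv$ becomes contaminated if there is a contaminated edge $vy$ and fewer than $w(v)$ searchers occupy $v$. After each move the subgraph formed by the clear edges has to be connected (the empty subgraph is allowed), and after the last move all edges are clear. The strategy is monotone if no clear edge ever becomes contaminated. The connected search number $\mathrm{cs}(G)$ is the smallest $k$ for which there is a connected $k$-search strategy (not necessarily monotone, with any starting vertex), and a strategy is optimal if it uses $k=\mathrm{cs}(G)$ searchers. **Theorem 4.5.** There is an algorithm that, given a weighted tree $T$ with arbitrary positive integer weights on its vertices and edges, computes $\mathrm{cs}(T)$ and an optimal connected search strategy for $T$, which moreover is monotone, and whose running time on trees of bounded maximum degree is $O(n^3\log n)$, where $n=|V(T)|$. Precisely: there is one program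 such that for every $\Delta$ there is a constant $C_\Delta$, depending only on $\Delta$, such that on every weighted tree with $n\ge 1$ vertices and maximum degree at most $\Delta$ the program halts after at most $C_\Delta\,(n^3\log n+1)$ steps with such a strategy, listed explicitly move by move (starting vertex, and for each move the vertices $u$, $v$ and the number $j$), as its output. Here the tree is given by $n$, the weights of its vertices $0,\dots,n-1$, and a list, in any order, of its edges with their weights; and the model of computation is a unit-cost random access machine on natural numbers of arbitrary size, with addition, truncated subtraction, tests for zero, and indirectly addressed arrays. -/

import Mathlib

namespace ConnSearch

/-! ## Weighted graphs and connected search strategies -/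

/-- A simple graph with positive integer weights on its vertices and edges. (The value of `ew` on
a pair that is not an edge plays no role.) -/
structure WeightedGraph (V : Type*) where
  graph : SimpleGraph V
  vw : V → ℕ
  ew : Sym2 V → ℕ
  vw_pos : ∀ v, 0 < vw v
  ew_pos : ∀ e ∈ graph.edgeSet, 0 < ew e

/-- The move that slides `count` searchers from `src` to `dst`. -/
structure Move (V : Type*) where
  src : V
  dst : V
  count : ℕ

/-- The number of searchers on every vertex, and the set of clear edges. -/
structure Config (V : Type*) where
  occ : V → ℕ
  clear : Set (Sym2 V)

/-- The subgraph formed by the edges in `C` is connected (the empty subgraph counts as connected):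
any two endpoints of edges in `C` are joined by a walk all of whose edges are in `C`. -/
def ConnectedEdges {V : Type*} (C : Set (Sym2 V)) : Prop :=
  ∀ u ∈ (SimpleGraph.fromEdgeSet C).support, ∀ v ∈ (SimpleGraph.fromEdgeSet C).support,
    (SimpleGraph.fromEdgeSet C).Reachable u v

namespace WeightedGraph

variable {V : Type*} [DecidableEq V] (G : WeightedGraph V)

/-- The edges that are contaminated once contamination has spread, when `occ` is the distribution
of the searchers and the edges outside `C` are contaminated: contamination passes through a vertex
`v` as long as fewer than `w(v)` searchers occupy `v`. -/
inductive Contaminated (occ : V → ℕ) (C : Set (Sym2 V)) : Sym2 V → Prop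
  | base {e : Sym2 V} : e ∈ G.graph.edgeSet → e ∉ C → Contaminated occ C e
  | spread {u v y : V} : G.graph.Adj u v → G.graph.Adj v y → occ v < G.vw v →
      Contaminated occ C s(v, y) → Contaminated occ C s(u, v)

/-- At least one searcher slides along an edge, the searchers that slide are there, and if the
edge is contaminated then there are at least as many of them as the weight of the edge. -/
def Legal (c : Config V) (m : Move V) : Prop :=
  G.graph.Adj m.src m.dst ∧ 1 ≤ m.count ∧ m.count ≤ c.occ m.src ∧
    (s(m.src, m.dst) ∉ c.clear → G.ew s(m.src, m.dst) ≤ m.count)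

/-- The distribution of the searchers after a move. -/
def occAfter (c : Config V) (m : Move V) : V → ℕ :=
  Function.update (Function.update c.occ m.src (c.occ m.src - m.count)) m.dst
    (c.occ m.dst + m.count)

/-- The configuration after a move: the edge of the move becomes clear, then contamination
spreads. -/
def after (c : Config V) (m : Move V) : Config V where
  occ := occAfter c m
  clear := {e | e ∈ G.graph.edgeSet ∧
    ¬ G.Contaminated (occAfter c m) (c.clear ∪ {s(m.src, m.dst)}) e}

/-- All moves are legal, the clear subgraph is connected after each of them, and all edges are
clear at the end. -/
def ClearsFrom : Config V → List (Move V) → Prop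
  | c, [] => c.clear = G.graph.edgeSet
  | c, m :: ms => G.Legal c m ∧ ConnectedEdges (G.after c m).clear ∧ ClearsFrom (G.after c m) ms

/-- No move causes a recontamination. -/
def MonotoneFrom : Config V → List (Move V) → Prop
  | _, [] => True
  | c, m :: ms => c.clear ⊆ (G.after c m).clear ∧ MonotoneFrom (G.after c m) ms

/-- Initially all `k` searchers are on the starting vertex and all edges are contaminated. -/
def start (k : ℕ) (v₀ : V) : Config V where
  occ := Function.update (fun _ => 0) v₀ k
  clear := ∅

/-- The moves `ms` form a connected `k`-search strategy with starting vertex `v₀`. -/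
def IsConnectedSearch (k : ℕ) (v₀ : V) (ms : List (Move V)) : Prop :=
  G.ClearsFrom (start k v₀) ms

/-- The strategy is monotone. -/
def IsMonotone (k : ℕ) (v₀ : V) (ms : List (Move V)) : Prop :=
  G.MonotoneFrom (start k v₀) ms

/-- The connected search number `cs(G)`. Recontamination is allowed, and so is every starting
vertex. -/
noncomputable def connectedSearchNumber : ℕ :=
  sInf {k | ∃ v₀ ms, G.IsConnectedSearch k v₀ ms}

end WeightedGraph

/-! ## Random access machines with unit cost

A program has finitely many variables and finitely many one-dimensional arrays (those that it
mentions), each variable and array cell holding a natural number. The operations on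
numbers are addition and truncated subtraction. -/

/-- The contents of the variables and of the arrays: `arr a i` is cell `i` of array `a`. -/
structure State where
  var : ℕ → ℕ
  arr : ℕ → ℕ → ℕ

/-- Expressions: constants, variables, sums, truncated differences, array cells. -/
inductive Expr where
  | const (c : ℕ)
  | var (x : ℕ)
  | add (e f : Expr)
  | sub (e f : Expr)
  | cell (a : ℕ) (e : Expr)

/-- The value of an expression. -/
def Expr.eval (s : State) : Expr → ℕ
  | const c => c
  | var x => s.var x
  | add e f => e.eval s + f.eval s
  | sub e f => e.eval s - f.eval s
  | cell a e => s.arr a (e.eval s)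

/-- The number of operations needed to evaluate an expression: each occurrence of a constant, of
a variable, of an arithmetic operation and of an array access counts one. -/
def Expr.cost : Expr → ℕ
  | const _ => 1
  | var _ => 1
  | add e f => e.cost + f.cost + 1
  | sub e f => e.cost + f.cost + 1
  | cell _ e => e.cost + 1

/-- Programs. A condition `e` of a conditional or of a loop holds if its value is not `0`. -/
inductive Program where
  | skip
  | assign (x : ℕ) (e : Expr)
  | put (a : ℕ) (i e : Expr)
  | seq (p q : Program)
  | ite (e : Expr) (p q : Program)
  | loop (e : Expr) (p : Program)

/-- `State` after `x := v`. -/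
def State.setVar (s : State) (x v : ℕ) : State where
  var := Function.update s.var x v
  arr := s.arr

/-- `State` after `a[i] := v`. -/
def State.setCell (s : State) (a i v : ℕ) : State where
  var := s.var
  arr := Function.update s.arr a (Function.update (s.arr a) i v)

/-- `p.Runs s t s'`: started in the state `s`, the program `p` halts after exactly `t` steps in
the state `s'`. Every assignment and every test of a condition takes one step in addition to the
evaluation of the expressions in it. -/
inductive Program.Runs : Program → State → ℕ → State → Prop
  | skip (s : State) : Runs .skip s 1 s
  | assign (s : State) (x : ℕ) (e : Expr) :
      Runs (.assign x e) s (e.cost + 1) (s.setVar x (e.eval s))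
  | put (s : State) (a : ℕ) (i e : Expr) :
      Runs (.put a i e) s (i.cost + e.cost + 1) (s.setCell a (i.eval s) (e.eval s))
  | seq {p q : Program} {s s₁ s₂ : State} {t₁ t₂ : ℕ} :
      Runs p s t₁ s₁ → Runs q s₁ t₂ s₂ → Runs (.seq p q) s (t₁ + t₂) s₂
  | ite_true {e : Expr} {p q : Program} {s s₁ : State} {t : ℕ} :
      e.eval s ≠ 0 → Runs p s t s₁ → Runs (.ite e p q) s (e.cost + 1 + t) s₁
  | ite_false {e : Expr} {p q : Program} {s s₁ : State} {t : ℕ} :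
      e.eval s = 0 → Runs q s t s₁ → Runs (.ite e p q) s (e.cost + 1 + t) s₁
  | loop_done {e : Expr} {p : Program} {s : State} :
      e.eval s = 0 → Runs (.loop e p) s (e.cost + 1) s
  | loop_step {e : Expr} {p : Program} {s s₁ s₂ : State} {t₁ t₂ : ℕ} :
      e.eval s ≠ 0 → Runs p s t₁ s₁ → Runs (.loop e p) s₁ t₂ s₂ →
      Runs (.loop e p) s (e.cost + 1 + t₁ + t₂) s₂

/-! ## Input and output -/

/-- `L` lists every edge of the graph exactly once, in any order and with its endpoints in any
order. -/
def WeightedGraph.ListsEdges {V : Type*} (G : WeightedGraph V) (L : List (V × V)) : Prop :=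
  (L.map fun p => s(p.1, p.2)).Nodup ∧
    ∀ e, e ∈ (L.map fun p => s(p.1, p.2)) ↔ e ∈ G.graph.edgeSet

/-- The initial state for a weighted graph with vertices `0, …, n - 1`, given by the list `L` of
its edges. Variable `0` holds `n`, array `0` the weights of the vertices, arrays `1` and `2` the
endpoints of the edges in `L`, array `3` the weights of these edges; everything else is `0`. -/
def WeightedGraph.input {n : ℕ} (G : WeightedGraph (Fin n)) (L : List (Fin n × Fin n)) :
    State where
  var := fun x => if x = 0 then n else 0
  arr := fun a i =>
    match a with
    | 0 => if h : i < n then G.vw ⟨i, h⟩ else 0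
    | 1 => if h : i < L.length then (L[i].1 : ℕ) else 0
    | 2 => if h : i < L.length then (L[i].2 : ℕ) else 0
    | 3 => if h : i < L.length then G.ew s(L[i].1, L[i].2) else 0
    | _ => 0

/-- The state holds a search strategy as its output: variable `1` holds the number `k` of
searchers, variable `2` the starting vertex, variable `3` the number of moves, and arrays `4`,
`5`, `6` the source, the target and the number of sliding searchers of each move. -/
def State.Outputs {n : ℕ} (s : State) (k : ℕ) (v₀ : Fin n) (ms : List (Move (Fin n))) : Prop :=
  s.var 1 = k ∧ s.var 2 = v₀ ∧ s.var 3 = ms.length ∧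
    ∀ (i : ℕ) (h : i < ms.length),
      s.arr 4 i = ms[i].src ∧ s.arr 5 i = ms[i].dst ∧ s.arr 6 i = ms[i].count

end ConnSearch

namespace ConnSearch
set_option linter.unusedSectionVars false

/-! ## Orders in which the vertices are entered -/

namespace WeightedGraph

variable {V : Type*} [Fintype V] [DecidableEq V] (G : WeightedGraph V)

/-! On a tree, a connected search amounts to an order in which the vertices are entered. If `S` is
the set of entered vertices, the vertices of `S` with a neighbour outside `S` bind `guard` many
searchers. Entering `y` from `x` costs the guard of `S ∪ {y}` plus `slack x y`, the excess of the
weight of `xy` over what stays at `y` anyway. The search number is the least `p` that admits a `Run`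
from a single vertex to all vertices.

Lower bound (`IsConnectedSearch.exists_run`): recontamination does not help. The vertices at clear
edges always lie in a set `Z` that some run with `k` searchers reaches. After recontamination they
form a connected set `S` that may be much smaller than `Z`. In that case a connected set `W` of
least guard between `S` and the enlarged `Z` takes the place of `Z`; submodularity of the guard lets
the run be restricted to `W` (`reached_inter`, `Reached.grow`).

Upper bound (`isConnectedSearch_strategy`): guards stay where they are needed, and all spare
searchers wait at the root. For each step they walk down to `x`, cross `xy` and walk back. This
takes O(n²) moves and is monotone.

Optimal orders from a fixed root are described by blocks, each with the guard `sf` at its start and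
its peak `sp`. In a greedy sequence (`Good`) every block starts at a `Tight` set and leads with as
few searchers as possible to a smaller guard. Uncrossing (`Tight.commit`) shows that committing to
such a block never hurts, so the peaks are simultaneous lower bounds for all orders (`Good.sp_le`).
If a domain consists of two parts joined by an edge `uv`, then guards add up once `u` and `v` are
entered, and greedy sequences are merged by always taking the block with the smaller surplus `sp -
sf` (`Split.good_merge`). For a vertex `u` with the branches at a set `R` of neighbours, every `v ∈
R` is tried as the first vertex to be entered. The rest is a merge of the sequences for the branch
at `v` and for `u` with `R \ {v}`; the initial blocks whose guard is at least w(u) are fused with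
the step from `u` to `v` (`good_absorb`). The `v` of smallest peak gives an optimal order
(`optimal_candidate`).

The program keeps one row for each vertex `u` and each subset `R` of its neighbours, at most n·2^Δ
rows. It recomputes all rows in n rounds, so that after each round the rows for domains with one
more vertex are correct. A row takes at most Δ linear merges, hence the total time is O(n³) for
fixed Δ, even without the logarithm (`searchTree_spec`). -/

open Classical in
/-- The number of searchers needed to guard the vertex set `S` inside `D`: the weight of the
vertices of `S` with a neighbor in `D \ S`. -/
noncomputable def guard (D S : Finset V) : ℕ :=
  ∑ x, if x ∈ S ∧ ∃ y ∈ D, G.graph.Adj x y ∧ y ∉ S then G.vw x else 0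

open Classical in
/-- The number of searchers that have to stay at `y` when it is entered for the first time. -/
noncomputable def entry (y : V) : ℕ :=
  if (G.graph.neighborSet y).ncard ≤ 1 then 0 else G.vw y

/-- The number of searchers that are needed to slide along `xy` in addition to the guard of `y`. -/
noncomputable def slack (x y : V) : ℕ := G.ew s(x, y) - G.entry y

/-- The inequality holds vertex by vertex: a neighbour outside `S ∪ T` is outside both sets, and one
outside `S ∩ T` is outside at least one of them. All uncrossing arguments rest on this. -/
theorem guard_submodular (D S T : Finset V) :
    G.guard D (S ∪ T) + G.guard D (S ∩ T) ≤ G.guard D S + G.guard D T := by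
  classical
  unfold guard
  rw [← Finset.sum_add_distrib, ← Finset.sum_add_distrib]
  refine Finset.sum_le_sum fun x _ => ?_
  have h1 : (∃ y ∈ D, G.graph.Adj x y ∧ y ∉ S ∪ T) →
      (∃ y ∈ D, G.graph.Adj x y ∧ y ∉ S) ∧ (∃ y ∈ D, G.graph.Adj x y ∧ y ∉ T) := by
    rintro ⟨y, h, h', h''⟩
    simp only [Finset.mem_union, not_or] at h''
    exact ⟨⟨y, h, h', h''.1⟩, ⟨y, h, h', h''.2⟩⟩
  have h2 : (∃ y ∈ D, G.graph.Adj x y ∧ y ∉ S ∩ T) →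
      (∃ y ∈ D, G.graph.Adj x y ∧ y ∉ S) ∨ (∃ y ∈ D, G.graph.Adj x y ∧ y ∉ T) := by
    rintro ⟨y, h, h', h''⟩
    by_cases hy : y ∈ S
    · exact Or.inr ⟨y, h, h', fun ht => h'' (Finset.mem_inter.2 ⟨hy, ht⟩)⟩
    · exact Or.inl ⟨y, h, h', hy⟩
  simp only [Finset.mem_union, Finset.mem_inter] at h1 h2 ⊢
  by_cases hS : x ∈ S <;> by_cases hT : x ∈ T <;>
    by_cases hc : ∃ y ∈ D, G.graph.Adj x y ∧ y ∉ S <;>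
    by_cases hd : ∃ y ∈ D, G.graph.Adj x y ∧ y ∉ T <;>
    simp only [hS, hT, hc, hd, or_self, or_true, and_self, true_and, false_and, if_false,
      and_false, if_true, or_false, imp_false] at h1 h2 ⊢ <;>
    (try simp only [h1, h2, if_false]) <;> (try split_ifs) <;> omega

theorem guard_self (D : Finset V) : G.guard D D = 0 := by
  classical
  unfold guard
  refine Finset.sum_eq_zero fun x _ => if_neg ?_
  rintro ⟨-, y, hy, -, hy'⟩
  exact hy' hy

theorem vw_le_guard {D S : Finset V} {x y : V} (hx : x ∈ S) (hy : y ∈ D) (hy' : y ∉ S)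
    (h : G.graph.Adj x y) : G.vw x ≤ G.guard D S := by
  classical
  unfold guard
  have := Finset.single_le_sum (s := Finset.univ) (f := fun x =>
    if x ∈ S ∧ ∃ y ∈ D, G.graph.Adj x y ∧ y ∉ S then G.vw x else 0) (fun _ _ => Nat.zero_le _)
    (Finset.mem_univ x)
  rwa [if_pos ⟨hx, y, hy, h, hy'⟩] at this

/-- `Run D p S l S'`: from `S`, the vertices of `D` in the second components of `l` can be entered
one by one, each from the vertex in the first component, with `p` searchers, which leads to `S'`. -/
def Run (D : Finset V) (p : ℕ) : Finset V → List (V × V) → Finset V → Prop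
  | S, [], S' => S = S'
  | S, e :: l, S' => e.1 ∈ S ∧ e.2 ∈ D ∧ e.2 ∉ S ∧ G.graph.Adj e.1 e.2 ∧
      G.guard D (insert e.2 S) + G.slack e.1 e.2 ≤ p ∧ Run D p (insert e.2 S) l S'

variable {G}

theorem Run.append {D : Finset V} {p : ℕ} {l l' : List (V × V)} {S S' S'' : Finset V}
    (h : G.Run D p S l S') (h' : G.Run D p S' l' S'') : G.Run D p S (l ++ l') S'' := by
  induction l generalizing S with
  | nil => cases h; exact h'
  | cons e l ih =>
    obtain ⟨h1, h2, h3, h4, h5, h6⟩ := h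
    exact ⟨h1, h2, h3, h4, h5, ih h6⟩

theorem Run.mono {D : Finset V} {p q : ℕ} (hpq : p ≤ q) {l : List (V × V)} {S S' : Finset V}
    (h : G.Run D p S l S') : G.Run D q S l S' := by
  induction l generalizing S with
  | nil => exact h
  | cons e l ih =>
    obtain ⟨h1, h2, h3, h4, h5, h6⟩ := h
    exact ⟨h1, h2, h3, h4, h5.trans hpq, ih h6⟩

theorem Run.subset {D : Finset V} {p : ℕ} {l : List (V × V)} {S S' : Finset V}
    (h : G.Run D p S l S') : S ⊆ S' := by
  induction l generalizing S with
  | nil => cases h; exact subset_rfl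
  | cons e l ih => exact (Finset.subset_insert _ _).trans (ih h.2.2.2.2.2)

theorem Run.subset_right {D : Finset V} {p : ℕ} {l : List (V × V)} {S S' : Finset V}
    (h : G.Run D p S l S') (hS : S ⊆ D) : S' ⊆ D := by
  induction l generalizing S with
  | nil => cases h; exact hS
  | cons e l ih => exact ih h.2.2.2.2.2 (Finset.insert_subset h.2.1 hS)

/-! ### Tight sets and greedy sequences of blocks. -/

variable (G) in
/-- No subset of `X` that contains `B` has a cheaper guard than `X`. -/
def Tight (D B X : Finset V) : Prop := ∀ W, B ⊆ W → W ⊆ X → G.guard D X ≤ G.guard D W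

/-- For `W ⊇ B`, submodularity and the tightness of `X` against `X ∩ W` give that the guard of `X ∪
W` is at most that of `W`. So all sets of a run may be joined with `X` at no cost; the steps into
`X` are dropped. -/
theorem Tight.commit {D B X : Finset V} (hX : G.Tight D B X) {p : ℕ} {l : List (V × V)}
    {Y Z : Finset V} (hBX : B ⊆ X) (hBY : B ⊆ Y) (h : G.Run D p Y l Z) :
    (∃ l', G.Run D p (X ∪ Y) l' (X ∪ Z)) ∧ G.guard D (X ∪ Z) ≤ G.guard D Z := by
  have key : ∀ W, B ⊆ W → G.guard D (X ∪ W) ≤ G.guard D W := by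
    intro W hW
    have h1 := G.guard_submodular D X W
    have h2 := hX (X ∩ W) (Finset.subset_inter hBX hW) Finset.inter_subset_left
    omega
  refine ⟨?_, key _ (hBY.trans h.subset)⟩
  induction l generalizing Y with
  | nil => cases h; exact ⟨[], rfl⟩
  | cons e l ih =>
    obtain ⟨h1, h2, h3, h4, h5, h6⟩ := h
    have hB' : B ⊆ insert e.2 Y := hBY.trans (Finset.subset_insert _ _)
    obtain ⟨l', hl'⟩ := ih hB' h6
    by_cases he : e.2 ∈ X
    · refine ⟨l', ?_⟩
      rwa [Finset.union_insert, Finset.insert_eq_of_mem (Finset.mem_union_left _ he)] at hl'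
    · refine ⟨e :: l', Finset.mem_union_right _ h1, h2, by simp [he, h3], h4, ?_, ?_⟩
      · rw [← Finset.union_insert]
        have := key _ hB'
        omega
      · rwa [← Finset.union_insert]

/-- A part of an optimal order: it starts where a set of guard `sf` is clear, needs `sp` searchers,
and ends where the guard is less than `sf`. -/
structure Block (V : Type*) where
  sf : ℕ
  sp : ℕ
  steps : List (V × V)

variable (G) in
/-- `b` leads from `X` to `X'`, and no cheaper way from `X` to a set with a smaller guard exists. -/
structure Head (D B X : Finset V) (b : Block V) (X' : Finset V) : Prop where
  sf_eq : b.sf = G.guard D X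
  tight : G.Tight D B X
  minimal : ∀ h l Z, G.Run D h X l Z → G.guard D Z < G.guard D X → b.sp ≤ h
  run : G.Run D b.sp X b.steps X'
  lt : G.guard D X' < G.guard D X

variable (G) in
/-- The blocks form an optimal order for entering the vertices in `D \ X`. -/
def Good (D B : Finset V) : Finset V → List (Block V) → Prop
  | X, [] => X = D
  | X, b :: bs => ∃ X', G.Head D B X b X' ∧ Good D B X' bs

theorem Good.sf_le {D B X : Finset V} {bs : List (Block V)} (h : G.Good D B X bs) :
    ∀ b ∈ bs, b.sf ≤ G.guard D X := by
  induction bs generalizing X with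
  | nil => simp
  | cons a bs ih =>
    obtain ⟨X', h1, h2⟩ := h
    intro b hb
    rcases List.mem_cons.1 hb with rfl | hb
    · exact h1.sf_eq.le
    · exact (ih h2 b hb).trans h1.lt.le

/-- Each block lowers the guard strictly. This is what makes flattening a sequence of blocks to a
list of steps lose no block. -/
theorem Good.steps_ne_nil {D B X : Finset V} {bs : List (Block V)} (h : G.Good D B X bs) :
    ∀ b ∈ bs, b.steps ≠ [] := by
  induction bs generalizing X with
  | nil => simp
  | cons a bs ih =>
    obtain ⟨X', h1, h2⟩ := h
    intro b hb
    rcases List.mem_cons.1 hb with rfl | hb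
    · intro h0
      have h3 := h1.run
      rw [h0] at h3
      have h4 := h1.lt
      cases h3
      exact lt_irrefl _ h4
    · exact ih h2 b hb

theorem Good.run {D B X : Finset V} {bs : List (Block V)} (h : G.Good D B X bs) {p : ℕ}
    (hp : ∀ b ∈ bs, b.sp ≤ p) : G.Run D p X (bs.flatMap Block.steps) D := by
  induction bs generalizing X with
  | nil => exact h
  | cons a bs ih =>
    obtain ⟨X', h1, h2⟩ := h
    exact (h1.run.mono (hp a (by simp))).append (ih h2 fun b hb => hp b (by simp [hb]))

/-- The first block is covered by its minimality. For the later ones the run is joined with `X'`,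
the tight end of the first block; it then starts at `X'`, needs no more searchers, and ends with a
guard that is no larger. -/
theorem Good.sp_le {D B X : Finset V} {bs : List (Block V)} (h : G.Good D B X bs) (hX : B ⊆ X)
    {p : ℕ} {l : List (V × V)} {Z : Finset V} (hZ : G.Run D p X l Z) :
    ∀ b ∈ bs, G.guard D Z < b.sf → b.sp ≤ p := by
  induction bs generalizing X l Z with
  | nil => simp
  | cons a bs ih =>
    have h0 := h.sf_le
    obtain ⟨X', h1, h2⟩ := h
    intro b hb hb'
    have hXZ := hb'.trans_le (h0 b hb)
    rcases List.mem_cons.1 hb with rfl | hb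
    · exact h1.minimal p l Z hZ hXZ
    · have hXX' := h1.run.subset
      cases bs with
      | nil => simp at hb
      | cons c cs =>
        obtain ⟨X'', h3, -⟩ := id h2
        obtain ⟨⟨l', hl'⟩, hle⟩ := h3.tight.commit (hX.trans hXX') hX hZ
        rw [Finset.union_eq_left.2 hXX'] at hl'
        exact ih h2 (hX.trans hXX') hl' b hb (hle.trans_lt hb')

/-! ### Domains that consist of two parts joined by an edge. -/

variable (G) in
/-- `D` consists of two parts that are joined by the edge `uv` only. -/
structure Split (D Dv Du : Finset V) (v u : V) : Prop where
  union : D = Dv ∪ Du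
  disj : Disjoint Dv Du
  memv : v ∈ Dv
  memu : u ∈ Du
  adj : G.graph.Adj u v
  cross : ∀ x ∈ Dv, ∀ y ∈ Du, G.graph.Adj x y → x = v ∧ y = u

theorem Split.symm {D Dv Du : Finset V} {v u : V} (h : G.Split D Dv Du v u) :
    G.Split D Du Dv u v where
  union := by rw [h.union, Finset.union_comm]
  disj := h.disj.symm
  memv := h.memu
  memu := h.memv
  adj := h.adj.symm
  cross x hx y hy hxy := (h.cross y hy x hx hxy.symm).symm

/-- With both ends of the joining edge entered, that edge exposes no vertex, so a vertex is exposed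
in `D` exactly if it is exposed in its own part. -/
theorem Split.guard_union {D Dv Du : Finset V} {v u : V} (h : G.Split D Dv Du v u)
    {A B : Finset V} (hA : A ⊆ Dv) (hvA : v ∈ A) (hB : B ⊆ Du) (huB : u ∈ B) :
    G.guard D (A ∪ B) = G.guard Dv A + G.guard Du B := by
  classical
  have aux : ∀ {D Dv Du : Finset V} {v u : V}, G.Split D Dv Du v u → ∀ {A B : Finset V}, A ⊆ Dv →
      B ⊆ Du → u ∈ B → ∀ x ∈ A, ((∃ y ∈ D, G.graph.Adj x y ∧ y ∉ A ∪ B) ↔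
        ∃ y ∈ Dv, G.graph.Adj x y ∧ y ∉ A) := by
    intro D Dv Du v u h A B hA hB huB x hx
    constructor
    · rintro ⟨y, hy, hxy, hy'⟩
      simp only [Finset.mem_union, not_or] at hy'
      rw [h.union, Finset.mem_union] at hy
      rcases hy with hy | hy
      · exact ⟨y, hy, hxy, hy'.1⟩
      · have := (h.cross x (hA hx) y hy hxy).2
        exact absurd (this ▸ huB) hy'.2
    · rintro ⟨y, hy, hxy, hy'⟩
      refine ⟨y, h.union ▸ Finset.mem_union_left _ hy, hxy, ?_⟩
      simp only [Finset.mem_union, not_or]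
      exact ⟨hy', fun hb => Finset.disjoint_left.1 h.disj hy (hB hb)⟩
  unfold guard
  rw [← Finset.sum_add_distrib]
  refine Finset.sum_congr rfl fun x _ => ?_
  have hAB : x ∈ A → x ∉ B := fun ha hb => Finset.disjoint_left.1 h.disj (hA ha) (hB hb)
  by_cases ha : x ∈ A
  · have := aux h hA hB huB x ha
    simp [ha, hAB ha, this, -Finset.mem_union, Finset.mem_union_left]
  · by_cases hb : x ∈ B
    · have := aux h.symm hB hA hvA x hb
      rw [Finset.union_comm] at this
      simp [ha, hb, this, -Finset.mem_union, Finset.mem_union_right]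
    · simp [ha, hb]

theorem Split.run_left {D Dv Du : Finset V} {v u : V} (h : G.Split D Dv Du v u)
    {A B A' : Finset V} (hA : A ⊆ Dv) (hvA : v ∈ A) (hB : B ⊆ Du) (huB : u ∈ B) {p : ℕ}
    {l : List (V × V)} (hl : G.Run Dv p A l A') :
    G.Run D (p + G.guard Du B) (A ∪ B) l (A' ∪ B) := by
  induction l generalizing A with
  | nil => cases hl; rfl
  | cons e l ih =>
    obtain ⟨h1, h2, h3, h4, h5, h6⟩ := hl
    have hA' := Finset.insert_subset h2 hA
    refine ⟨Finset.mem_union_left _ h1, h.union ▸ Finset.mem_union_left _ h2, ?_, h4, ?_, ?_⟩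
    · simp only [Finset.mem_union, not_or]
      exact ⟨h3, fun hb => Finset.disjoint_left.1 h.disj h2 (hB hb)⟩
    · rw [← Finset.insert_union, h.guard_union hA' (Finset.mem_insert_of_mem hvA) hB huB]
      omega
    · rw [← Finset.insert_union]
      exact ih hA' (Finset.mem_insert_of_mem hvA) h6

/-- Each step of the run belongs to one part, and meanwhile the other part binds at least `b` or `a`
searchers. Thus `Dv` sees a run with `p - b` searchers and `Du` one with `p - a`, and `hra`, `hrb`
forbid the first fall of either guard below its bound. -/
theorem Split.guard_le {D Dv Du : Finset V} {v u : V} (h : G.Split D Dv Du v u) {p a b : ℕ}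
    {l : List (V × V)} {A B Z : Finset V} (hA : A ⊆ Dv) (hvA : v ∈ A) (hB : B ⊆ Du) (huB : u ∈ B)
    (ha : a ≤ G.guard Dv A) (hb : b ≤ G.guard Du B)
    (hra : b ≤ p → ∀ l Z, G.Run Dv (p - b) A l Z → a ≤ G.guard Dv Z)
    (hrb : a ≤ p → ∀ l Z, G.Run Du (p - a) B l Z → b ≤ G.guard Du Z)
    (hl : G.Run D p (A ∪ B) l Z) : a + b ≤ G.guard D Z := by
  induction l generalizing A B with
  | nil =>
    cases hl
    rw [h.guard_union hA hvA hB huB]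
    omega
  | cons e l ih =>
    obtain ⟨h1, h2, h3, h4, h5, h6⟩ := hl
    simp only [Finset.mem_union, not_or] at h3
    rw [h.union, Finset.mem_union] at h2
    rw [Finset.mem_union] at h1
    rcases h2 with h2 | h2
    · have hA' := Finset.insert_subset h2 hA
      have hvA' : v ∈ insert e.2 A := Finset.mem_insert_of_mem hvA
      rw [← Finset.insert_union] at h5 h6
      rw [h.guard_union hA' hvA' hB huB] at h5
      -- A step from `Du` into `Dv` could only enter `v`, which has been entered already.
      have h1' : e.1 ∈ A := by
        refine h1.resolve_right fun h1 => h3.1 ?_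
        rw [(h.cross _ h2 _ (hB h1) h4.symm).1]
        exact hvA
      have hbp : b ≤ p := by omega
      have step : G.Run Dv (p - b) A [e] (insert e.2 A) :=
        ⟨h1', h2, h3.1, h4, by omega, rfl⟩
      exact ih hA' hvA' hB huB (hra hbp _ _ step) hb
        (fun _ l Z hl => hra hbp _ _ (step.append hl)) hrb h6
    · have hB' := Finset.insert_subset h2 hB
      have huB' : u ∈ insert e.2 B := Finset.mem_insert_of_mem huB
      rw [← Finset.union_insert] at h5 h6
      rw [h.guard_union hA hvA hB' huB'] at h5
      have h1' : e.1 ∈ B := by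
        refine h1.resolve_left fun h1 => h3.2 ?_
        rw [(h.cross _ (hA h1) _ h2 h4).2]
        exact huB
      have hap : a ≤ p := by omega
      have step : G.Run Du (p - a) B [e] (insert e.2 B) :=
        ⟨h1', h2, h3.2, h4, by omega, rfl⟩
      exact ih hA hvA hB' huB' ha (hrb hap _ _ step) hra
        (fun _ l Z hl => hrb hap _ _ (step.append hl)) h6

theorem Split.tight {D Dv Du : Finset V} {v u : V} (h : G.Split D Dv Du v u) {A B : Finset V}
    (hA : A ⊆ Dv) (hvA : v ∈ A) (hB : B ⊆ Du) (huB : u ∈ B) (hA' : G.Tight Dv {v} A)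
    (hB' : G.Tight Du {u} B) : G.Tight D {u, v} (A ∪ B) := by
  intro W hW hW'
  have hu : u ∈ W := hW (by simp)
  have hv : v ∈ W := hW (by simp)
  have hWe : W = W ∩ A ∪ W ∩ B := by
    rw [← Finset.inter_union_distrib_left, Finset.inter_eq_left.2 hW']
  have h1 := hA' (W ∩ A) (by simp [hv, hvA]) Finset.inter_subset_right
  have h2 := hB' (W ∩ B) (by simp [hu, huB]) Finset.inter_subset_right
  rw [hWe, h.guard_union hA hvA hB huB, h.guard_union (Finset.inter_subset_right.trans hA)
    (by simp [hv, hvA]) (Finset.inter_subset_right.trans hB) (by simp [hu, huB])]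
  omega

/-- `hmin` says that no decrease in `Du` has a smaller surplus over the present guard than `a.sp`
has in `Dv`. With fewer searchers than claimed neither part can get below its present guard, so
`Split.guard_le` applies. -/
theorem Split.head_left {D Dv Du : Finset V} {v u : V} (h : G.Split D Dv Du v u)
    {A B A' : Finset V} {a : Block V} (hA : A ⊆ Dv) (hvA : v ∈ A) (hB : B ⊆ Du) (huB : u ∈ B)
    (ha : G.Head Dv {v} A a A') (hB' : G.Tight Du {u} B)
    (hmin : ∀ p l Z, G.Run Du p B l Z → G.guard Du Z < G.guard Du B →
      a.sp + G.guard Du B ≤ p + G.guard Dv A) :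
    G.Head D {u, v} (A ∪ B) ⟨a.sf + G.guard Du B, a.sp + G.guard Du B, a.steps⟩ (A' ∪ B) where
  sf_eq := by rw [h.guard_union hA hvA hB huB, ha.sf_eq]
  tight := h.tight hA hvA hB huB ha.tight hB'
  minimal p l Z hl hlt := by
    by_contra hcon
    refine absurd (h.guard_le hA hvA hB huB le_rfl le_rfl ?_ ?_ hl) ?_
    · intro h0 l Z hl
      by_contra hlt
      have := ha.minimal _ l Z hl (by omega)
      simp only at hcon
      omega
    · intro h0 l Z hl
      by_contra hlt
      have := hmin _ l Z hl (by omega)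
      simp only at hcon
      omega
    · rw [h.guard_union hA hvA hB huB] at hlt
      omega
  run := h.run_left hA hvA hB huB ha.run
  lt := by
    have h1 := ha.run.subset
    rw [h.guard_union hA hvA hB huB, h.guard_union (ha.run.subset_right hA) (h1 hvA) hB huB]
    have := ha.lt
    omega

/-! ### Merging the greedy sequences of two parts. -/

theorem tight_self (D B : Finset V) : G.Tight D B D := by
  intro W _ _
  rw [guard_self]
  exact Nat.zero_le _

theorem Good.tight {D B X : Finset V} {bs : List (Block V)} (h : G.Good D B X bs) :
    G.Tight D B X := by
  cases bs with
  | nil => cases h; exact tight_self _ _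
  | cons a bs => obtain ⟨X', h1, -⟩ := h; exact h1.tight

/-- Interleave optimal orders for two independent parts. -/
def mergeBlocks : List (Block V) → List (Block V) → List (Block V)
  | [], Q => Q
  | P, [] => P
  | a :: P, b :: Q =>
    if a.sp + b.sf ≤ b.sp + a.sf then
      ⟨a.sf + b.sf, a.sp + b.sf, a.steps⟩ :: mergeBlocks P (b :: Q)
    else
      ⟨b.sf + a.sf, b.sp + a.sf, b.steps⟩ :: mergeBlocks (a :: P) Q
termination_by P Q => P.length + Q.length

theorem mergeBlocks_nil_right (P : List (Block V)) : mergeBlocks P [] = P := by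
  cases P <;> rw [mergeBlocks]
  simp

/-- The present guard of a part is the `sf` of its next block, or 0 if the part is complete. Hence
the test in `mergeBlocks` compares surpluses, and the minimality of the block not taken is the
hypothesis `hmin` of `Split.head_left`. -/
theorem Split.good_merge {D Dv Du : Finset V} {v u : V} (h : G.Split D Dv Du v u)
    {P Q : List (Block V)} {A B : Finset V} (hA : A ⊆ Dv) (hvA : v ∈ A) (hB : B ⊆ Du) (huB : u ∈ B)
    (hP : G.Good Dv {v} A P) (hQ : G.Good Du {u} B Q) :
    G.Good D {u, v} (A ∪ B) (mergeBlocks P Q) := by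
  induction hn : P.length + Q.length using Nat.strong_induction_on generalizing P Q A B with
  | _ n ih =>
  subst hn
  have left : ∀ (a : Block V) (P' : List (Block V)), P = a :: P' →
      (∀ p l Z, G.Run Du p B l Z → G.guard Du Z < G.guard Du B →
        a.sp + G.guard Du B ≤ p + G.guard Dv A) →
      G.Good D {u, v} (A ∪ B)
        (⟨a.sf + G.guard Du B, a.sp + G.guard Du B, a.steps⟩ :: mergeBlocks P' Q) := by
    rintro a P' rfl hmin
    obtain ⟨A', h1, h2⟩ := hP
    exact ⟨A' ∪ B, h.head_left hA hvA hB huB h1 hQ.tight hmin,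
      ih _ (by simp) (h1.run.subset_right hA) (h1.run.subset hvA) hB huB h2 hQ rfl⟩
  have right : ∀ (b : Block V) (Q' : List (Block V)), Q = b :: Q' →
      (∀ p l Z, G.Run Dv p A l Z → G.guard Dv Z < G.guard Dv A →
        b.sp + G.guard Dv A ≤ p + G.guard Du B) →
      G.Good D {u, v} (A ∪ B)
        (⟨b.sf + G.guard Dv A, b.sp + G.guard Dv A, b.steps⟩ :: mergeBlocks P Q') := by
    rintro b Q' rfl hmin
    obtain ⟨B', h1, h2⟩ := hQ
    refine ⟨A ∪ B', ?_, ih _ (by simp) hA hvA (h1.run.subset_right hB) (h1.run.subset huB) hP h2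
      rfl⟩
    rw [Finset.union_comm A B, Finset.union_comm A B', Finset.pair_comm]
    exact h.symm.head_left hB huB hA hvA h1 hP.tight hmin
  cases P with
  | nil =>
    cases Q with
    | nil =>
      rw [mergeBlocks]
      have h1 : A = Dv := hP
      have h2 : B = Du := hQ
      rw [h1, h2]
      exact h.union.symm
    | cons b Q =>
      have hA0 : A = Dv := hP
      have := right b Q rfl (by
        intro p l Z _ hlt
        rw [hA0, guard_self] at hlt
        exact absurd hlt (by simp))
      rw [mergeBlocks] at this ⊢
      simpa [hA0, guard_self] using this
  | cons a P =>
    obtain ⟨A', h1, h2⟩ := id hP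
    cases Q with
    | nil =>
      have hB0 : B = Du := hQ
      have := left a P rfl (by
        intro p l Z _ hlt
        rw [hB0, guard_self] at hlt
        exact absurd hlt (by simp))
      rw [mergeBlocks_nil_right] at this ⊢
      simpa [hB0, guard_self] using this
    | cons b Q =>
      obtain ⟨B', h3, h4⟩ := id hQ
      rw [mergeBlocks]
      split_ifs with hc
      · rw [h3.sf_eq]
        refine left a P rfl fun p l Z hl hlt => ?_
        have := h3.minimal p l Z hl hlt
        rw [h3.sf_eq, h1.sf_eq] at hc
        omega
      · rw [h1.sf_eq]
        refine right b Q rfl fun p l Z hl hlt => ?_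
        have := h1.minimal p l Z hl hlt
        rw [h3.sf_eq, h1.sf_eq] at hc
        omega

/-! ### Adding the first step of an order. -/

theorem Good.enlarge {D B B' X : Finset V} {bs : List (Block V)} {c : ℕ}
    (h : G.Good D B X bs) (hX : G.guard D X < c)
    (hc : ∀ W, B' ⊆ W → ¬ B ⊆ W → c ≤ G.guard D W) : G.Good D B' X bs := by
  induction bs generalizing X with
  | nil => exact h
  | cons a bs ih =>
    obtain ⟨X', h1, h2⟩ := h
    refine ⟨X', ⟨h1.sf_eq, ?_, h1.minimal, h1.run, h1.lt⟩, ih h2 (h1.lt.trans hX)⟩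
    intro W hW hWX
    by_cases hBW : B ⊆ W
    · exact h1.tight W hBW hWX
    · exact hX.le.trans (hc W hW hBW)

theorem Good.exists_run_takeWhile {D B X : Finset V} {bs : List (Block V)} {c p : ℕ} (hc : 0 < c)
    (h : G.Good D B X bs) (hp : ∀ b ∈ bs, c ≤ b.sf → b.sp ≤ p) :
    ∃ X', G.Run D p X ((bs.takeWhile fun b => c ≤ b.sf).flatMap Block.steps) X' ∧
      G.Good D B X' (bs.dropWhile fun b => c ≤ b.sf) ∧ G.guard D X' < c := by
  induction bs generalizing X with
  | nil => exact ⟨X, rfl, h, by cases h; rwa [guard_self]⟩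
  | cons a bs ih =>
    by_cases ha : c ≤ a.sf
    · obtain ⟨X', h1, h2⟩ := h
      obtain ⟨X'', h3, h4, h5⟩ := ih h2 fun b hb => hp b (by simp [hb])
      refine ⟨X'', ?_, ?_, h5⟩
      · rw [List.takeWhile_cons_of_pos (by simpa using ha)]
        exact (h1.run.mono (hp a (by simp) ha)).append h3
      · rwa [List.dropWhile_cons_of_pos (by simpa using ha)]
    · refine ⟨X, ?_, ?_, ?_⟩
      · rw [List.takeWhile_cons_of_neg (by simpa using ha)]
        rfl
      · rwa [List.dropWhile_cons_of_neg (by simpa using ha)]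
      · obtain ⟨X', h1, -⟩ := h
        rw [← h1.sf_eq]
        omega

/-- Enter the neighbor `v` of `u` first, then proceed as in `bs`. All blocks that start with a guard
of at least `c` become one block. -/
def absorb (u v : V) (c q : ℕ) (bs : List (Block V)) : List (Block V) :=
  ⟨c, q, (u, v) :: (bs.takeWhile fun b => c ≤ b.sf).flatMap Block.steps⟩ ::
    bs.dropWhile fun b => c ≤ b.sf

theorem guard_singleton {D : Finset V} {u v : V} (hv : v ∈ D) (huv : G.graph.Adj u v) :
    G.guard D {u} = G.vw u := by
  classical
  unfold guard
  rw [Finset.sum_eq_single u]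
  · exact if_pos ⟨by simp, v, hv, huv, by simpa using huv.ne'⟩
  · intro b _ hb
    exact if_neg fun h => hb (by simpa using h.1)
  · simp

/-- The guard of `{u}` is w(u). A run that gets below it must first enter some neighbour `v'` and
then overcome all blocks for `{u, v'}` with `sf` at least w(u). Together with the first step these
form one block, and `hmin` says that `v` makes it cheapest. The remaining blocks start below w(u),
where sets without `v` cannot compete. -/
theorem good_absorb {D : Finset V} {u v : V} {q : ℕ} {bs : List (Block V)} (hv : v ∈ D)
    (huv : G.graph.Adj u v) (hbs : G.Good D {u, v} {u, v} bs)
    (hq : G.guard D {u, v} + G.slack u v ≤ q) (hq' : ∀ b ∈ bs, G.vw u ≤ b.sf → b.sp ≤ q)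
    (hmin : ∀ v' ∈ D, G.graph.Adj u v' → ∃ bs', G.Good D {u, v'} {u, v'} bs' ∧
      ∀ h, G.guard D {u, v'} + G.slack u v' ≤ h → (∀ b ∈ bs', G.vw u ≤ b.sf → b.sp ≤ h) → q ≤ h) :
    G.Good D {u} {u} (absorb u v (G.vw u) q bs) := by
  have hu := guard_singleton hv huv
  obtain ⟨X', h1, h2, h3⟩ := hbs.exists_run_takeWhile (G.vw_pos u) hq'
  refine ⟨X', ⟨hu.symm, ?_, ?_, ?_, by rwa [hu]⟩, h2.enlarge h3 ?_⟩
  · intro W h1 h2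
    rw [h1.antisymm h2]
  · intro h l Z hl hlt
    cases l with
    | nil => cases hl; exact absurd hlt (lt_irrefl _)
    | cons e l =>
      obtain ⟨g1, g2, g3, g4, g5, g6⟩ := hl
      rw [Finset.mem_singleton] at g1
      rw [g1] at g4 g5
      rw [Finset.pair_comm e.2 u] at g5 g6
      obtain ⟨bs', hbs', hh⟩ := hmin _ g2 g4
      refine hh h g5 fun b hb hub => hbs'.sp_le subset_rfl g6 b hb ?_
      rw [hu] at hlt
      exact hlt.trans_le hub
  · refine ⟨by simp, hv, by simpa using huv.ne', huv, ?_, ?_⟩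
    · rwa [Finset.pair_comm u v] at hq
    · rwa [Finset.pair_comm u v] at h1
  · intro W hW hW'
    have huW : u ∈ W := hW (by simp)
    refine G.vw_le_guard huW hv (fun hvW => hW' ?_) huv
    intro x hx
    rcases Finset.mem_insert.1 hx with rfl | hx
    · exact huW
    · rw [Finset.mem_singleton.1 hx]; exact hvW

end WeightedGraph

/-! ## Merging optimal orders step by step -/

namespace WeightedGraph

/-- A step of an order: `y` is entered from `x`; the step belongs to a block that starts with a
guard of `sf` and needs `sp` searchers. -/
structure Stp (V : Type*) where
  x : V
  y : V
  sf : ℕ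
  sp : ℕ

section Steps

variable {V : Type*}

/-- The steps of a list of blocks. -/
def flatten (bs : List (Block V)) : List (Stp V) :=
  bs.flatMap fun b => b.steps.map fun e => ⟨e.1, e.2, b.sf, b.sp⟩

/-- The guard at the start of a list of steps. -/
def headSf : List (Stp V) → ℕ
  | [] => 0
  | a :: _ => a.sf

/-- Interleave the steps of optimal orders for two independent parts. -/
def mergeSteps : List (Stp V) → List (Stp V) → List (Stp V)
  | [], Q => Q
  | P, [] => P
  | a :: P, b :: Q =>
    if a.sp + b.sf ≤ b.sp + a.sf then
      ⟨a.x, a.y, a.sf + b.sf, a.sp + b.sf⟩ :: mergeSteps P (b :: Q)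
    else
      ⟨b.x, b.y, a.sf + b.sf, b.sp + a.sf⟩ :: mergeSteps (a :: P) Q
termination_by P Q => P.length + Q.length

theorem mergeSteps_nil_right (P : List (Stp V)) : mergeSteps P [] = P := by
  cases P <;> rw [mergeSteps]
  simp

theorem length_mergeSteps (P Q : List (Stp V)) :
    (mergeSteps P Q).length = P.length + Q.length := by
  fun_induction mergeSteps P Q <;> simp_all <;> omega

theorem flatten_cons (b : Block V) (bs : List (Block V)) :
    flatten (b :: bs) = (b.steps.map fun e => ⟨e.1, e.2, b.sf, b.sp⟩) ++ flatten bs := rfl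

theorem mergeSteps_left (s : List (V × V)) (sf sp : ℕ) (P : List (Stp V)) (b : Stp V)
    (Q : List (Stp V)) (h : sp + b.sf ≤ b.sp + sf) :
    mergeSteps ((s.map fun e => ⟨e.1, e.2, sf, sp⟩) ++ P) (b :: Q) =
      (s.map fun e => ⟨e.1, e.2, sf + b.sf, sp + b.sf⟩) ++ mergeSteps P (b :: Q) := by
  induction s with
  | nil => rfl
  | cons e s ih =>
    simp only [List.map_cons, List.cons_append]
    rw [mergeSteps, if_pos h, ih]

theorem mergeSteps_right (s : List (V × V)) (sf sp : ℕ) (a : Stp V) (P : List (Stp V))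
    (Q : List (Stp V)) (h : ¬ a.sp + sf ≤ sp + a.sf) :
    mergeSteps (a :: P) ((s.map fun e => ⟨e.1, e.2, sf, sp⟩) ++ Q) =
      (s.map fun e => ⟨e.1, e.2, sf + a.sf, sp + a.sf⟩) ++ mergeSteps (a :: P) Q := by
  induction s with
  | nil => rfl
  | cons e s ih =>
    simp only [List.map_cons, List.cons_append]
    rw [mergeSteps, if_neg h, ih, add_comm sf]

/-- All steps of a block carry the same `sf` and `sp`, so the comparison has the same outcome until
the block is used up. No block may be empty, since the comparison reads the first step of the
opposite block. -/
theorem flatten_mergeBlocks (P Q : List (Block V)) (hP : ∀ b ∈ P, b.steps ≠ [])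
    (hQ : ∀ b ∈ Q, b.steps ≠ []) :
    flatten (mergeBlocks P Q) = mergeSteps (flatten P) (flatten Q) := by
  fun_induction mergeBlocks P Q with
  | case1 Q => simp [flatten, mergeSteps]
  | case2 P hP' => rw [show flatten ([] : List (Block V)) = [] from rfl, mergeSteps_nil_right]
  | case3 a P b Q h ih =>
    rw [flatten_cons, ih (fun x hx => hP x (by simp [hx])) hQ, flatten_cons a]
    obtain ⟨e, s, hs⟩ := List.exists_cons_of_ne_nil (hQ b (by simp))
    have : flatten (b :: Q) = ⟨e.1, e.2, b.sf, b.sp⟩ ::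
      ((s.map fun e => ⟨e.1, e.2, b.sf, b.sp⟩) ++ flatten Q) := by
      rw [flatten_cons, hs]; rfl
    rw [this, mergeSteps_left _ _ _ _ _ _ h]
  | case4 a P b Q h ih =>
    rw [flatten_cons, ih hP (fun x hx => hQ x (by simp [hx])), flatten_cons b]
    obtain ⟨e, s, hs⟩ := List.exists_cons_of_ne_nil (hP a (by simp))
    have : flatten (a :: P) = ⟨e.1, e.2, a.sf, a.sp⟩ ::
      ((s.map fun e => ⟨e.1, e.2, a.sf, a.sp⟩) ++ flatten P) := by
      rw [flatten_cons, hs]; rfl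
    rw [this, mergeSteps_right _ _ _ _ _ _ h]

/-- The largest `sp` of the steps with `sf` at least `c`, and at least `q`. -/
def peakFrom (c q : ℕ) (l : List (Stp V)) : ℕ :=
  l.foldl (fun q s => if c ≤ s.sf then max q s.sp else q) q

theorem peakFrom_le_iff {c q h : ℕ} {l : List (Stp V)} :
    peakFrom c q l ≤ h ↔ q ≤ h ∧ ∀ s ∈ l, c ≤ s.sf → s.sp ≤ h := by
  induction l generalizing q with
  | nil => simp [peakFrom]
  | cons s l ih =>
    have : peakFrom c q (s :: l) = peakFrom c (if c ≤ s.sf then max q s.sp else q) l := rfl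
    rw [this, ih]
    split_ifs with hs <;> simp [hs, and_assoc]

/-- Mark the steps with `sf` at least `c` as belonging to a first block that starts with `c` and
needs `q` searchers. -/
def raise (c q : ℕ) (s : Stp V) : Stp V := if c ≤ s.sf then ⟨s.x, s.y, c, q⟩ else s

/-- The order that enters `v` from `u` with `e` searchers and then proceeds as in `l`. -/
def candidate (u v : V) (c e : ℕ) (l : List (Stp V)) : List (Stp V) :=
  ⟨u, v, c, peakFrom c e l⟩ :: l.map (raise c (peakFrom c e l))

/-- By `h`, the blocks with `sf` at least `c` form an initial segment; cutting it off can therefore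
be replaced by a test on each single step, which is what the program does. -/
theorem flatten_absorb (u v : V) (c q : ℕ) (bs : List (Block V))
    (h : ∀ b ∈ bs.dropWhile (fun b => c ≤ b.sf), b.sf < c) :
    flatten (absorb u v c q bs) = ⟨u, v, c, q⟩ :: (flatten bs).map (raise c q) := by
  rw [absorb, flatten_cons, List.map_cons, List.cons_append]
  congr 1
  induction bs with
  | nil => rfl
  | cons a bs ih =>
    by_cases ha : c ≤ a.sf
    · rw [List.dropWhile_cons_of_pos (by simpa using ha)] at h ⊢
      rw [List.takeWhile_cons_of_pos (by simpa using ha), List.flatMap_cons, List.map_append,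
        List.append_assoc, ih h, flatten_cons, List.map_append, List.map_map]
      congr 1
      exact List.map_congr_left fun e _ => by simp [raise, ha]
    · rw [List.dropWhile_cons_of_neg (by simpa using ha)] at h ⊢
      rw [List.takeWhile_cons_of_neg (by simpa using ha)]
      simp only [List.flatMap_nil, List.map_nil, List.nil_append]
      conv_lhs => rw [← List.map_id (flatten (a :: bs))]
      refine List.map_congr_left fun s hs => ?_
      obtain ⟨b, hb, hs⟩ := List.mem_flatMap.1 hs
      obtain ⟨e, -, rfl⟩ := List.mem_map.1 hs
      simp [raise, h b hb]

end Steps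

variable {V : Type*} [Fintype V] [DecidableEq V] {G : WeightedGraph V}

theorem Good.dropWhile_lt {D B X : Finset V} {bs : List (Block V)} (h : G.Good D B X bs) (c : ℕ) :
    ∀ b ∈ bs.dropWhile (fun b => c ≤ b.sf), b.sf < c := by
  induction bs generalizing X with
  | nil => simp
  | cons a bs ih =>
    have h0 := h.sf_le
    obtain ⟨X', h1, h2⟩ := h
    by_cases ha : c ≤ a.sf
    · rw [List.dropWhile_cons_of_pos (by simpa using ha)]
      exact ih h2
    · rw [List.dropWhile_cons_of_neg (by simpa using ha)]
      intro b hb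
      have := h0 b hb
      rw [← h1.sf_eq] at this
      omega

theorem forall_mem_flatten {bs : List (Block V)} (h : ∀ b ∈ bs, b.steps ≠ []) {p : ℕ → ℕ → Prop} :
    (∀ s ∈ flatten bs, p s.sf s.sp) ↔ ∀ b ∈ bs, p b.sf b.sp := by
  constructor
  · intro H b hb
    obtain ⟨e, s, hs⟩ := List.exists_cons_of_ne_nil (h b hb)
    exact H ⟨e.1, e.2, b.sf, b.sp⟩ (List.mem_flatMap.2 ⟨b, hb, by simp [hs]⟩)
  · intro H s hs
    obtain ⟨b, hb, hs⟩ := List.mem_flatMap.1 hs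
    obtain ⟨e, -, rfl⟩ := List.mem_map.1 hs
    exact H b hb

/-! ### Branches of a tree and the domains of the recursion. -/

variable (G) in
open Classical in
/-- The neighbors of a vertex. -/
noncomputable def nbrs (u : V) : Finset V := Finset.univ.filter (G.graph.Adj u)

variable (G) in
open Classical in
/-- The vertices on the side of `v` of the edge `uv` of a tree. -/
noncomputable def branch (u v : V) : Finset V :=
  Finset.univ.filter fun x => (G.graph.deleteEdges {s(u, v)}).Reachable v x

variable (G) in
/-- The vertex `u` and the branches at its neighbors in `R`. -/
noncomputable def dom (u : V) (R : Finset V) : Finset V := insert u (R.biUnion (G.branch u))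

theorem mem_nbrs {u v : V} : v ∈ G.nbrs u ↔ G.graph.Adj u v := by simp [nbrs]

theorem mem_branch {u v x : V} :
    x ∈ G.branch u v ↔ (G.graph.deleteEdges {s(u, v)}).Reachable v x := by simp [branch]

theorem self_mem_branch (u v : V) : v ∈ G.branch u v := mem_branch.2 (SimpleGraph.Reachable.refl _)

theorem notMem_branch (hT : G.graph.IsTree) {u v : V} (h : G.graph.Adj u v) : u ∉ G.branch u v := by
  rw [mem_branch]
  intro h'
  exact SimpleGraph.isAcyclic_iff_forall_adj_isBridge.1 hT.isAcyclic h h'.symm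

theorem branch_leave (hT : G.graph.IsTree) {u v x y : V} (h : G.graph.Adj u v)
    (hx : x ∈ G.branch u v) (hxy : G.graph.Adj x y) (hy : y ∉ G.branch u v) : x = v ∧ y = u := by
  by_cases he : s(x, y) = s(u, v)
  · rcases Sym2.eq_iff.1 he with ⟨rfl, rfl⟩ | ⟨rfl, rfl⟩
    · exact absurd hx (notMem_branch hT h)
    · exact ⟨rfl, rfl⟩
  · refine absurd (mem_branch.2 ((mem_branch.1 hx).trans (SimpleGraph.Adj.reachable ?_))) hy
    rw [SimpleGraph.deleteEdges_adj]
    exact ⟨hxy, he⟩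

theorem exists_boundary (hT : G.graph.IsTree) {A : Finset V} {a b : V} (ha : a ∈ A) (hb : b ∉ A) :
    ∃ x ∈ A, ∃ y ∉ A, G.graph.Adj x y := by
  obtain ⟨p⟩ := hT.connected a b
  obtain ⟨d, -, h1, h2⟩ := p.exists_boundary_dart (A : Set V) ha hb
  exact ⟨d.fst, h1, d.snd, h2, d.adj⟩

/-- On a walk from a common vertex to `u`, the edge that leaves the intersection would have to be
both `uv` and `uv'`. -/
theorem disjoint_branch (hT : G.graph.IsTree) {u v v' : V} (h : G.graph.Adj u v)
    (h' : G.graph.Adj u v') (hv : v ≠ v') : Disjoint (G.branch u v) (G.branch u v') := by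
  rw [Finset.disjoint_left]
  intro a ha ha'
  obtain ⟨x, hx, y, hy, hxy⟩ := exists_boundary hT (A := G.branch u v ∩ G.branch u v') (a := a)
    (b := u) (Finset.mem_inter.2 ⟨ha, ha'⟩) fun hu =>
      notMem_branch hT h (Finset.mem_inter.1 hu).1
  rw [Finset.mem_inter] at hx hy
  have key : ∀ {v v' : V}, G.graph.Adj u v → G.graph.Adj u v' → v ≠ v' → x ∈ G.branch u v →
      x ∈ G.branch u v' → y ∉ G.branch u v → False := by
    intro v v' h h' hv hx hx' hy
    obtain ⟨rfl, rfl⟩ := branch_leave hT h hx hxy hy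
    exact hv (branch_leave hT h' hx' hxy (notMem_branch hT h')).1
  by_cases hy1 : y ∈ G.branch u v
  · exact key h' h hv.symm hx.2 hx.1 fun hy2 => hy ⟨hy1, hy2⟩
  · exact key h h' hv hx.1 hx.2 hy1

theorem mem_branch_or (hT : G.graph.IsTree) {u v : V} (h : G.graph.Adj u v) (x : V) :
    x ∈ G.branch u v ∨ x ∈ G.branch v u := by
  rw [← Finset.mem_union]
  by_contra hx
  obtain ⟨a, ha, b, hb, hab⟩ := exists_boundary hT (A := G.branch u v ∪ G.branch v u)
    (Finset.mem_union_left _ (self_mem_branch u v)) hx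
  rw [Finset.mem_union] at ha hb
  push Not at hb
  rcases ha with ha | ha
  · refine hb.2 ?_
    rw [(branch_leave hT h ha hab hb.1).2]
    exact self_mem_branch v u
  · refine hb.1 ?_
    rw [(branch_leave hT h.symm ha hab hb.2).2]
    exact self_mem_branch u v

theorem notMem_branch_swap (hT : G.graph.IsTree) {u v x : V} (h : G.graph.Adj u v)
    (hx : x ∈ G.branch u v) : x ∉ G.branch v u := by
  intro hx'
  rw [mem_branch] at hx hx'
  rw [Sym2.eq_swap] at hx'
  exact notMem_branch hT h (mem_branch.2 (hx.trans hx'.symm))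

theorem dom_nbrs (hT : G.graph.IsTree) (u : V) : G.dom u (G.nbrs u) = Finset.univ := by
  rw [Finset.eq_univ_iff_forall]
  by_contra! hx
  obtain ⟨x, hx⟩ := hx
  obtain ⟨a, ha, b, hb, hab⟩ := exists_boundary hT (A := G.dom u (G.nbrs u))
    (Finset.mem_insert_self _ _) hx
  simp only [dom, Finset.mem_insert, Finset.mem_biUnion, mem_nbrs, not_or, not_exists,
    not_and] at ha hb
  rcases ha with rfl | ⟨v, hv, ha⟩
  · exact hb.2 b hab (self_mem_branch a b)
  · exact hb.1 (branch_leave hT hv ha hab (hb.2 v hv)).2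

/-- This closes the recursion: the branches of a domain are domains again. -/
theorem branch_eq_dom (hT : G.graph.IsTree) {u v : V} (h : G.graph.Adj u v) :
    G.branch u v = G.dom v ((G.nbrs v).erase u) := by
  ext x
  simp only [dom, Finset.mem_insert, Finset.mem_biUnion, Finset.mem_erase, mem_nbrs]
  constructor
  · intro hx
    have := Finset.mem_univ x
    rw [← dom_nbrs hT v] at this
    simp only [dom, Finset.mem_insert, Finset.mem_biUnion, mem_nbrs] at this
    rcases this with rfl | ⟨y, hy, hxy⟩
    · exact Or.inl rfl
    · refine Or.inr ⟨y, ⟨?_, hy⟩, hxy⟩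
      rintro rfl
      exact notMem_branch_swap hT h hx hxy
  · rintro (rfl | ⟨y, ⟨hy, hy'⟩, hxy⟩)
    · exact self_mem_branch u x
    · refine (mem_branch_or hT h x).resolve_right fun hx => ?_
      exact Finset.disjoint_left.1 (disjoint_branch hT hy' h.symm hy) hxy hx

theorem dom_split (hT : G.graph.IsTree) {u v : V} {R : Finset V} (hR : R ⊆ G.nbrs u) (hv : v ∈ R) :
    G.Split (G.dom u R) (G.dom v ((G.nbrs v).erase u)) (G.dom u (R.erase v)) v u := by
  have huv := mem_nbrs.1 (hR hv)
  rw [← branch_eq_dom hT huv]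
  have hd : Disjoint (G.branch u v) (G.dom u (R.erase v)) := by
    rw [Finset.disjoint_left]
    intro x hx hx'
    simp only [dom, Finset.mem_insert, Finset.mem_biUnion, Finset.mem_erase] at hx'
    rcases hx' with rfl | ⟨w, ⟨hw, hw'⟩, hx'⟩
    · exact notMem_branch hT huv hx
    · exact Finset.disjoint_left.1 (disjoint_branch hT (mem_nbrs.1 (hR hw')) huv hw) hx' hx
  refine ⟨?_, hd, self_mem_branch u v, Finset.mem_insert_self _ _, huv, ?_⟩
  · rw [dom, dom, Finset.union_insert, ← Finset.biUnion_insert, Finset.insert_erase hv]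
  · intro x hx y hy hxy
    exact branch_leave hT huv hx hxy (Finset.disjoint_right.1 hd hy)

theorem card_dom (hT : G.graph.IsTree) {u v : V} {R : Finset V} (hR : R ⊆ G.nbrs u) (hv : v ∈ R) :
    (G.dom u R).card = (G.dom v ((G.nbrs v).erase u)).card + (G.dom u (R.erase v)).card := by
  have h := dom_split hT hR hv
  rw [h.union, Finset.card_union_of_disjoint h.disj]

theorem card_dom_pos (u : V) (R : Finset V) : 0 < (G.dom u R).card :=
  Finset.card_pos.2 ⟨u, Finset.mem_insert_self _ _⟩

theorem entry_eq_guard {u v : V} (h : G.graph.Adj u v) :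
    G.guard (G.dom v ((G.nbrs v).erase u)) {v} = G.entry v := by
  have hn : (G.graph.neighborSet v).ncard = (G.nbrs v).card := by
    rw [← Set.ncard_coe_finset]
    congr 1
    ext x
    simp [mem_nbrs]
  have hu : u ∈ G.nbrs v := mem_nbrs.2 h.symm
  rw [entry, hn]
  split_ifs with hc
  · have : (G.nbrs v).erase u = ∅ := by
      rw [← Finset.card_eq_zero, Finset.card_erase_of_mem hu]
      omega
    rw [this]
    simp [dom, guard_self]
  · have : ((G.nbrs v).erase u).Nonempty := by
      rw [← Finset.card_pos, Finset.card_erase_of_mem hu]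
      omega
    obtain ⟨y, hy⟩ := this
    refine guard_singleton (v := y) ?_ (mem_nbrs.1 (Finset.mem_of_mem_erase hy))
    exact Finset.mem_insert_of_mem (Finset.mem_biUnion.2 ⟨y, hy, self_mem_branch v y⟩)

/-! ### Optimal orders for a vertex and some of its branches. -/

variable (G) in
/-- `l` is an optimal order for the vertex `u` and the branches at its neighbors in `R`. -/
def Optimal (u : V) (R : Finset V) (l : List (Stp V)) : Prop :=
  ∃ bs, l = flatten bs ∧ G.Good (G.dom u R) {u} {u} bs

theorem optimal_empty (u : V) : G.Optimal u ∅ [] := ⟨[], rfl, by simp [Good, dom]⟩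

variable (G) in
/-- The number of searchers needed for entering `v` from `u`, before the other vertices of `R`. -/
noncomputable def enterPeak (u v : V) (R : Finset V) : ℕ :=
  (if (R.erase v).card = 0 then 0 else G.vw u) + G.entry v + (G.ew s(u, v) - G.entry v)

theorem enterPeak_eq (hT : G.graph.IsTree) {u v : V} {R : Finset V} (hR : R ⊆ G.nbrs u)
    (hv : v ∈ R) : G.enterPeak u v R = G.guard (G.dom u R) {u, v} + G.slack u v := by
  have h := dom_split hT hR hv
  have h1 := h.guard_union (A := {v}) (B := {u}) (by simpa using h.memv) (by simp)
    (by simpa using h.memu) (by simp)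
  rw [entry_eq_guard h.adj] at h1
  rw [Finset.pair_comm, show ({v, u} : Finset V) = {v} ∪ {u} from rfl, h1, enterPeak, slack]
  have : (if (R.erase v).card = 0 then 0 else G.vw u) = G.guard (G.dom u (R.erase v)) {u} := by
    split_ifs with hc
    · rw [Finset.card_eq_zero] at hc
      rw [hc]
      simp [dom, guard_self]
    · obtain ⟨y, hy⟩ := Finset.card_pos.1 (Nat.pos_of_ne_zero hc)
      symm
      refine guard_singleton (v := y) ?_ (mem_nbrs.1 (hR (Finset.mem_of_mem_erase hy)))
      exact Finset.mem_insert_of_mem (Finset.mem_biUnion.2 ⟨y, hy, self_mem_branch u y⟩)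
  rw [this]
  omega

/-- For each possible first neighbour `w`, `Split.good_merge` provides the greedy sequence after `u`
and `w`, and `peakFrom` is the price that `good_absorb` asks to minimize. A neighbour of `u` in the
domain belongs to `R`, so it suffices to compare the elements of `R`. -/
theorem optimal_candidate (hT : G.graph.IsTree) {u v : V} {R : Finset V} (hR : R ⊆ G.nbrs u)
    (hv : v ∈ R) {P Q : V → List (Stp V)}
    (hP : ∀ w ∈ R, G.Optimal w ((G.nbrs w).erase u) (P w))
    (hQ : ∀ w ∈ R, G.Optimal u (R.erase w) (Q w))
    (hmin : ∀ w ∈ R, peakFrom (G.vw u) (G.enterPeak u v R) (mergeSteps (P v) (Q v)) ≤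
      peakFrom (G.vw u) (G.enterPeak u w R) (mergeSteps (P w) (Q w))) :
    G.Optimal u R (candidate u v (G.vw u) (G.enterPeak u v R) (mergeSteps (P v) (Q v))) := by
  have key : ∀ w ∈ R, ∃ bs, mergeSteps (P w) (Q w) = flatten bs ∧
      G.Good (G.dom u R) {u, w} {u, w} bs := by
    intro w hw
    obtain ⟨ps, hps, hps'⟩ := hP w hw
    obtain ⟨qs, hqs, hqs'⟩ := hQ w hw
    have h := dom_split hT hR hw
    refine ⟨mergeBlocks ps qs, ?_, ?_⟩
    · rw [flatten_mergeBlocks _ _ hps'.steps_ne_nil hqs'.steps_ne_nil, hps, hqs]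
    · have := h.good_merge (by simpa using h.memv) (by simp) (by simpa using h.memu) (by simp)
        hps' hqs'
      rwa [Finset.union_comm, show ({u} ∪ {w} : Finset V) = {u, w} from rfl] at this
  obtain ⟨bs, hbs, hbs'⟩ := key v hv
  have hvD : ∀ w ∈ R, w ∈ G.dom u R := fun w hw =>
    Finset.mem_insert_of_mem (Finset.mem_biUnion.2 ⟨w, hw, self_mem_branch u w⟩)
  have le_iff : ∀ {w bs} h, G.Good (G.dom u R) {u, w} {u, w} bs →
      (peakFrom (G.vw u) (G.enterPeak u w R) (flatten bs) ≤ h ↔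
        G.enterPeak u w R ≤ h ∧ ∀ b ∈ bs, G.vw u ≤ b.sf → b.sp ≤ h) := by
    intro w bs h hbs
    rw [peakFrom_le_iff,
      forall_mem_flatten hbs.steps_ne_nil (p := fun sf sp => G.vw u ≤ sf → sp ≤ h)]
  set q := peakFrom (G.vw u) (G.enterPeak u v R) (mergeSteps (P v) (Q v)) with hq
  have hq0 : peakFrom (G.vw u) (G.enterPeak u v R) (flatten bs) ≤ q := by rw [hq, hbs]
  rw [le_iff q hbs'] at hq0
  refine ⟨absorb u v (G.vw u) q bs, ?_, ?_⟩
  · rw [flatten_absorb _ _ _ _ _ (hbs'.dropWhile_lt _), candidate, ← hbs]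
  · refine good_absorb (hvD v hv) (mem_nbrs.1 (hR hv)) hbs' ?_ hq0.2 ?_
    · rw [← enterPeak_eq hT hR hv]
      exact hq0.1
    · intro w hw huw
      have hwR : w ∈ R := by
        simp only [dom, Finset.mem_insert, Finset.mem_biUnion] at hw
        rcases hw with rfl | ⟨y, hy, hw⟩
        · exact absurd huw (G.graph.irrefl)
        · have huy := mem_nbrs.1 (hR hy)
          rw [(branch_leave hT huy hw huw.symm (notMem_branch hT huy)).1]
          exact hy
      obtain ⟨bs', hb1, hb2⟩ := key w hwR
      refine ⟨bs', hb2, fun h h1 h2 => (hmin w hwR).trans ?_⟩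
      rw [hb1, le_iff h hb2, enterPeak_eq hT hR hwR]
      exact ⟨h1, h2⟩

theorem length_candidate (u v : V) (c e : ℕ) (l : List (Stp V)) :
    (candidate u v c e l).length = l.length + 1 := by
  simp [candidate]

theorem Optimal.run {u : V} {R : Finset V} {l : List (Stp V)} (h : G.Optimal u R l) {p : ℕ}
    (hp : ∀ s ∈ l, s.sp ≤ p) : G.Run (G.dom u R) p {u} (l.map fun s => (s.x, s.y)) (G.dom u R) := by
  obtain ⟨bs, rfl, hbs⟩ := h
  have := hbs.run
    ((forall_mem_flatten hbs.steps_ne_nil (p := fun _ sp => sp ≤ p)).1 hp)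
  convert this using 1
  simp [flatten, List.map_flatMap, Function.comp_def]

/-- A complete run ends with guard 0, while every block starts with a positive guard; thus
`Good.sp_le` bounds all peaks. -/
theorem Optimal.sp_le {u : V} {R : Finset V} {l : List (Stp V)} (h : G.Optimal u R l) {p : ℕ}
    {l' : List (V × V)} (hl' : G.Run (G.dom u R) p {u} l' (G.dom u R)) : ∀ s ∈ l, s.sp ≤ p := by
  obtain ⟨bs, rfl, hbs⟩ := h
  rw [forall_mem_flatten hbs.steps_ne_nil (p := fun _ sp => sp ≤ p)]
  intro b hb
  refine hbs.sp_le subset_rfl hl' b hb ?_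
  rw [guard_self]
  clear hl'
  obtain ⟨X, hX⟩ : ∃ X, G.Good (G.dom u R) {u} X bs := ⟨_, hbs⟩
  clear hbs
  induction bs generalizing X with
  | nil => simp at hb
  | cons a bs ih =>
    obtain ⟨X', h1, h2⟩ := hX
    rcases List.mem_cons.1 hb with rfl | hb
    · rw [h1.sf_eq]; exact (Nat.zero_le _).trans_lt h1.lt
    · exact ih hb X' h2

end WeightedGraph

/-! ## From strategies to orders -/

namespace WeightedGraph

variable {V : Type*} [Fintype V] [DecidableEq V] {G : WeightedGraph V}

variable (G) in
/-- Every cut of `A` is crossed by an edge between vertices of `A`. -/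
def Linked (A : Finset V) : Prop :=
  ∀ B : Set V, (∃ a ∈ A, a ∈ B) → (∃ a ∈ A, a ∉ B) →
    ∃ p ∈ A, ∃ q ∈ A, p ∈ B ∧ q ∉ B ∧ G.graph.Adj p q

theorem linked_singleton (x : V) : G.Linked {x} := by
  rintro B ⟨a, ha, ha'⟩ ⟨b, hb, hb'⟩
  rw [Finset.mem_singleton] at ha hb
  subst ha hb
  exact absurd ha' hb'

theorem Linked.union {A A' : Finset V} (h : G.Linked A) (h' : G.Linked A') {x : V} (hx : x ∈ A)
    (hx' : x ∈ A') : G.Linked (A ∪ A') := by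
  intro B h1 h2
  by_cases c1 : (∃ a ∈ A, a ∈ B) ∧ ∃ a ∈ A, a ∉ B
  · obtain ⟨p, hp, q, hq, h⟩ := h B c1.1 c1.2
    exact ⟨p, Finset.mem_union_left _ hp, q, Finset.mem_union_left _ hq, h⟩
  by_cases c2 : (∃ a ∈ A', a ∈ B) ∧ ∃ a ∈ A', a ∉ B
  · obtain ⟨p, hp, q, hq, h⟩ := h' B c2.1 c2.2
    exact ⟨p, Finset.mem_union_right _ hp, q, Finset.mem_union_right _ hq, h⟩
  exfalso
  obtain ⟨a, ha, ha'⟩ := h1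
  obtain ⟨b, hb, hb'⟩ := h2
  rw [Finset.mem_union] at ha hb
  by_cases hxB : x ∈ B
  · rcases hb with hb | hb
    · exact c1 ⟨⟨x, hx, hxB⟩, b, hb, hb'⟩
    · exact c2 ⟨⟨x, hx', hxB⟩, b, hb, hb'⟩
  · rcases ha with ha | ha
    · exact c1 ⟨⟨a, ha, ha'⟩, x, hx, hxB⟩
    · exact c2 ⟨⟨a, ha, ha'⟩, x, hx', hxB⟩

theorem Linked.enter {A : Finset V} (h : G.Linked A) {x y : V} (hx : x ∈ A)
    (hxy : G.graph.Adj x y) : G.Linked (insert y A) := by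
  have h2 : G.Linked {x, y} := by
    rintro B ⟨a, ha, ha'⟩ ⟨b, hb, hb'⟩
    have hab : G.graph.Adj a b := by
      simp only [Finset.mem_insert, Finset.mem_singleton] at ha hb
      rcases ha with rfl | rfl <;> rcases hb with rfl | rfl
      · exact absurd ha' hb'
      · exact hxy
      · exact hxy.symm
      · exact absurd ha' hb'
    exact ⟨a, ha, b, hb, ha', hb', hab⟩
  have := h.union h2 hx (by simp)
  rwa [show A ∪ {x, y} = insert y A by ext z; simp; aesop] at this

/-- The edge `xy` separates `a` from `y`, because `A` joins `a` to `x` without using `y`. As `W`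
joins `a` to `y`, it has to use this edge. -/
theorem Linked.mem_of_adj (hT : G.graph.IsTree) {A W : Finset V} (hA : G.Linked A)
    (hW : G.Linked W) {a x y : V} (haA : a ∈ A) (haW : a ∈ W) (hx : x ∈ A) (hy : y ∉ A)
    (hyW : y ∈ W) (hxy : G.graph.Adj x y) : x ∈ W := by
  have ha : a ∉ G.branch x y := by
    intro ha
    obtain ⟨p, hp, q, hq, hp', hq', hpq⟩ := hA (G.branch x y) ⟨a, haA, ha⟩
      ⟨x, hx, notMem_branch hT hxy⟩
    exact hy ((branch_leave hT hxy hp' hpq hq').1 ▸ hp)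
  obtain ⟨p, hp, q, hq, hp', hq', hpq⟩ := hW (G.branch x y) ⟨y, hyW, self_mem_branch x y⟩
    ⟨a, haW, ha⟩
  exact (branch_leave hT hxy hp' hpq hq').2 ▸ hq

/-! ### Restricting runs by uncrossing. -/

variable (G) in
/-- With `k` searchers, the set `Z` can be entered vertex by vertex from some starting vertex. -/
def Reached (k : ℕ) (Z : Finset V) : Prop := ∃ r l, G.Run Finset.univ k {r} l Z

theorem reached_singleton (k : ℕ) (r : V) : G.Reached k {r} := ⟨r, [], rfl⟩

theorem Reached.enter {k : ℕ} {Z : Finset V} (h : G.Reached k Z) {x y : V} (hx : x ∈ Z)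
    (hy : y ∉ Z) (hxy : G.graph.Adj x y)
    (hk : G.guard Finset.univ (insert y Z) + G.slack x y ≤ k) : G.Reached k (insert y Z) := by
  obtain ⟨r, l, hl⟩ := h
  exact ⟨r, l ++ [(x, y)], hl.append ⟨hx, Finset.mem_univ _, hy, hxy, hk, rfl⟩⟩

/-- Keep only the steps that enter a vertex of `W`. Submodularity and the minimality of the guard of
`W` make the sets `A ∩ W` no more expensive than `A`, and by `Linked.mem_of_adj` such a step starts
inside `W` too. -/
theorem reached_inter (hT : G.graph.IsTree) {k : ℕ} {W A Z : Finset V} {l : List (V × V)}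
    (hW : G.Linked W) (hA : G.Linked A) (hl : G.Run Finset.univ k A l Z)
    (hmin : ∀ B ⊆ Z, G.Linked B → (B ∩ W).Nonempty →
      G.guard Finset.univ W ≤ G.guard Finset.univ (B ∪ W))
    (h : (A ∩ W).Nonempty → G.Reached k (A ∩ W)) (hZ : (Z ∩ W).Nonempty) :
    G.Reached k (Z ∩ W) := by
  induction l generalizing A with
  | nil => cases hl; exact h hZ
  | cons e l ih =>
    obtain ⟨x, y⟩ := e
    obtain ⟨h1, -, h3, h4, h5, h6⟩ := hl
    simp only at h1 h3 h4 h5 h6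
    have hA' := hA.enter h1 h4
    refine ih hA' h6 fun hne => ?_
    by_cases hy : y ∈ W
    · rw [Finset.insert_inter_of_mem hy]
      by_cases hAW : (A ∩ W).Nonempty
      · obtain ⟨a, ha⟩ := hAW
        have haA := (Finset.mem_inter.1 ha).1
        have hx := hA.mem_of_adj hT hW haA (Finset.mem_inter.1 ha).2 h1 h3 hy h4
        refine (h ⟨a, ha⟩).enter (Finset.mem_inter.2 ⟨h1, hx⟩)
          (fun hh => h3 (Finset.mem_inter.1 hh).1) h4 ?_
        have g1 := G.guard_submodular Finset.univ (insert y A) W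
        have g2 := hmin _ h6.subset hA' hne
        rw [Finset.insert_inter_of_mem hy] at g1
        omega
      -- The first vertex of `W` that the run meets becomes the new starting vertex; standing there
      -- costs nothing.
      · rw [Finset.not_nonempty_iff_eq_empty.1 hAW]
        exact reached_singleton k y
    · rw [Finset.insert_inter_of_notMem hy] at hne ⊢
      exact h hne

/-- Only `S` is known to be cheap, and entering `y` from the larger set `Z` could be too expensive.
Let `W` be a connected set of least guard with `S ⊆ W ⊆ Z ∪ {y}`. Its minimality allows
`reached_inter` to reach `Z ∩ W`, and its guard, at most that of `S`, pays for the final step into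
`y`. -/
theorem Reached.grow (hT : G.graph.IsTree) {k : ℕ} {Z S : Finset V} (h : G.Reached k Z)
    (hS : G.Linked S) {x y : V} (hSZ : S ⊆ insert y Z) (hy : y ∉ Z) (hyS : y ∈ S) (hx : x ∈ Z)
    (hxS : x ∈ S) (hxy : G.graph.Adj x y) (hk : G.guard Finset.univ S + G.slack x y ≤ k) :
    ∃ Z', S ⊆ Z' ∧ G.Reached k Z' := by
  classical
  obtain ⟨W, hW, hmin⟩ :=
    ((insert y Z).powerset.filter fun W => S ⊆ W ∧ G.Linked W).exists_min_image
    (G.guard Finset.univ) ⟨S, by simp [hSZ, hS]⟩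
  simp only [Finset.mem_filter, Finset.mem_powerset] at hW hmin
  obtain ⟨hWZ, hSW, hWl⟩ := hW
  refine ⟨W, hSW, ?_⟩
  have hne : (Z ∩ W).Nonempty := ⟨x, Finset.mem_inter.2 ⟨hx, hSW hxS⟩⟩
  have hWe : W = insert y (Z ∩ W) := by
    ext z
    simp only [Finset.mem_insert, Finset.mem_inter]
    constructor
    · intro hz
      rcases Finset.mem_insert.1 (hWZ hz) with h | h
      · exact Or.inl h
      · exact Or.inr ⟨h, hz⟩
    · rintro (rfl | h)
      · exact hSW hyS
      · exact h.2
  have h1 : G.Reached k (Z ∩ W) := by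
    obtain ⟨r, l, hl⟩ := h
    refine reached_inter hT hWl (linked_singleton r) hl ?_ ?_ hne
    · intro B hB hB' hBW
      obtain ⟨b, hb⟩ := hBW
      rw [Finset.mem_inter] at hb
      exact hmin _ ⟨Finset.union_subset (hB.trans (Finset.subset_insert _ _)) hWZ,
        hSW.trans Finset.subset_union_right, hB'.union hWl hb.1 hb.2⟩
    · rintro ⟨b, hb⟩
      rw [Finset.mem_inter, Finset.mem_singleton] at hb
      rw [Finset.singleton_inter_of_mem (hb.1 ▸ hb.2)]
      exact reached_singleton k r
  rw [hWe]
  refine h1.enter (Finset.mem_inter.2 ⟨hx, hSW hxS⟩) (fun hh => hy (Finset.mem_inter.1 hh).1) hxy ?_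
  rw [← hWe]
  have := hmin S ⟨hSZ, subset_rfl, hS⟩
  omega

/-! ### The invariant along an arbitrary strategy. -/

open Classical in
/-- The vertices that are incident to the edges in `C`. -/
noncomputable def verts (C : Set (Sym2 V)) : Finset V :=
  Finset.univ.filter fun v => ∃ w, s(v, w) ∈ C

theorem mem_verts {C : Set (Sym2 V)} {v : V} : v ∈ verts C ↔ ∃ w, s(v, w) ∈ C := by simp [verts]

theorem exists_boundary_edge {C : Set (Sym2 V)} (hC : C ⊆ G.graph.edgeSet) (h : ConnectedEdges C)
    {a b : V} (ha : a ∈ verts C) (hb : b ∈ verts C) {B : Set V} (haB : a ∈ B) (hbB : b ∉ B) :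
    ∃ p ∈ B, ∃ q ∉ B, s(p, q) ∈ C := by
  have aux : ∀ v ∈ verts C, v ∈ (SimpleGraph.fromEdgeSet C).support := by
    intro v hv
    obtain ⟨w, hw⟩ := mem_verts.1 hv
    exact ⟨w, hw, ((SimpleGraph.mem_edgeSet _).1 (hC hw)).ne⟩
  obtain ⟨p⟩ := h a (aux a ha) b (aux b hb)
  obtain ⟨d, -, h1, h2⟩ := p.exists_boundary_dart B haB hbB
  exact ⟨d.fst, h1, d.snd, h2, d.adj.1⟩

theorem linked_verts {C : Set (Sym2 V)} (hC : C ⊆ G.graph.edgeSet) (h : ConnectedEdges C) :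
    G.Linked (verts C) := by
  rintro B ⟨a, ha, ha'⟩ ⟨b, hb, hb'⟩
  obtain ⟨p, hp, q, hq, hpq⟩ := exists_boundary_edge hC h ha hb ha' hb'
  refine ⟨p, mem_verts.2 ⟨q, hpq⟩, q, mem_verts.2 ⟨p, Sym2.eq_swap ▸ hpq⟩, hp, hq,
    (SimpleGraph.mem_edgeSet _).1 (hC hpq)⟩

variable (G) in
/-- In the configuration `c` with `k` searchers contamination has spread as far as possible. -/
structure Stable (k : ℕ) (c : Config V) : Prop where
  sum : ∑ v, c.occ v = k
  sub : c.clear ⊆ G.graph.edgeSet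
  guarded : ∀ v a b, s(v, a) ∈ c.clear → G.graph.Adj v b → s(v, b) ∉ c.clear → G.vw v ≤ c.occ v

theorem stable_start (k : ℕ) (v₀ : V) : G.Stable k (start k v₀) where
  sum := by simp [start, Finset.sum_update_of_mem]
  sub := by simp [start]
  guarded := by simp [start]

theorem occAfter_add (c : Config V) (m : Move V) (hne : m.src ≠ m.dst)
    (hm : m.count ≤ c.occ m.src) (x : V) :
    occAfter c m x + (if x = m.src then m.count else 0) =
      c.occ x + (if x = m.dst then m.count else 0) := by
  unfold occAfter
  by_cases h1 : x = m.dst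
  · subst h1
    simp [hne.symm]
  · by_cases h2 : x = m.src
    · subst h2
      simp [h1]
      omega
    · simp [h1, h2]

theorem Stable.after {k : ℕ} {c : Config V} (h : G.Stable k c) {m : Move V} (hm : G.Legal c m) :
    G.Stable k (G.after c m) where
  sum := by
    have h1 := Finset.sum_congr (s₁ := Finset.univ) rfl
      fun x _ => occAfter_add c m hm.1.ne hm.2.2.1 x
    simp only [Finset.sum_add_distrib, Finset.sum_ite_eq', Finset.mem_univ, if_true, h.sum] at h1
    exact Nat.add_right_cancel h1
  sub _ he := he.1
  guarded v a b ha hb hb' := by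
    have hb2 : G.Contaminated (occAfter c m) (c.clear ∪ {s(m.src, m.dst)}) s(v, b) := by
      by_contra hcon
      exact hb' ⟨hb, hcon⟩
    by_contra hlt
    refine ha.2 ?_
    rw [show s(v, a) = s(a, v) from Sym2.eq_swap]
    exact .spread ((SimpleGraph.mem_edgeSet _).1 ha.1).symm hb (not_le.1 hlt) hb2

theorem after_clear_subset (c : Config V) (m : Move V) :
    (G.after c m).clear ⊆ c.clear ∪ {s(m.src, m.dst)} := by
  intro e he
  by_contra hcon
  exact he.2 (.base he.1 hcon)

/-- Searchers are counted vertex by vertex: stability puts w(x) of them on every `x` that the guard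
counts, and `z` holds `d` on top of its share. -/
theorem Stable.guard_add_le {k : ℕ} {c : Config V} (h : G.Stable k c) {z : V} {d : ℕ}
    (hz : (∃ y, G.graph.Adj z y ∧ y ∉ verts c.clear) → G.vw z + d ≤ c.occ z) (hd : d ≤ c.occ z) :
    G.guard Finset.univ (verts c.clear) + d ≤ k := by
  classical
  have : d = ∑ x, if x = z then d else 0 := by simp
  rw [this, ← h.sum, guard, ← Finset.sum_add_distrib]
  refine Finset.sum_le_sum fun x _ => ?_
  by_cases hxz : x = z
  · subst hxz
    rw [if_pos rfl]
    split_ifs with hc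
    · obtain ⟨-, y, -, hy⟩ := hc
      exact hz ⟨y, hy⟩
    · omega
  · rw [if_neg hxz]
    split_ifs with hc
    · obtain ⟨hx, y, -, hxy, hy⟩ := hc
      obtain ⟨w, hw⟩ := mem_verts.1 hx
      exact h.guarded x w y hw hxy fun hh => hy (mem_verts.2 ⟨x, Sym2.eq_swap ▸ hh⟩)
    · simp

theorem entry_eq_vw {x y z : V} (hxy : G.graph.Adj y x) (hyz : G.graph.Adj y z) (hxz : x ≠ z) :
    G.entry y = G.vw y := by
  refine if_neg fun h => hxz ?_
  exact Set.ncard_le_one_iff (Set.toFinite _) |>.1 h hxy hyz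

/-- Unless a new edge `ab` becomes clear, the old `Z` still works. If one does, the searchers that
have crossed `ab` are all at `b`, and they pay for the slack in addition to the guard of the clear
vertices. `Z` then grows by the endpoint that it lacks. -/
theorem Reached.after (hT : G.graph.IsTree) {k : ℕ} {c : Config V} (h : G.Stable k c)
    {Z : Finset V} (hZ : G.Reached k Z) (hcZ : verts c.clear ⊆ Z) {m : Move V} (hm : G.Legal c m)
    (hC : ConnectedEdges (G.after c m).clear) :
    ∃ Z', verts (G.after c m).clear ⊆ Z' ∧ G.Reached k Z' := by
  have h' := h.after hm
  have hsub := G.after_clear_subset c m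
  obtain ⟨hadj, hm1, hm2, hm3⟩ := hm
  have hocc := occAfter_add c m hadj.ne hm2
  have hocc' : (G.after c m).occ = occAfter c m := rfl
  set c' := G.after c m with hc'
  rcases m with ⟨a, b, j⟩
  simp only at hadj hm1 hm2 hm3 hsub hocc hocc'
  by_cases he : s(a, b) ∈ c'.clear ∧ s(a, b) ∉ c.clear
  swap
  · refine ⟨Z, Finset.Subset.trans ?_ hcZ, hZ⟩
    intro v hv
    obtain ⟨w, hw⟩ := mem_verts.1 hv
    refine mem_verts.2 ⟨w, ?_⟩
    rcases hsub hw with hw' | hw'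
    · exact hw'
    · rw [Set.mem_singleton_iff] at hw'
      by_contra hcon
      rw [hw'] at hw hcon
      exact he ⟨hw, hcon⟩
  obtain ⟨he, hec⟩ := he
  have hj := hm3 hec
  have hlink := linked_verts h'.sub hC
  have haS : a ∈ verts c'.clear := mem_verts.2 ⟨b, he⟩
  have hbS : b ∈ verts c'.clear := mem_verts.2 ⟨a, Sym2.eq_swap ▸ he⟩
  have hSab : ∀ v ∈ verts c'.clear, v = a ∨ v = b ∨ v ∈ verts c.clear := by
    intro v hv
    obtain ⟨w, hw⟩ := mem_verts.1 hv
    rcases hsub hw with hw' | hw'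
    · exact Or.inr (Or.inr (mem_verts.2 ⟨w, hw'⟩))
    · rw [Set.mem_singleton_iff, Sym2.eq_iff] at hw'
      rcases hw' with hw' | hw'
      · exact Or.inl hw'.1
      · exact Or.inr (Or.inl hw'.1)
  -- If `b` is exposed, its entry cost is w(b), and w(b) plus the slack is the maximum of w(b) and
  -- w(ab). Stability and the crossing searchers bound both by the number of searchers at `b`.
  have hgb : G.guard Finset.univ (verts c'.clear) + G.slack a b ≤ k := by
    have hb0 : j ≤ c'.occ b := by
      have := hocc b
      rw [hocc']
      simp only [hadj.ne', if_true, if_false] at this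
      omega
    refine h'.guard_add_le (z := b) ?_ ?_
    · rintro ⟨y, hby, hy⟩
      have hv := h'.guarded b a y (Sym2.eq_swap ▸ he) hby fun hh =>
        hy (mem_verts.2 ⟨b, Sym2.eq_swap ▸ hh⟩)
      have := entry_eq_vw hadj.symm hby (by rintro rfl; exact hy haS)
      rw [slack, this]
      omega
    · rw [slack]; omega
  -- If no clear edge met `ab` before, connectedness leaves `ab` as the only clear edge, and a new
  -- run starts at `a`.
  by_cases hn : a ∉ verts c.clear ∧ b ∉ verts c.clear
  · have hS : verts c'.clear = {a, b} := by
      ext v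
      simp only [Finset.mem_insert, Finset.mem_singleton]
      constructor
      · intro hv
        by_contra hvab
        obtain ⟨p, hp, q, hq, hpq⟩ := exists_boundary_edge h'.sub hC haS hv
          (B := {a, b}) (by simp) (by simpa using hvab)
        rcases hsub hpq with hw | hw
        · rcases hp with rfl | hp
          · exact hn.1 (mem_verts.2 ⟨q, hw⟩)
          · rw [Set.mem_singleton_iff] at hp
            subst hp
            exact hn.2 (mem_verts.2 ⟨q, hw⟩)
        · rw [Set.mem_singleton_iff, Sym2.eq_iff] at hw
          rcases hw with hw | hw
          · exact hq (by simp [hw.2])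
          · exact hq (by simp [hw.2])
      · rintro (rfl | rfl)
        · exact haS
        · exact hbS
    refine ⟨insert b {a}, by rw [hS, Finset.pair_comm], ?_⟩
    refine (reached_singleton k a).enter (by simp) (by simpa using hadj.ne') hadj ?_
    rw [Finset.pair_comm, ← hS]
    exact hgb
  by_cases haZ : a ∈ Z
  · by_cases hbZ : b ∈ Z
    · refine ⟨Z, fun v hv => ?_, hZ⟩
      rcases hSab v hv with rfl | rfl | hv
      · exact haZ
      · exact hbZ
      · exact hcZ hv
    · refine hZ.grow hT hlink (fun v hv => ?_) hbZ hbS haZ haS hadj hgb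
      rcases hSab v hv with rfl | rfl | hv
      · exact Finset.mem_insert_of_mem haZ
      · exact Finset.mem_insert_self _ _
      · exact Finset.mem_insert_of_mem (hcZ hv)
  -- Here the searchers come from outside `Z` and the order enters `a` from `b`. Before the move `b`
  -- was guarded against the contaminated edge `ab`, so afterwards it holds at least w(b) + j
  -- searchers.
  · have hbv : b ∈ verts c.clear := by
      by_contra hb
      exact hn ⟨fun ha => haZ (hcZ ha), hb⟩
    refine hZ.grow hT hlink (fun v hv => ?_) haZ haS (hcZ hbv) hbS hadj.symm ?_
    · rcases hSab v hv with rfl | rfl | hv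
      · exact Finset.mem_insert_self _ _
      · exact Finset.mem_insert_of_mem (hcZ hbv)
      · exact Finset.mem_insert_of_mem (hcZ hv)
    · obtain ⟨w, hw⟩ := mem_verts.1 hbv
      have hv := h.guarded b w a hw hadj.symm (Sym2.eq_swap ▸ hec)
      have hb0 : G.vw b + j ≤ c'.occ b := by
        have := hocc b
        rw [hocc']
        simp only [hadj.ne', if_true, if_false] at this
        omega
      have hsl : G.slack b a ≤ j := by
        rw [slack, Sym2.eq_swap]; omega
      exact h'.guard_add_le (z := b) (fun _ => by omega) (by omega)

theorem IsConnectedSearch.exists_run (hT : G.graph.IsTree) {k : ℕ} {v₀ : V} {ms : List (Move V)}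
    (h : G.IsConnectedSearch k v₀ ms) : ∃ r l, G.Run Finset.univ k {r} l Finset.univ := by
  have key : ∀ (ms : List (Move V)) (c : Config V) (Z : Finset V), G.Stable k c → G.Reached k Z →
      verts c.clear ⊆ Z → G.ClearsFrom c ms → G.Reached k Finset.univ := by
    intro ms
    induction ms with
    | nil =>
      intro c Z _ hZ hcZ hc
      -- An edge that leaves `Z` would be clear, which puts its outer end into `Z`. Arguing with
      -- such an edge also covers the tree with a single vertex, where no vertex meets a clear edge.
      have : Z = Finset.univ := by
        rw [Finset.eq_univ_iff_forall]
        by_contra! hb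
        obtain ⟨b, hb⟩ := hb
        obtain ⟨r, l, hl⟩ := hZ
        obtain ⟨x, hx, y, hy, hxy⟩ :=
          exists_boundary hT (hl.subset (Finset.mem_singleton_self r)) hb
        refine hy (hcZ (mem_verts.2 ⟨x, ?_⟩))
        rw [show c.clear = G.graph.edgeSet from hc]
        exact hxy.symm
      exact this ▸ hZ
    | cons m ms ih =>
      intro c Z h1 hZ hcZ hc
      obtain ⟨hm, hC, hc⟩ := hc
      obtain ⟨Z', hZ', hr⟩ := hZ.after hT h1 hcZ hm hC
      exact ih _ Z' (h1.after hm) hr hZ' hc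
  refine key ms _ {v₀} (stable_start k v₀) (reached_singleton k v₀) ?_ h
  intro v hv
  simp [mem_verts, start] at hv

end WeightedGraph

/-! ## From orders to monotone strategies -/

namespace WeightedGraph

variable {V : Type*} [Fintype V] [DecidableEq V] {G : WeightedGraph V}

variable (G) in
open Classical in
/-- The number of searchers that guard `v` while the vertices of `S` are entered. -/
noncomputable def need (S : Finset V) (v : V) : ℕ :=
  if v ∈ S ∧ ∃ y ∈ Finset.univ, G.graph.Adj v y ∧ y ∉ S then G.vw v else 0

theorem guard_eq_sum (S : Finset V) : G.guard Finset.univ S = ∑ v, G.need S v := by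
  unfold guard need
  exact Finset.sum_congr rfl fun _ _ => by congr

theorem need_eq_zero {S : Finset V} {v : V} (h : v ∉ S) : G.need S v = 0 :=
  if_neg fun hh => h hh.1

theorem need_eq_vw {S : Finset V} {v y : V} (h : v ∈ S) (hy : G.graph.Adj v y) (hyS : y ∉ S) :
    G.need S v = G.vw v := if_pos ⟨h, y, Finset.mem_univ _, hy, hyS⟩

theorem need_le (S : Finset V) (v : V) : G.need S v ≤ G.guard Finset.univ S := by
  rw [guard_eq_sum]
  exact Finset.single_le_sum (f := G.need S) (fun _ _ => Nat.zero_le _) (Finset.mem_univ v)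

theorem Linked.adj_unique (hT : G.graph.IsTree) {S : Finset V} (hS : G.Linked S) {x y z : V}
    (hx : x ∈ S) (hy : y ∉ S) (hz : z ∈ S) (hxy : G.graph.Adj x y) (hzy : G.graph.Adj z y) :
    z = x := by
  by_contra hzx
  have hzB : z ∈ G.branch x y := by
    by_contra hzB
    exact hzx (branch_leave hT hxy (self_mem_branch x y) hzy.symm hzB).2
  obtain ⟨p, hp, q, hq, hp', hq', hpq⟩ := hS (G.branch x y) ⟨z, hz, hzB⟩
    ⟨x, hx, notMem_branch hT hxy⟩
  exact hy ((branch_leave hT hxy hp' hpq hq').1 ▸ hp)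

section Enter

variable {S : Finset V} {x y : V}

theorem need_insert_of_ne (hT : G.graph.IsTree) (hS : G.Linked S) (hx : x ∈ S) (hy : y ∉ S)
    (hxy : G.graph.Adj x y) {v : V} (hvx : v ≠ x) (hvy : v ≠ y) :
    G.need (insert y S) v = G.need S v := by
  unfold need
  congr 1
  simp only [Finset.mem_insert, hvy, false_or, Finset.mem_univ, true_and, eq_iff_iff, not_or]
  refine and_congr_right fun hv => exists_congr fun w => and_congr_right fun hw => ?_
  refine ⟨fun h => h.2, fun h => ⟨?_, h⟩⟩
  rintro rfl
  exact hvx (hS.adj_unique hT hx hy hv hxy hw)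

theorem need_insert_self (hT : G.graph.IsTree) (hS : G.Linked S) (hx : x ∈ S) (hy : y ∉ S)
    (hxy : G.graph.Adj x y) : G.need (insert y S) y = G.entry y := by
  by_cases h : ∃ z, G.graph.Adj y z ∧ z ≠ x
  · obtain ⟨z, hz, hzx⟩ := h
    rw [entry_eq_vw hxy.symm hz hzx.symm]
    refine need_eq_vw (Finset.mem_insert_self _ _) hz ?_
    simp only [Finset.mem_insert, not_or]
    exact ⟨hz.ne', fun hzS => hzx (hS.adj_unique hT hx hy hzS hxy hz.symm)⟩
  · push Not at h
    rw [entry, if_pos, need, if_neg]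
    · rintro ⟨-, z, -, hz, hz'⟩
      exact hz' (Finset.mem_insert_of_mem (h z hz ▸ hx))
    · rw [Set.ncard_le_one_iff (Set.toFinite _)]
      intro a b ha hb
      rw [h a ha, h b hb]

/-- Only `x` and `y` change their need: by `Linked.adj_unique` no other vertex of `S` is adjacent to
`y`. The additive form avoids truncated subtraction. -/
theorem guard_insert (hT : G.graph.IsTree) (hS : G.Linked S) (hx : x ∈ S) (hy : y ∉ S)
    (hxy : G.graph.Adj x y) : G.guard Finset.univ (insert y S) + G.vw x =
      G.guard Finset.univ S + G.need (insert y S) x + G.entry y := by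
  have h : ∀ v, G.need (insert y S) v + (if v = x then G.vw x else 0) =
      G.need S v + (if v = x then G.need (insert y S) x else 0) +
        (if v = y then G.entry y else 0) := by
    intro v
    by_cases hvx : v = x
    · subst hvx
      simp [hxy.ne, need_eq_vw hx hxy hy]
      omega
    · by_cases hvy : v = y
      · subst hvy
        simp [hvx, need_eq_zero hy, need_insert_self hT hS hx hy hxy]
      · simp [hvx, hvy, need_insert_of_ne hT hS hx hy hxy hvx hvy]
  have := Finset.sum_congr (s₁ := Finset.univ) rfl fun v _ => h v
  simpa only [Finset.sum_add_distrib, Finset.sum_ite_eq', Finset.mem_univ, if_true,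
    ← guard_eq_sum] using this

theorem entry_le_guard_insert (hT : G.graph.IsTree) (hS : G.Linked S) (hx : x ∈ S) (hy : y ∉ S)
    (hxy : G.graph.Adj x y) :
    G.need (insert y S) x + G.entry y ≤ G.guard Finset.univ (insert y S) := by
  have h1 := guard_insert hT hS hx hy hxy
  have h2 := G.need_le S x
  rw [need_eq_vw hx hxy hy] at h2
  omega

end Enter

/-! ### Single moves without recontamination. -/

variable (G) in
/-- The edges between vertices of `S`. -/
def inner (S : Finset V) : Set (Sym2 V) := {e | e ∈ G.graph.edgeSet ∧ ∀ v ∈ e, v ∈ S}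

theorem mem_inner {S : Finset V} {a b : V} :
    s(a, b) ∈ G.inner S ↔ G.graph.Adj a b ∧ a ∈ S ∧ b ∈ S := by
  simp [inner]

theorem connectedEdges_inner {S : Finset V} (hS : G.Linked S) : ConnectedEdges (G.inner S) := by
  have aux : ∀ v ∈ (SimpleGraph.fromEdgeSet (G.inner S)).support, v ∈ S := by
    rintro v ⟨w, hw, -⟩
    exact (mem_inner.1 hw).2.1
  intro u hu v hv
  by_contra hcon
  obtain ⟨p, hp, q, hq, hp', hq', hpq⟩ := hS
    {w | (SimpleGraph.fromEdgeSet (G.inner S)).Reachable u w}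
    ⟨u, aux u hu, SimpleGraph.Reachable.refl _⟩ ⟨v, aux v hv, hcon⟩
  exact hq' (SimpleGraph.Reachable.trans hp'
    (SimpleGraph.Adj.reachable ⟨mem_inner.2 ⟨hpq, hp, hq⟩, hpq.ne⟩))

/-- Contamination would have to enter through a vertex of `S` with a neighbour outside `S`, and such
a vertex holds its full weight. -/
theorem after_clear_eq {c : Config V} {m : Move V} {S : Finset V}
    (h : c.clear ∪ {s(m.src, m.dst)} = G.inner S) (hocc : ∀ v, G.need S v ≤ occAfter c m v) :
    (G.after c m).clear = G.inner S := by
  have key : ∀ e, G.Contaminated (occAfter c m) (G.inner S) e → e ∉ G.inner S := by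
    intro e he
    induction he with
    | base _ h => exact h
    | @spread u v y huv hvy hlt _ ih =>
      intro hcon
      rw [mem_inner] at hcon ih
      have := hocc v
      rw [need_eq_vw hcon.2.2 hvy fun hy => ih ⟨hvy, hcon.2.2, hy⟩] at this
      omega
  ext e
  simp only [after, h, Set.mem_ofPred_eq]
  constructor
  · rintro ⟨h1, h2⟩
    by_contra hcon
    exact h2 (.base h1 hcon)
  · intro he
    exact ⟨he.1, fun hc => key e hc he⟩

variable (G) in
/-- The moves are legal, they lead from `c` to `c'`, the clear edges are always connected, and
there is no recontamination. -/
def Leads : Config V → List (Move V) → Config V → Prop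
  | c, [], c' => c = c'
  | c, m :: ms, c' => G.Legal c m ∧ ConnectedEdges (G.after c m).clear ∧
      c.clear ⊆ (G.after c m).clear ∧ Leads (G.after c m) ms c'

theorem Leads.append {c c' c'' : Config V} {ms ms' : List (Move V)} (h : G.Leads c ms c')
    (h' : G.Leads c' ms' c'') : G.Leads c (ms ++ ms') c'' := by
  induction ms generalizing c with
  | nil => cases h; exact h'
  | cons m ms ih => exact ⟨h.1, h.2.1, h.2.2.1, ih h.2.2.2⟩

theorem Leads.clearsFrom {c c' : Config V} {ms : List (Move V)} (h : G.Leads c ms c')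
    (hc' : c'.clear = G.graph.edgeSet) : G.ClearsFrom c ms ∧ G.MonotoneFrom c ms := by
  induction ms generalizing c with
  | nil => cases h; exact ⟨hc', trivial⟩
  | cons m ms ih =>
    obtain ⟨h1, h2, h3, h4⟩ := h
    exact ⟨⟨h1, h2, (ih h4).1⟩, h3, (ih h4).2⟩

variable (G) in
/-- The edges between vertices of `S` are clear, and the searchers that are not needed as guards
are at `z`. -/
structure Spare (k : ℕ) (S : Finset V) (z : V) (c : Config V) : Prop where
  clear : c.clear = G.inner S
  occ : ∀ v, c.occ v = G.need S v + if v = z then k - G.guard Finset.univ S else 0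

theorem Spare.of_eq_zero {k : ℕ} {S : Finset V} {z z' : V} {c : Config V} (h : G.Spare k S z c)
    (h0 : k - G.guard Finset.univ S = 0) : G.Spare k S z' c :=
  ⟨h.clear, by simpa [h0] using h.occ⟩

theorem Spare.walk {k : ℕ} {S : Finset V} (hS : G.Linked S) {z z' : V} {c : Config V}
    (h : G.Spare k S z c) (hz : z ∈ S) (hz' : z' ∈ S) (hzz : G.graph.Adj z z')
    (h0 : k - G.guard Finset.univ S ≠ 0) :
    ∃ c', G.Leads c [⟨z, z', k - G.guard Finset.univ S⟩] c' ∧ G.Spare k S z' c' := by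
  have hin : s(z, z') ∈ G.inner S := mem_inner.2 ⟨hzz, hz, hz'⟩
  have hle : k - G.guard Finset.univ S ≤ c.occ z := by
    rw [h.occ, if_pos rfl]; omega
  have hocc : ∀ v, occAfter c ⟨z, z', k - G.guard Finset.univ S⟩ v =
      G.need S v + if v = z' then k - G.guard Finset.univ S else 0 := by
    intro v
    have := occAfter_add c ⟨z, z', k - G.guard Finset.univ S⟩ hzz.ne hle v
    rw [h.occ v] at this
    simp only at this ⊢
    omega
  have hcl : (G.after c ⟨z, z', k - G.guard Finset.univ S⟩).clear = G.inner S := by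
    refine after_clear_eq ?_ fun v => ?_
    · rw [h.clear]
      simpa using hin
    · rw [hocc]; exact Nat.le_add_right _ _
  refine ⟨_, ⟨⟨hzz, by simp only; omega, hle, fun hn => absurd (h.clear ▸ hin) hn⟩, ?_, ?_, rfl⟩,
    hcl, hocc⟩
  · rw [hcl]; exact connectedEdges_inner hS
  · rw [hcl, h.clear]

/-- By `hocc`, the guards of the new set other than the one at `y` are in place, and all other
searchers are at `x`. These all slide, both the future guard of `y` and the spare ones; `hk` makes
them at least w(xy) many. -/
theorem Spare.slide (hT : G.graph.IsTree) {k : ℕ} {S : Finset V} (hS : G.Linked S) {x y : V}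
    {c : Config V} (hx : x ∈ S) (hy : y ∉ S) (hxy : G.graph.Adj x y)
    (hk : G.guard Finset.univ (insert y S) + G.slack x y ≤ k) (hc : c.clear = G.inner S)
    (hocc : ∀ v, c.occ v + (if v = y then G.entry y else 0) = G.need (insert y S) v +
      if v = x then k - (G.guard Finset.univ (insert y S) - G.entry y) else 0) :
    ∃ c', G.Leads c [⟨x, y, k - (G.guard Finset.univ (insert y S) - G.entry y)⟩] c' ∧
      G.Spare k (insert y S) y c' := by
  have hle := entry_le_guard_insert hT hS hx hy hxy
  have hsl : G.ew s(x, y) ≤ G.slack x y + G.entry y := by rw [slack]; omega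
  have hin : c.clear ∪ {s(x, y)} = G.inner (insert y S) := by
    rw [hc]
    ext e
    induction e with
    | _ a b =>
    simp only [Set.mem_union, mem_inner, Set.mem_singleton_iff, Finset.mem_insert, Sym2.eq_iff]
    constructor
    · rintro (⟨h1, h2, h3⟩ | ⟨rfl, rfl⟩ | ⟨rfl, rfl⟩)
      · exact ⟨h1, Or.inr h2, Or.inr h3⟩
      · exact ⟨hxy, Or.inr hx, Or.inl rfl⟩
      · exact ⟨hxy.symm, Or.inl rfl, Or.inr hx⟩
    · rintro ⟨h1, rfl | h2, rfl | h3⟩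
      · exact absurd h1 (G.graph.irrefl)
      · exact Or.inr (Or.inr ⟨rfl, hS.adj_unique hT hx hy h3 hxy h1.symm⟩)
      · exact Or.inr (Or.inl ⟨hS.adj_unique hT hx hy h2 hxy h1, rfl⟩)
      · exact Or.inl ⟨h1, h2, h3⟩
  set j := k - (G.guard Finset.univ (insert y S) - G.entry y) with hj
  have hcx : j ≤ c.occ x := by
    have := hocc x
    simp only [hxy.ne, if_true, if_false] at this
    omega
  have hocc' : ∀ v, occAfter c ⟨x, y, j⟩ v =
      G.need (insert y S) v + if v = y then k - G.guard Finset.univ (insert y S) else 0 := by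
    intro v
    have h1 := occAfter_add c ⟨x, y, j⟩ hxy.ne hcx v
    have h2 := hocc v
    simp only at h1 h2 ⊢
    by_cases hvy : v = y
    · subst hvy
      simp only [if_true, hxy.ne', if_false] at h1 h2 ⊢
      omega
    · simp only [hvy, if_false] at h1 h2 ⊢
      omega
  have hcl : (G.after c ⟨x, y, j⟩).clear = G.inner (insert y S) := by
    refine after_clear_eq hin fun v => ?_
    rw [hocc']; exact Nat.le_add_right _ _
  have hpos := G.ew_pos s(x, y) hxy
  refine ⟨_, ⟨⟨hxy, by simp only; omega, hcx, fun _ => by simp only; omega⟩, ?_, ?_, rfl⟩,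
    hcl, hocc'⟩
  · rw [hcl]
    exact connectedEdges_inner (hS.enter hx hxy)
  · rw [hcl, ← hin]
    exact Set.subset_union_left

/-! ### Walks of the spare searchers to and from the root. -/

variable (G) in
/-- The pairs in the list are edges of a walk from `z` to `r` inside `S`. -/
def Climb (S : Finset V) (r : V) : V → List (V × V) → Prop
  | z, [] => z = r
  | z, e :: l => e.1 = z ∧ e.2 ∈ S ∧ G.graph.Adj e.1 e.2 ∧ Climb S r e.2 l

theorem Climb.mono {S S' : Finset V} (h : S ⊆ S') {r z : V} {l : List (V × V)}
    (hl : G.Climb S r z l) : G.Climb S' r z l := by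
  induction l generalizing z with
  | nil => exact hl
  | cons e l ih => exact ⟨hl.1, h hl.2.1, hl.2.2.1, ih hl.2.2.2⟩

/-- Slide `a` searchers along a walk, upwards. -/
def movesUp (a : ℕ) (l : List (V × V)) : List (Move V) := l.map fun e => ⟨e.1, e.2, a⟩

/-- Slide `a` searchers along a walk, downwards. -/
def movesDown (a : ℕ) (l : List (V × V)) : List (Move V) :=
  (l.map fun e => ⟨e.2, e.1, a⟩).reverse

theorem Spare.up {k : ℕ} {S : Finset V} (hS : G.Linked S) {r z : V} {c : Config V}
    {l : List (V × V)} (h : G.Spare k S z c) (hz : z ∈ S) (hl : G.Climb S r z l)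
    (h0 : k - G.guard Finset.univ S ≠ 0) :
    ∃ c', G.Leads c (movesUp (k - G.guard Finset.univ S) l) c' ∧ G.Spare k S r c' := by
  induction l generalizing z c with
  | nil => cases hl; exact ⟨c, rfl, h⟩
  | cons e l ih =>
    obtain ⟨rfl, h2, h3, h4⟩ := hl
    obtain ⟨c1, hc1, hc1'⟩ := h.walk hS hz h2 h3 h0
    obtain ⟨c2, hc2, hc2'⟩ := ih hc1' h2 h4
    exact ⟨c2, hc1.append hc2, hc2'⟩

theorem Spare.down {k : ℕ} {S : Finset V} (hS : G.Linked S) {r z : V} {c : Config V}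
    {l : List (V × V)} (h : G.Spare k S r c) (hz : z ∈ S) (hl : G.Climb S r z l)
    (h0 : k - G.guard Finset.univ S ≠ 0) :
    ∃ c', G.Leads c (movesDown (k - G.guard Finset.univ S) l) c' ∧ G.Spare k S z c' := by
  induction l generalizing z with
  | nil => cases hl; exact ⟨c, rfl, h⟩
  | cons e l ih =>
    obtain ⟨rfl, h2, h3, h4⟩ := hl
    obtain ⟨c1, hc1, hc1'⟩ := ih h2 h4
    obtain ⟨c2, hc2, hc2'⟩ := hc1'.walk hS h2 hz h3.symm h0
    refine ⟨c2, ?_, hc2'⟩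
    rw [movesDown, List.map_cons, List.reverse_cons]
    exact hc1.append hc2

variable (G) in
/-- The moves that enter `y` from `x` when `S` is entered and all spare searchers are at the root,
and that bring the spare searchers back to the root. -/
noncomputable def stepMoves (k : ℕ) (up : V → List (V × V)) (S : Finset V) (x y : V) :
    List (Move V) :=
  (if k - G.guard Finset.univ S = 0 then [] else movesDown (k - G.guard Finset.univ S) (up x)) ++
    [⟨x, y, k - (G.guard Finset.univ (insert y S) - G.entry y)⟩] ++
    (if k - G.guard Finset.univ (insert y S) = 0 then [] else
      movesUp (k - G.guard Finset.univ (insert y S)) ((y, x) :: up x))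

variable (G) in
/-- The strategy that enters the vertices in the given order. -/
noncomputable def strategy (k : ℕ) : (V → List (V × V)) → Finset V → List (V × V) → List (Move V)
  | _, _, [] => []
  | up, S, e :: l => G.stepMoves k up S e.1 e.2 ++
      strategy k (Function.update up e.2 ((e.2, e.1) :: up e.1)) (insert e.2 S) l

/-- The initial configuration is a separate case of `hc`, because w(r) may exceed `k`: a leaf as
starting vertex needs no guard once its only edge is clear. At that moment all searchers are at `r`
and no walk is necessary. -/
theorem exists_leads_stepMoves (hT : G.graph.IsTree) {k : ℕ} {up : V → List (V × V)}
    {S : Finset V} (hS : G.Linked S) {r x y : V} {c : Config V} (hx : x ∈ S) (hy : y ∉ S)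
    (hxy : G.graph.Adj x y) (hk : G.guard Finset.univ (insert y S) + G.slack x y ≤ k)
    (hup : G.Climb S r x (up x))
    (hc : G.Spare k S r c ∧ G.guard Finset.univ S ≤ k ∨
      S = {r} ∧ up r = [] ∧ c = start k r) :
    ∃ c', G.Leads c (G.stepMoves k up S x y) c' ∧ G.Spare k (insert y S) r c' := by
  have hS' := hS.enter hx hxy
  have hle := entry_le_guard_insert hT hS hx hy hxy
  have hg := guard_insert hT hS hx hy hxy
  have h1 : ∃ c1, G.Leads c (if k - G.guard Finset.univ S = 0 then [] else
      movesDown (k - G.guard Finset.univ S) (up x)) c1 ∧ c1.clear = G.inner S ∧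
      ∀ v, c1.occ v + (if v = y then G.entry y else 0) = G.need (insert y S) v +
        if v = x then k - (G.guard Finset.univ (insert y S) - G.entry y) else 0 := by
    rcases hc with ⟨hc, hkS⟩ | ⟨rfl, hr, rfl⟩
    · have h2 : ∃ c1, G.Leads c (if k - G.guard Finset.univ S = 0 then [] else
          movesDown (k - G.guard Finset.univ S) (up x)) c1 ∧ G.Spare k S x c1 := by
        split_ifs with h0
        · exact ⟨c, rfl, hc.of_eq_zero h0⟩
        · exact hc.down hS hx hup h0
      obtain ⟨c1, hc1, hc1'⟩ := h2
      refine ⟨c1, hc1, hc1'.clear, fun v => ?_⟩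
      rw [hc1'.occ v]
      have hvx := need_eq_vw hx hxy hy
      have hvx' := need_le (G := G) S x
      by_cases hvx : v = x
      · subst hvx
        simp only [hxy.ne, if_true, if_false]
        omega
      · by_cases hvy : v = y
        · subst hvy
          simp [hvx, need_eq_zero hy, need_insert_self hT hS hx hy hxy]
        · simp [hvx, hvy, need_insert_of_ne hT hS hx hy hxy hvx hvy]
    · rw [Finset.mem_singleton] at hx
      subst hx
      have hx1 : x ∈ ({x} : Finset V) := Finset.mem_singleton_self x
      refine ⟨start k x, ?_, ?_, fun v => ?_⟩
      · rw [hr]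
        split_ifs <;> rfl
      · ext e
        induction e with
        | _ a b =>
        rw [mem_inner]
        simp only [start, Set.mem_empty_iff_false, Finset.mem_singleton, false_iff]
        rintro ⟨h, rfl, rfl⟩
        exact G.graph.irrefl h
      · have hsing : G.guard Finset.univ {x} = G.vw x :=
          guard_singleton (Finset.mem_univ y) hxy
        by_cases hvx : v = x
        · subst hvx
          simp only [hxy.ne, if_true, if_false, start, Function.update_self]
          omega
        · by_cases hvy : v = y
          · subst hvy
            simp [hvx, start, need_insert_self hT hS hx1 hy hxy]
          · rw [need_insert_of_ne hT hS hx1 hy hxy hvx hvy,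
              need_eq_zero (by simpa using hvx)]
            simp [hvx, hvy, start]
  obtain ⟨c1, hc1, hcl, hocc⟩ := h1
  obtain ⟨c2, hc2, hc2'⟩ := Spare.slide hT hS hx hy hxy hk hcl hocc
  have h3 : ∃ c3, G.Leads c2 (if k - G.guard Finset.univ (insert y S) = 0 then [] else
      movesUp (k - G.guard Finset.univ (insert y S)) ((y, x) :: up x)) c3 ∧
      G.Spare k (insert y S) r c3 := by
    split_ifs with h0
    · exact ⟨c2, rfl, hc2'.of_eq_zero h0⟩
    · exact hc2'.up hS' (Finset.mem_insert_self _ _) ⟨rfl, Finset.mem_insert_of_mem hx, hxy.symm,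
        hup.mono (Finset.subset_insert _ _)⟩ h0
  obtain ⟨c3, hc3, hc3'⟩ := h3
  exact ⟨c3, (hc1.append hc2).append hc3, hc3'⟩

theorem exists_leads_strategy (hT : G.graph.IsTree) {k : ℕ} {r : V} {up : V → List (V × V)}
    {S : Finset V} (hS : G.Linked S) {c : Config V} {l : List (V × V)}
    (hl : G.Run Finset.univ k S l Finset.univ) (hup : ∀ x ∈ S, G.Climb S r x (up x))
    (hc : G.Spare k S r c ∧ G.guard Finset.univ S ≤ k ∨
      S = {r} ∧ up r = [] ∧ c = start k r) :
    ∃ c', G.Leads c (G.strategy k up S l) c' ∧ c'.clear = G.graph.edgeSet := by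
  induction l generalizing S up c with
  | nil =>
    cases hl
    refine ⟨c, rfl, ?_⟩
    rcases hc with ⟨hc, -⟩ | ⟨hr, -, rfl⟩
    · rw [hc.clear]
      simp [inner]
    · symm
      change G.graph.edgeSet = ∅
      rw [SimpleGraph.edgeSet_eq_empty]
      ext a b
      have ha := Finset.mem_univ a
      have hb := Finset.mem_univ b
      rw [hr, Finset.mem_singleton] at ha hb
      simp [ha, hb]
  | cons e l ih =>
    obtain ⟨x, y⟩ := e
    obtain ⟨h1, -, h3, h4, h5, h6⟩ := hl
    simp only at h1 h3 h4 h5 h6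
    obtain ⟨c1, hc1, hc1'⟩ := exists_leads_stepMoves hT hS h1 h3 h4 h5 (hup x h1) hc
    have hup' : ∀ z ∈ insert y S, G.Climb (insert y S) r z
        (Function.update up y ((y, x) :: up x) z) := by
      intro z hz
      by_cases hzy : z = y
      · subst hzy
        rw [Function.update_self]
        exact ⟨rfl, Finset.mem_insert_of_mem h1, h4.symm,
          (hup x h1).mono (Finset.subset_insert _ _)⟩
      · rw [Function.update_of_ne hzy]
        exact (hup z ((Finset.mem_insert.1 hz).resolve_left hzy)).mono (Finset.subset_insert _ _)
    obtain ⟨c2, hc2, hc2'⟩ := ih (hS.enter h1 h4) h6 hup' (Or.inl ⟨hc1', by omega⟩)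
    exact ⟨c2, hc1.append hc2, hc2'⟩

theorem isConnectedSearch_strategy (hT : G.graph.IsTree) {k : ℕ} {r : V} {l : List (V × V)}
    (hl : G.Run Finset.univ k {r} l Finset.univ) :
    G.IsConnectedSearch k r (G.strategy k (fun _ => []) {r} l) ∧
      G.IsMonotone k r (G.strategy k (fun _ => []) {r} l) := by
  obtain ⟨c, hc, hc'⟩ := exists_leads_strategy hT (linked_singleton r) hl (c := start k r)
    (up := fun _ => []) (fun x hx => Finset.mem_singleton.1 hx) (Or.inr ⟨rfl, rfl, rfl⟩)
  exact hc.clearsFrom hc'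

theorem length_movesDown (a : ℕ) (l : List (V × V)) : (movesDown a l).length = l.length := by
  simp [movesDown]

theorem connectedSearchNumber_eq (hT : G.graph.IsTree) {k : ℕ} {r : V} {l : List (V × V)}
    (hl : G.Run Finset.univ k {r} l Finset.univ)
    (hmin : ∀ k' r' l', G.Run Finset.univ k' {r'} l' Finset.univ → k ≤ k') :
    G.connectedSearchNumber = k := by
  refine le_antisymm (Nat.sInf_le ⟨r, _, (isConnectedSearch_strategy hT hl).1⟩) ?_
  have hne : {k | ∃ v₀ ms, G.IsConnectedSearch k v₀ ms}.Nonempty :=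
    ⟨k, r, _, (isConnectedSearch_strategy hT hl).1⟩
  obtain ⟨v₀, ms, h⟩ := Nat.sInf_mem hne
  obtain ⟨r', l', h'⟩ := h.exists_run hT
  exact hmin _ r' l' h'

end WeightedGraph

/-! ## Verification of programs -/

instance : Add Expr := ⟨Expr.add⟩
instance : Sub Expr := ⟨Expr.sub⟩
instance : OfNat Expr c := ⟨Expr.const c⟩

@[simp] theorem Expr.eval_add' (s : State) (e f : Expr) : (e + f).eval s = e.eval s + f.eval s :=
  rfl
@[simp] theorem Expr.eval_sub' (s : State) (e f : Expr) : (e - f).eval s = e.eval s - f.eval s :=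
  rfl
@[simp] theorem Expr.eval_ofNat (s : State) (c : ℕ) :
    (OfNat.ofNat c : Expr).eval s = c := rfl
@[simp] theorem Expr.eval_one (s : State) : (1 : Expr).eval s = 1 := rfl
@[simp] theorem Expr.eval_zero (s : State) : (0 : Expr).eval s = 0 := rfl
@[simp] theorem Expr.eval_var (s : State) (x : ℕ) : (Expr.var x).eval s = s.var x := rfl
@[simp] theorem Expr.eval_cell (s : State) (a : ℕ) (e : Expr) :
    (Expr.cell a e).eval s = s.arr a (e.eval s) := rfl

@[simp] theorem State.setVar_var (s : State) (x v y : ℕ) :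
    (s.setVar x v).var y = if y = x then v else s.var y := by
  simp [State.setVar, Function.update_apply]
@[simp] theorem State.setVar_arr (s : State) (x v : ℕ) : (s.setVar x v).arr = s.arr := rfl
@[simp] theorem State.setCell_var (s : State) (a i v : ℕ) : (s.setCell a i v).var = s.var := rfl
@[simp] theorem State.setCell_arr (s : State) (a i v b : ℕ) :
    (s.setCell a i v).arr b = if b = a then Function.update (s.arr b) i v else s.arr b := by
  simp only [State.setCell, Function.update_apply]
  split_ifs with h
  · rw [h]
  · rfl

namespace Program

/-- The variables that a program may change. -/
def wv : Program → List ℕ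
  | skip => []
  | assign x _ => [x]
  | put _ _ _ => []
  | seq p q => wv p ++ wv q
  | ite _ p q => wv p ++ wv q
  | loop _ p => wv p

/-- The arrays that a program may change. -/
def wa : Program → List ℕ
  | skip => []
  | assign _ _ => []
  | put a _ _ => [a]
  | seq p q => wa p ++ wa q
  | ite _ p q => wa p ++ wa q
  | loop _ p => wa p

/-- The states agree except for what `p` may change. -/
def Frame (p : Program) (s s' : State) : Prop :=
  (∀ x ∉ p.wv, s'.var x = s.var x) ∧ ∀ a ∉ p.wa, s'.arr a = s.arr a

/-- This frame rule lets a specification mention only what changes; everything else follows by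
deciding membership in the lists of written variables and arrays. -/
theorem Runs.frame {p : Program} {s s' : State} {t : ℕ} (h : p.Runs s t s') : p.Frame s s' := by
  induction h with
  | skip s => exact ⟨fun _ _ => rfl, fun _ _ => rfl⟩
  | assign s x e =>
    refine ⟨fun y hy => ?_, fun _ _ => rfl⟩
    simp only [wv, List.mem_singleton] at hy
    simp [hy]
  | put s a i e =>
    refine ⟨fun _ _ => rfl, fun b hb => ?_⟩
    simp only [wa, List.mem_singleton] at hb
    simp [hb]
  | seq _ _ ih1 ih2 =>
    constructor
    · intro x hx
      simp only [wv, List.mem_append, not_or] at hx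
      rw [ih2.1 x hx.2, ih1.1 x hx.1]
    · intro x hx
      simp only [wa, List.mem_append, not_or] at hx
      rw [ih2.2 x hx.2, ih1.2 x hx.1]
  | ite_true _ _ ih =>
    constructor
    · intro x hx
      simp only [wv, List.mem_append, not_or] at hx
      exact ih.1 x hx.1
    · intro x hx
      simp only [wa, List.mem_append, not_or] at hx
      exact ih.2 x hx.1
  | ite_false _ _ ih =>
    constructor
    · intro x hx
      simp only [wv, List.mem_append, not_or] at hx
      exact ih.1 x hx.2
    · intro x hx
      simp only [wa, List.mem_append, not_or] at hx
      exact ih.2 x hx.2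
  | loop_done _ => exact ⟨fun _ _ => rfl, fun _ _ => rfl⟩
  | loop_step _ _ _ ih1 ih2 =>
    constructor
    · intro x hx
      rw [ih2.1 x hx, ih1.1 x hx]
    · intro x hx
      rw [ih2.2 x hx, ih1.2 x hx]

theorem Frame.trans {p : Program} {s s' s'' : State} (h : p.Frame s s') (h' : p.Frame s' s'') :
    p.Frame s s'' :=
  ⟨fun x hx => by rw [h'.1 x hx, h.1 x hx], fun x hx => by rw [h'.2 x hx, h.2 x hx]⟩

theorem Frame.refl (p : Program) (s : State) : p.Frame s s := ⟨fun _ _ => rfl, fun _ _ => rfl⟩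

/-- Started in `s`, the program `p` halts after at most `T` steps in a state that satisfies `Q`. -/
def Halts (p : Program) (s : State) (T : ℕ) (Q : State → Prop) : Prop :=
  ∃ t s', p.Runs s t s' ∧ t ≤ T ∧ Q s'

variable {p q : Program} {s : State} {T T' : ℕ} {Q Q' : State → Prop}

theorem Halts.imp (h : p.Halts s T Q) (hT : T ≤ T') (hQ : ∀ s', p.Frame s s' → Q s' → Q' s') :
    p.Halts s T' Q' := by
  obtain ⟨t, s', h1, h2, h3⟩ := h
  exact ⟨t, s', h1, h2.trans hT, hQ s' h1.frame h3⟩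

theorem Halts.seq (h : p.Halts s T Q) (h' : ∀ s', p.Frame s s' → Q s' → q.Halts s' T' Q') :
    (p.seq q).Halts s (T + T') Q' := by
  obtain ⟨t, s', h1, h2, h3⟩ := h
  obtain ⟨t', s'', h1', h2', h3'⟩ := h' s' h1.frame h3
  exact ⟨t + t', s'', .seq h1 h1', by omega, h3'⟩

theorem halts_ite {e : Expr} (h : e.eval s ≠ 0 → p.Halts s T Q)
    (h' : e.eval s = 0 → q.Halts s T Q) : (ite e p q).Halts s (e.cost + 1 + T) Q := by
  by_cases he : e.eval s = 0
  · obtain ⟨t, s', h1, h2, h3⟩ := h' he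
    exact ⟨_, s', .ite_false he h1, by omega, h3⟩
  · obtain ⟨t, s', h1, h2, h3⟩ := h he
    exact ⟨_, s', .ite_true he h1, by omega, h3⟩

/-- The invariant is indexed by the number of completed passes, which is exactly `N` at the end; the
factor `N + 1` pays for the failing last test. -/
theorem halts_loop {e : Expr} {Inv : ℕ → State → Prop} (N : ℕ) (h0 : Inv 0 s)
    (hstep : ∀ i < N, ∀ s', p.Frame s s' → Inv i s' → e.eval s' ≠ 0 ∧ p.Halts s' T (Inv (i + 1)))
    (hend : ∀ s', p.Frame s s' → Inv N s' → e.eval s' = 0) :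
    (loop e p).Halts s ((N + 1) * (T + e.cost + 1)) (Inv N) := by
  have key : ∀ d i, i + d = N → ∀ s', p.Frame s s' → Inv i s' →
      (loop e p).Halts s' ((d + 1) * (T + e.cost + 1)) (Inv N) := by
    intro d
    induction d with
    | zero =>
      intro i hi s' hF hs
      rw [add_zero] at hi
      subst hi
      exact ⟨_, s', .loop_done (hend s' hF hs), by rw [zero_add, one_mul]; omega, hs⟩
    | succ d ih =>
      intro i hi s' hF hs
      obtain ⟨he, t, s'', h1, h2, h3⟩ := hstep i (by omega) s' hF hs
      obtain ⟨t', s''', h1', h2', h3'⟩ := ih (i + 1) (by omega) s'' (hF.trans h1.frame) h3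
      refine ⟨_, s''', .loop_step he h1 h1', ?_, h3'⟩
      rw [add_mul (d + 1) 1, one_mul]
      omega
  exact key N 0 (by omega) s (Frame.refl p s) h0

/-! ### Programs without loops, evaluated symbolically. -/

/-- The final state of a program without loops. -/
def exec : Program → State → State
  | skip, s => s
  | assign x e, s => s.setVar x (e.eval s)
  | put a i e, s => s.setCell a (i.eval s) (e.eval s)
  | seq p q, s => exec q (exec p s)
  | ite e p q, s => if e.eval s = 0 then exec q s else exec p s
  | loop _ _, s => s

/-- A bound for the number of steps of a program without loops. -/
def cost : Program → ℕ
  | skip => 1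
  | assign _ e => e.cost + 1
  | put _ i e => i.cost + e.cost + 1
  | seq p q => cost p + cost q
  | ite e p q => e.cost + 1 + (cost p + cost q)
  | loop _ _ => 0

/-- The program has no loops. -/
def straight : Program → Bool
  | skip => true
  | assign _ _ => true
  | put _ _ _ => true
  | seq p q => straight p && straight q
  | ite _ p q => straight p && straight q
  | loop _ _ => false

theorem halts_straight (hp : p.straight = true) (h : Q (p.exec s)) : p.Halts s p.cost Q := by
  have key : ∀ (p : Program) (s : State), p.straight = true →
      ∃ t, p.Runs s t (p.exec s) ∧ t ≤ p.cost := by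
    intro p
    induction p with
    | skip => exact fun s _ => ⟨1, .skip s, le_rfl⟩
    | assign x e => exact fun s _ => ⟨_, .assign s x e, le_rfl⟩
    | put a i e => exact fun s _ => ⟨_, .put s a i e, le_rfl⟩
    | seq p q ih1 ih2 =>
      intro s h
      simp only [straight, Bool.and_eq_true] at h
      obtain ⟨t, h1, h2⟩ := ih1 s h.1
      obtain ⟨t', h1', h2'⟩ := ih2 (p.exec s) h.2
      exact ⟨_, .seq h1 h1', by simp only [cost]; omega⟩
    | ite e p q ih1 ih2 =>
      intro s h
      simp only [straight, Bool.and_eq_true] at h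
      by_cases he : e.eval s = 0
      · obtain ⟨t, h1, h2⟩ := ih2 s h.2
        refine ⟨e.cost + 1 + t, ?_, ?_⟩
        · exact .ite_false he (by simpa [exec, he] using h1)
        · simp only [cost]; omega
      · obtain ⟨t, h1, h2⟩ := ih1 s h.1
        refine ⟨e.cost + 1 + t, ?_, ?_⟩
        · exact .ite_true he (by simpa [exec, he] using h1)
        · simp only [cost]; omega
    | loop e p => intro s h; simp [straight] at h
  obtain ⟨t, h1, h2⟩ := key p s hp
  exact ⟨t, _, h1, h2, h⟩

end Program

open WeightedGraph

infixr:30 " ;; " => Program.seq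
infix:40 " ≔ " => Program.assign

/-- The value of a variable. -/
abbrev V (x : ℕ) : Expr := .var x

/-- The value of an array cell. -/
abbrev A (a : ℕ) (e : Expr) : Expr := .cell a e

/-! ### Lists of steps stored in arrays. -/

/-- The four arrays hold the steps in `l`, starting at cell `o`. -/
def Enc {n : ℕ} (X Y F S : ℕ → ℕ) (o : ℕ) (l : List (Stp (Fin n))) : Prop :=
  ∀ i (h : i < l.length),
    X (o + i) = l[i].x ∧ Y (o + i) = l[i].y ∧ F (o + i) = l[i].sf ∧ S (o + i) = l[i].sp

section Enc

variable {n : ℕ} {X Y F S X' Y' F' S' : ℕ → ℕ} {o : ℕ} {l : List (Stp (Fin n))}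

theorem Enc.nil : Enc X Y F S o ([] : List (Stp (Fin n))) := by
  intro i h
  simp at h

theorem Enc.head {a : Stp (Fin n)} (h : Enc X Y F S o (a :: l)) :
    X o = a.x ∧ Y o = a.y ∧ F o = a.sf ∧ S o = a.sp := h 0 (by simp)

theorem Enc.tail {a : Stp (Fin n)} (h : Enc X Y F S o (a :: l)) : Enc X Y F S (o + 1) l := by
  intro i hi
  have := h (i + 1) (by simpa using hi)
  simpa [add_assoc, add_comm 1 i] using this

theorem Enc.congr (h : Enc X Y F S o l) (h' : ∀ i < l.length, X' (o + i) = X (o + i) ∧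
    Y' (o + i) = Y (o + i) ∧ F' (o + i) = F (o + i) ∧ S' (o + i) = S (o + i)) :
    Enc X' Y' F' S' o l := by
  intro i hi
  obtain ⟨h1, h2, h3, h4⟩ := h' i hi
  rw [h1, h2, h3, h4]
  exact h i hi

theorem Enc.snoc (h : Enc X Y F S o l) (h' : ∀ i < o + l.length, X' i = X i ∧
    Y' i = Y i ∧ F' i = F i ∧ S' i = S i) {a : Stp (Fin n)}
    (ha : X' (o + l.length) = a.x ∧ Y' (o + l.length) = a.y ∧ F' (o + l.length) = a.sf ∧
      S' (o + l.length) = a.sp) :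
    Enc X' Y' F' S' o (l ++ [a]) := by
  intro i hi
  rw [List.length_append, List.length_singleton] at hi
  by_cases hil : i < l.length
  · obtain ⟨h1, h2, h3, h4⟩ := h' (o + i) (by omega)
    rw [List.getElem_append_left hil, h1, h2, h3, h4]
    exact h i hil
  · have : i = l.length := by omega
    subst this
    simpa using ha

end Enc

theorem peakFrom_snoc {W : Type*} (c q : ℕ) (l : List (Stp W)) (a : Stp W) :
    peakFrom c q (l ++ [a]) =
      if c ≤ a.sf then max (peakFrom c q l) a.sp else peakFrom c q l := by
  simp [peakFrom]

/-! ### The program that merges two rows. -/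

/-- Choose the list from which the next step is taken. -/
def mergeChoose : Program :=
  -- Variables 17 and 18 delimit what is left of the first row, 19 and 20 what is left of the
  -- second. A nonzero value of variable 27 means that the next step comes from the second row.
  .ite (V 18 - V 17) (25 ≔ A 17 (V 17)) (25 ≔ 0) ;;
  .ite (V 20 - V 19) (26 ≔ A 17 (V 19)) (26 ≔ 0) ;;
  .ite (V 18 - V 17)
    (.ite (V 20 - V 19) (27 ≔ (A 18 (V 17) + V 26) - (A 18 (V 19) + V 25)) (27 ≔ 0)) (27 ≔ 1)

/-- Append the chosen step. -/
def mergeTake : Program :=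
  .put 21 (V 24) (V 25 + V 26) ;;
  .ite (V 27)
    (.put 19 (V 24) (A 15 (V 19)) ;; .put 20 (V 24) (A 16 (V 19)) ;;
      .put 22 (V 24) (A 18 (V 19) + V 25) ;; 19 ≔ V 19 + 1)
    (.put 19 (V 24) (A 15 (V 17)) ;; .put 20 (V 24) (A 16 (V 17)) ;;
      .put 22 (V 24) (A 18 (V 17) + V 26) ;; 17 ≔ V 17 + 1) ;;
  -- The condition says that the `sf` of the new step is at least `c`; adding a truncated difference
  -- yields the maximum.
  .ite ((V 25 + V 26 + 1) - V 21) (23 ≔ V 23 + (A 22 (V 24) - V 23)) .skip ;;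
  24 ≔ V 24 + 1

/-- Merge two rows into the temporary row, and compute the peak. -/
def mergeLoop : Program :=
  .loop ((V 18 - V 17) + (V 20 - V 19)) (mergeChoose ;; mergeTake)

section Merge

variable {n : ℕ} {s : State} {P Q : List (Stp (Fin n))}

/-- An exhausted row has `headSf` equal to 0, so shifting by the guard of the opposite row leaves
the steps of the remaining row unchanged. One rule thus covers all cases of `mergeSteps`. -/
theorem mergeChoose_spec (hP : Enc (s.arr 15) (s.arr 16) (s.arr 17) (s.arr 18) (s.var 17) P)
    (hQ : Enc (s.arr 15) (s.arr 16) (s.arr 17) (s.arr 18) (s.var 19) Q)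
    (hpe : s.var 18 = s.var 17 + P.length) (hqe : s.var 20 = s.var 19 + Q.length)
    (hne : 0 < P.length + Q.length) :
    mergeChoose.Halts s mergeChoose.cost fun s' => s'.var 25 = headSf P ∧ s'.var 26 = headSf Q ∧
      ((s'.var 27 = 0 ∧ ∃ a P', P = a :: P' ∧ mergeSteps P Q =
        ⟨a.x, a.y, headSf P + headSf Q, a.sp + headSf Q⟩ :: mergeSteps P' Q) ∨
      (s'.var 27 ≠ 0 ∧ ∃ b Q', Q = b :: Q' ∧ mergeSteps P Q =
        ⟨b.x, b.y, headSf P + headSf Q, b.sp + headSf P⟩ :: mergeSteps P Q')) := by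
  refine Program.halts_straight rfl ?_
  cases P with
  | nil =>
    cases Q with
    | nil => simp at hne
    | cons b Q =>
      obtain ⟨-, -, h3, h4⟩ := hQ.head
      simp only [List.length_nil, List.length_cons] at hpe hqe
      simp [mergeChoose, Program.exec, hpe, hqe, headSf, h3, mergeSteps]
  | cons a P =>
    obtain ⟨-, -, g3, g4⟩ := hP.head
    cases Q with
    | nil =>
      simp only [List.length_nil, List.length_cons] at hpe hqe
      simp [mergeChoose, Program.exec, hpe, hqe, headSf, g3, mergeSteps_nil_right]
    | cons b Q =>
      obtain ⟨-, -, h3, h4⟩ := hQ.head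
      simp only [List.length_cons] at hpe hqe
      rw [mergeSteps]
      have e1 : s.var 18 - s.var 17 = P.length + 1 := by omega
      have e2 : s.var 20 - s.var 19 = Q.length + 1 := by omega
      by_cases hc : a.sp + b.sf ≤ b.sp + a.sf
      · simp [mergeChoose, Program.exec, e1, e2, g3, g4, h3, h4, hc, headSf]
      · have hc' : a.sp + b.sf - (b.sp + a.sf) ≠ 0 := by omega
        simp [mergeChoose, Program.exec, e1, e2, g3, g4, h3, h4, hc, hc', headSf]

theorem mergeTake_spec {F R : List (Stp (Fin n))} {c e : ℕ}
    (hP : Enc (s.arr 15) (s.arr 16) (s.arr 17) (s.arr 18) (s.var 17) P)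
    (hQ : Enc (s.arr 15) (s.arr 16) (s.arr 17) (s.arr 18) (s.var 19) Q)
    (hpe : s.var 18 = s.var 17 + P.length) (hqe : s.var 20 = s.var 19 + Q.length)
    (hF : Enc (s.arr 19) (s.arr 20) (s.arr 21) (s.arr 22) 1 F) (ht : s.var 24 = 1 + F.length)
    (hR : F ++ mergeSteps P Q = R) (hc : s.var 21 = c) (hpk : s.var 23 = peakFrom c e F)
    (h25 : s.var 25 = headSf P) (h26 : s.var 26 = headSf Q)
    (h27 : (s.var 27 = 0 ∧ ∃ a P', P = a :: P' ∧ mergeSteps P Q =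
        ⟨a.x, a.y, headSf P + headSf Q, a.sp + headSf Q⟩ :: mergeSteps P' Q) ∨
      (s.var 27 ≠ 0 ∧ ∃ b Q', Q = b :: Q' ∧ mergeSteps P Q =
        ⟨b.x, b.y, headSf P + headSf Q, b.sp + headSf P⟩ :: mergeSteps P Q')) :
    mergeTake.Halts s mergeTake.cost fun s' => ∃ P' Q' F',
      Enc (s.arr 15) (s.arr 16) (s.arr 17) (s.arr 18) (s'.var 17) P' ∧
      Enc (s.arr 15) (s.arr 16) (s.arr 17) (s.arr 18) (s'.var 19) Q' ∧
      s.var 18 = s'.var 17 + P'.length ∧ s.var 20 = s'.var 19 + Q'.length ∧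
      Enc (s'.arr 19) (s'.arr 20) (s'.arr 21) (s'.arr 22) 1 F' ∧ s'.var 24 = 1 + F'.length ∧
      F' ++ mergeSteps P' Q' = R ∧ s'.var 23 = peakFrom c e F' ∧ F'.length = F.length + 1 ∧
      (∀ i < 1, s'.arr 19 i = s.arr 19 i ∧ s'.arr 20 i = s.arr 20 i ∧ s'.arr 21 i = s.arr 21 i ∧
        s'.arr 22 i = s.arr 22 i) := by
  refine Program.halts_straight rfl ?_
  -- What both alternatives share, with `z` the appended step and `P'`, `Q'` the rests.
  have fin : ∀ (P' Q' : List (Stp (Fin n))) (z : Stp (Fin n)) (s' : State),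
      z.sf = headSf P + headSf Q → mergeSteps P Q = z :: mergeSteps P' Q' →
      Enc (s.arr 15) (s.arr 16) (s.arr 17) (s.arr 18) (s'.var 17) P' →
      Enc (s.arr 15) (s.arr 16) (s.arr 17) (s.arr 18) (s'.var 19) Q' →
      s.var 18 = s'.var 17 + P'.length → s.var 20 = s'.var 19 + Q'.length →
      s'.arr 19 = Function.update (s.arr 19) (s.var 24) z.x →
      s'.arr 20 = Function.update (s.arr 20) (s.var 24) z.y →
      s'.arr 21 = Function.update (s.arr 21) (s.var 24) z.sf →
      s'.arr 22 = Function.update (s.arr 22) (s.var 24) z.sp →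
      s'.var 24 = s.var 24 + 1 →
      (s'.var 23 = if s.var 25 + s.var 26 + 1 - c = 0 then s.var 23 else
        s.var 23 + (z.sp - s.var 23)) →
      ∃ P' Q' F',
      Enc (s.arr 15) (s.arr 16) (s.arr 17) (s.arr 18) (s'.var 17) P' ∧
      Enc (s.arr 15) (s.arr 16) (s.arr 17) (s.arr 18) (s'.var 19) Q' ∧
      s.var 18 = s'.var 17 + P'.length ∧ s.var 20 = s'.var 19 + Q'.length ∧
      Enc (s'.arr 19) (s'.arr 20) (s'.arr 21) (s'.arr 22) 1 F' ∧ s'.var 24 = 1 + F'.length ∧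
      F' ++ mergeSteps P' Q' = R ∧ s'.var 23 = peakFrom c e F' ∧ F'.length = F.length + 1 ∧
      (∀ i < 1, s'.arr 19 i = s.arr 19 i ∧ s'.arr 20 i = s.arr 20 i ∧ s'.arr 21 i = s.arr 21 i ∧
        s'.arr 22 i = s.arr 22 i) := by
    intro P' Q' z s' hz hm h1 h2 h3 h4 h5 h6 h7 h8 h9 h10
    have hne : ∀ i < 1 + F.length, s'.arr 19 i = s.arr 19 i ∧ s'.arr 20 i = s.arr 20 i ∧
        s'.arr 21 i = s.arr 21 i ∧ s'.arr 22 i = s.arr 22 i := by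
      intro i hi
      have : i ≠ s.var 24 := by omega
      simp [h5, h6, h7, h8, this]
    refine ⟨P', Q', F ++ [z], h1, h2, h3, h4, hF.snoc hne ?_, ?_, ?_, ?_, by simp,
      fun i hi => hne i (by omega)⟩
    · simp [h5, h6, h7, h8, ← ht]
    · simp [h9, ht, add_assoc]
    · simp [← hR, hm]
    · rw [peakFrom_snoc, h10, hpk, h25, h26, ← hz]
      split_ifs <;> omega
  rcases h27 with ⟨h27, a, P', rfl, hm⟩ | ⟨h27, b, Q', rfl, hm⟩
  · obtain ⟨g1, g2, g3, g4⟩ := hP.head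
    rw [List.length_cons] at hpe
    rw [← h25, ← h26] at hm
    refine fin P' Q ⟨a.x, a.y, _, _⟩ _ (by rw [← h25, ← h26]) hm ?_ ?_ ?_ ?_ ?_ ?_ ?_ ?_ ?_ ?_ <;>
      by_cases hcc : s.var 25 + s.var 26 + 1 - c = 0 <;>
      simp [mergeTake, Program.exec, h27, hc, hcc, g1, g2, g4, hP.tail, hQ, hqe] <;> omega
  · obtain ⟨g1, g2, g3, g4⟩ := hQ.head
    rw [List.length_cons] at hqe
    rw [← h25, ← h26] at hm
    refine fin P Q' ⟨b.x, b.y, _, _⟩ _ (by rw [← h25, ← h26]) hm ?_ ?_ ?_ ?_ ?_ ?_ ?_ ?_ ?_ ?_ <;>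
      by_cases hcc : s.var 25 + s.var 26 + 1 - c = 0 <;>
      simp [mergeTake, Program.exec, h27, hc, hcc, g1, g2, g4, hQ.tail, hP, hpe] <;> omega

/-- The part written so far, followed by the merge of the two rests, is always the whole merge.
Writing begins at cell 1, because cell 0 is reserved for the step that enters the first neighbour.
-/
theorem mergeLoop_spec {c e : ℕ}
    (hP : Enc (s.arr 15) (s.arr 16) (s.arr 17) (s.arr 18) (s.var 17) P)
    (hQ : Enc (s.arr 15) (s.arr 16) (s.arr 17) (s.arr 18) (s.var 19) Q)
    (hpe : s.var 18 = s.var 17 + P.length) (hqe : s.var 20 = s.var 19 + Q.length)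
    (ht : s.var 24 = 1) (hc : s.var 21 = c) (hpk : s.var 23 = e) :
    mergeLoop.Halts s ((P.length + Q.length + 1) * 120) fun s' =>
      Enc (s'.arr 19) (s'.arr 20) (s'.arr 21) (s'.arr 22) 1 (mergeSteps P Q) ∧
      s'.var 24 = 1 + (P.length + Q.length) ∧ s'.var 23 = peakFrom c e (mergeSteps P Q) ∧
      (s'.arr 19 0 = s.arr 19 0 ∧ s'.arr 20 0 = s.arr 20 0 ∧ s'.arr 21 0 = s.arr 21 0 ∧
        s'.arr 22 0 = s.arr 22 0) := by
  refine (Program.halts_loop (T := mergeChoose.cost + mergeTake.cost)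
    (Inv := fun i s' => ∃ P' Q' F' : List (Stp (Fin n)),
      Enc (s.arr 15) (s.arr 16) (s.arr 17) (s.arr 18) (s'.var 17) P' ∧
      Enc (s.arr 15) (s.arr 16) (s.arr 17) (s.arr 18) (s'.var 19) Q' ∧
      s.var 18 = s'.var 17 + P'.length ∧ s.var 20 = s'.var 19 + Q'.length ∧
      Enc (s'.arr 19) (s'.arr 20) (s'.arr 21) (s'.arr 22) 1 F' ∧ s'.var 24 = 1 + F'.length ∧
      F' ++ mergeSteps P' Q' = mergeSteps P Q ∧ s'.var 23 = peakFrom c e F' ∧ F'.length = i ∧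
      (∀ i < 1, s'.arr 19 i = s.arr 19 i ∧ s'.arr 20 i = s.arr 20 i ∧ s'.arr 21 i = s.arr 21 i ∧
        s'.arr 22 i = s.arr 22 i))
    (P.length + Q.length) ?_ ?_ ?_).imp (Nat.mul_le_mul_left _ (by decide)) ?_
  · exact ⟨P, Q, [], hP, hQ, hpe, hqe, Enc.nil, by simp [ht], rfl, by simp [hpk, peakFrom], rfl,
      fun i hi => ⟨rfl, rfl, rfl, rfl⟩⟩
  · rintro i hi s' hfr ⟨P', Q', F', h1, h2, h3, h4, h5, h6, h7, h8, h9, h10⟩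
    have e18 : s'.var 18 = s.var 18 := hfr.1 18 (by decide)
    have e20 : s'.var 20 = s.var 20 := hfr.1 20 (by decide)
    have e21 : s'.var 21 = s.var 21 := hfr.1 21 (by decide)
    have a15 : s'.arr 15 = s.arr 15 := hfr.2 15 (by decide)
    have a16 : s'.arr 16 = s.arr 16 := hfr.2 16 (by decide)
    have a17 : s'.arr 17 = s.arr 17 := hfr.2 17 (by decide)
    have a18 : s'.arr 18 = s.arr 18 := hfr.2 18 (by decide)
    have hlen := congrArg List.length h7
    simp only [List.length_append, length_mergeSteps] at hlen
    refine ⟨by simp; omega, ?_⟩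
    refine (mergeChoose_spec (P := P') (Q := Q') (by rwa [a15, a16, a17, a18])
      (by rwa [a15, a16, a17, a18]) (by omega) (by omega) (by omega)).seq ?_
    rintro s2 hfr2 ⟨k1, k2, k3⟩
    have b : s2.arr = s'.arr := funext fun a => hfr2.2 a (by simp [mergeChoose, Program.wa])
    have b17 : s2.var 17 = s'.var 17 := hfr2.1 17 (by decide)
    have b18 : s2.var 18 = s'.var 18 := hfr2.1 18 (by decide)
    have b19 : s2.var 19 = s'.var 19 := hfr2.1 19 (by decide)
    have b20 : s2.var 20 = s'.var 20 := hfr2.1 20 (by decide)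
    have b21 : s2.var 21 = s'.var 21 := hfr2.1 21 (by decide)
    have b23 : s2.var 23 = s'.var 23 := hfr2.1 23 (by decide)
    have b24 : s2.var 24 = s'.var 24 := hfr2.1 24 (by decide)
    refine (mergeTake_spec (P := P') (Q := Q') (F := F') (R := mergeSteps P Q) (c := c) (e := e)
      (by rwa [b, b17, a15, a16, a17, a18]) (by rwa [b, b19, a15, a16, a17, a18]) (by omega)
      (by omega) (by rwa [b]) (by omega) h7 (by omega) (by omega) k1 k2 k3).imp le_rfl ?_
    rintro s3 hfr3 ⟨P'', Q'', F'', m1, m2, m3, m4, m5, m6, m7, m8, m9, m10⟩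
    rw [b, a15, a16, a17, a18] at m1 m2
    refine ⟨P'', Q'', F'', m1, m2, by omega, by omega, m5, m6, m7, m8, by omega, fun i hi => ?_⟩
    have := m10 i hi
    rw [b] at this
    simpa [h10 i hi] using this
  · rintro s' hfr ⟨P', Q', F', h1, h2, h3, h4, h5, h6, h7, h8, h9, h10⟩
    have e18 : s'.var 18 = s.var 18 := hfr.1 18 (by decide)
    have e20 : s'.var 20 = s.var 20 := hfr.1 20 (by decide)
    have hlen := congrArg List.length h7
    simp only [List.length_append, length_mergeSteps] at hlen
    simp; omega
  · rintro s' hfr ⟨P', Q', F', h1, h2, h3, h4, h5, h6, h7, h8, h9, h10⟩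
    have hlen := congrArg List.length h7
    simp only [List.length_append, length_mergeSteps] at hlen
    have e1 : P' = [] := List.length_eq_zero_iff.1 (by omega)
    have e2 : Q' = [] := List.length_eq_zero_iff.1 (by omega)
    subst e1 e2
    rw [mergeSteps_nil_right, List.append_nil] at h7
    subst h7
    exact ⟨h5, by omega, h8, h10 0 (by omega)⟩

end Merge

/-! ## Subsets of the neighbors, and the layout of the table -/

/-- Going down from the top bit, comparing the remainder of `m` with `2 ^ j` reads bit `j`;
addition, subtraction and zero tests suffice for this. -/
theorem mod_two_pow_succ (m j : ℕ) :
    m % 2 ^ (j + 1) = m % 2 ^ j + if m.testBit j then 2 ^ j else 0 := by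
  rw [Nat.mod_pow_succ, Nat.testBit_eq_decide_div_mod_eq]
  rcases Nat.mod_two_eq_zero_or_one (m / 2 ^ j) with h | h <;> simp [h]

theorem testBit_sub_two_pow {m j : ℕ} (h : m.testBit j = true) (i : ℕ) :
    (m - 2 ^ j).testBit i = (m.testBit i && decide (i ≠ j)) := by
  obtain ⟨a, l, hl, rfl⟩ : ∃ a l, l < 2 ^ j ∧ m = 2 ^ (j + 1) * a + (2 ^ j + l) := by
    refine ⟨m / 2 ^ (j + 1), m % 2 ^ j, Nat.mod_lt _ (by positivity), ?_⟩
    have h1 := Nat.div_add_mod m (2 ^ (j + 1))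
    have h2 := mod_two_pow_succ m j
    rw [if_pos h] at h2
    omega
  have hj : 2 ^ (j + 1) = 2 * 2 ^ j := by rw [pow_succ, mul_comm]
  have e : 2 ^ (j + 1) * a + (2 ^ j + l) - 2 ^ j = 2 ^ (j + 1) * a + l := by omega
  rw [e, Nat.testBit_two_pow_mul_add _ (by omega), Nat.testBit_two_pow_mul_add _ (by omega)]
  rcases lt_trichotomy i j with hi | rfl | hi
  · rw [if_pos (by omega), if_pos (by omega), Nat.testBit_two_pow_add_gt hi]
    simp [hi.ne]
  · rw [if_pos (by omega)]
    simp [Nat.testBit_lt_two_pow hl]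
  · rw [if_neg (by omega), if_neg (by omega)]
    simp [hi.ne']

theorem two_pow_le_of_testBit {m j : ℕ} (h : m.testBit j = true) : 2 ^ j ≤ m :=
  Nat.ge_two_pow_of_testBit h

section Layout

variable {n : ℕ} (T : WeightedGraph (Fin n)) (nb : Fin n → List (Fin n))

/-- `nb` lists the neighbors of every vertex. -/
structure Neighbors : Prop where
  nodup (u : Fin n) : (nb u).Nodup
  mem {u v : Fin n} : v ∈ nb u ↔ T.graph.Adj u v

/-- The neighbors of `u` that are given by the bits of `m`. -/
noncomputable def sel (u : Fin n) (m : ℕ) : Finset (Fin n) :=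
  (T.nbrs u).filter fun v => m.testBit ((nb u).idxOf v)

variable {T nb} (hN : Neighbors T nb)
include hN

theorem mem_sel {u v : Fin n} {m : ℕ} :
    v ∈ sel T nb u m ↔ ∃ j, ∃ h : j < (nb u).length, (nb u)[j] = v ∧ m.testBit j = true := by
  simp only [sel, Finset.mem_filter, mem_nbrs, ← hN.mem]
  constructor
  · rintro ⟨h1, h2⟩
    exact ⟨_, List.idxOf_lt_length_of_mem h1, List.getElem_idxOf _, h2⟩
  · rintro ⟨j, h, rfl, h'⟩
    exact ⟨List.getElem_mem h, by rwa [(hN.nodup u).idxOf_getElem]⟩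

omit hN in
theorem sel_subset (u : Fin n) (m : ℕ) : sel T nb u m ⊆ T.nbrs u := Finset.filter_subset _ _

omit hN in
theorem sel_zero (u : Fin n) : sel T nb u 0 = ∅ := by simp [sel]

theorem sel_full (u : Fin n) : sel T nb u (2 ^ (nb u).length - 1) = T.nbrs u := by
  refine Finset.filter_true_of_mem fun v hv => ?_
  rw [mem_nbrs, ← hN.mem] at hv
  simpa using List.idxOf_lt_length_of_mem hv

theorem sel_sub {u v : Fin n} {m : ℕ} (hv : v ∈ sel T nb u m) :
    sel T nb u (m - 2 ^ (nb u).idxOf v) = (sel T nb u m).erase v := by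
  simp only [sel, Finset.mem_filter, mem_nbrs] at hv
  ext w
  simp only [sel, Finset.mem_filter, mem_nbrs, Finset.mem_erase, testBit_sub_two_pow hv.2,
    Bool.and_eq_true, decide_eq_true_eq]
  have : T.graph.Adj u w → ((nb u).idxOf w ≠ (nb u).idxOf v ↔ w ≠ v) := by
    intro hw
    rw [← hN.mem] at hw
    exact not_congr (List.idxOf_inj hw)
  tauto

theorem sel_eq_empty {u : Fin n} {m : ℕ} (hm : m < 2 ^ (nb u).length) :
    sel T nb u m = ∅ ↔ m = 0 := by
  constructor
  · intro h
    by_contra h0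
    obtain ⟨j, hj, -⟩ := Nat.exists_most_significant_bit h0
    have hjl : j < (nb u).length := by
      by_contra hge
      have := two_pow_le_of_testBit hj
      have := Nat.pow_le_pow_right (n := 2) (by norm_num) (not_lt.1 hge)
      omega
    have := (mem_sel hN).2 ⟨j, hjl, rfl, hj⟩
    rw [h] at this
    simp at this
  · rintro rfl
    exact sel_zero u

theorem length_nb (u : Fin n) : (nb u).length = (T.nbrs u).card := by
  rw [← List.toFinset_card_of_nodup (hN.nodup u)]
  congr 1
  ext v
  simp [hN.mem, mem_nbrs]

theorem ncard_neighborSet (u : Fin n) : (T.graph.neighborSet u).ncard = (nb u).length := by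
  rw [length_nb hN, ← Set.ncard_coe_finset]
  congr 1
  ext v
  simp [mem_nbrs]

omit hN

/-! ### Addresses of the rows. -/

variable (nb)

/-- The number of subsets of the neighbors of the vertex `x`. -/
def width (x : ℕ) : ℕ := if h : x < n then 2 ^ (nb ⟨x, h⟩).length else 0

/-- The number of rows that come before those of the vertex `x`. -/
def rows (x : ℕ) : ℕ := ∑ y ∈ Finset.range x, width nb y

/-- The start of the row for `u` and the bits of `m`. -/
def row (u : Fin n) (m : ℕ) : ℕ := n * rows nb u + n * m

variable {nb}

theorem width_val (u : Fin n) : width nb u = 2 ^ (nb u).length := by simp [width]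

theorem rows_succ (x : ℕ) : rows nb (x + 1) = rows nb x + width nb x := Finset.sum_range_succ _ _

theorem rows_mono {x y : ℕ} (h : x ≤ y) : rows nb x ≤ rows nb y :=
  Finset.sum_le_sum_of_subset (Finset.range_subset_range.2 h)

/-- Dividing an address by `n` yields the number of its row, and the intervals of row numbers of
different vertices are disjoint. -/
theorem row_inj {u v : Fin n} {m k i j : ℕ} (hm : m < 2 ^ (nb u).length)
    (hk : k < 2 ^ (nb v).length)
    (hi : i < n) (hj : j < n) (h : row nb u m + i = row nb v k + j) : u = v ∧ m = k ∧ i = j := by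
  have h1 : rows nb u + m = rows nb v + k ∧ i = j := by
    have e1 : (row nb u m + i) / n = rows nb u + m := by
      rw [row, ← mul_add, Nat.mul_add_div (by omega), Nat.div_eq_of_lt hi, add_zero]
    have e2 : (row nb v k + j) / n = rows nb v + k := by
      rw [row, ← mul_add, Nat.mul_add_div (by omega), Nat.div_eq_of_lt hj, add_zero]
    have e3 : rows nb u + m = rows nb v + k := by rw [← e1, h, e2]
    refine ⟨e3, ?_⟩
    rw [row, row, ← mul_add, ← mul_add, e3] at h
    omega
  have h2 : u = v := by
    rw [← width_val] at hm hk
    have a1 := rows_succ (nb := nb) u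
    have a2 := rows_succ (nb := nb) v
    rcases lt_trichotomy u v with hlt | heq | hgt
    · have := rows_mono (nb := nb) (Nat.succ_le_of_lt (Fin.lt_def.1 hlt))
      simp only [Nat.succ_eq_add_one] at this
      omega
    · exact heq
    · have := rows_mono (nb := nb) (Nat.succ_le_of_lt (Fin.lt_def.1 hgt))
      simp only [Nat.succ_eq_add_one] at this
      omega
  subst h2
  exact ⟨rfl, by omega, h1.2⟩

end Layout

/-! ## The table of optimal orders -/

section Table

variable {n : ℕ} (T : WeightedGraph (Fin n)) (nb : Fin n → List (Fin n))

/-- The state holds the tree: the weights, powers of two, degrees, lists of neighbors with the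
weights of the edges and the positions of the edges in the lists of the other endpoints, and the
layout of the table. -/
structure Static (s : State) : Prop where
  size : s.var 0 = n
  vw (u : Fin n) : s.arr 0 u = T.vw u
  off (u : Fin n) : s.arr 7 u = n * u
  -- Masks are stored multiplied by `n`. They can then serve as addresses of rows, although the
  -- machine cannot multiply.
  pow (j : ℕ) : j < n → s.arr 8 j = n * 2 ^ j
  deg (u : Fin n) : s.arr 9 u = (nb u).length
  adj (u : Fin n) (j : ℕ) (h : j < (nb u).length) : s.arr 10 (n * u + j) = (nb u)[j] ∧
    s.arr 11 (n * u + j) = T.ew s(u, (nb u)[j]) ∧ s.arr 12 (n * u + j) = (nb (nb u)[j]).idxOf u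
  base (u : Fin n) : s.arr 13 u = n * rows nb u

/-- The state holds the rows of the table. -/
def Table (tab : Fin n → ℕ → List (Stp (Fin n))) (s : State) : Prop :=
  ∀ u m, m < 2 ^ (nb u).length → s.arr 14 (row nb u m) = (tab u m).length ∧
    (tab u m).length < n ∧ Enc (s.arr 15) (s.arr 16) (s.arr 17) (s.arr 18) (row nb u m) (tab u m)

/-- Replace a row. -/
def setRow (tab : Fin n → ℕ → List (Stp (Fin n))) (u : Fin n) (m : ℕ) (l : List (Stp (Fin n))) :
    Fin n → ℕ → List (Stp (Fin n)) :=
  fun u' m' => if u' = u ∧ m' = m then l else tab u' m'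

variable {T nb}

theorem Static.frame {s s' : State} {p : Program} (h : Static T nb s) (hf : p.Frame s s')
    (h0 : 0 ∉ p.wv := by decide) (ha : ∀ a ∈ [0, 7, 8, 9, 10, 11, 12, 13], a ∉ p.wa := by decide) :
    Static T nb s' := by
  constructor
  · rw [hf.1 0 h0]; exact h.size
  · rw [hf.2 0 (ha 0 (by decide))]; exact h.vw
  · rw [hf.2 7 (ha 7 (by decide))]; exact h.off
  · rw [hf.2 8 (ha 8 (by decide))]; exact h.pow
  · rw [hf.2 9 (ha 9 (by decide))]; exact h.deg
  · rw [hf.2 10 (ha 10 (by decide)), hf.2 11 (ha 11 (by decide)), hf.2 12 (ha 12 (by decide))]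
    exact h.adj
  · rw [hf.2 13 (ha 13 (by decide))]; exact h.base

theorem Table.frame {tab : Fin n → ℕ → List (Stp (Fin n))} {s s' : State} {p : Program}
    (h : Table nb tab s) (hf : p.Frame s s')
    (ha : ∀ a ∈ [14, 15, 16, 17, 18], a ∉ p.wa := by decide) : Table nb tab s' := by
  intro u m hm
  rw [hf.2 14 (ha 14 (by decide)), hf.2 15 (ha 15 (by decide)), hf.2 16 (ha 16 (by decide)),
    hf.2 17 (ha 17 (by decide)), hf.2 18 (ha 18 (by decide))]
  exact h u m hm

/-! ### The candidate order for one choice of the first neighbour. -/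

/-- Copy a step of the temporary row. -/
def copyStep : Program :=
  .put 15 (V 11 + V 28) (A 19 (V 28)) ;; .put 16 (V 11 + V 28) (A 20 (V 28)) ;;
  .ite ((A 21 (V 28) + 1) - V 21)
    (.put 17 (V 11 + V 28) (V 21) ;; .put 18 (V 11 + V 28) (V 23))
    (.put 17 (V 11 + V 28) (A 21 (V 28)) ;; .put 18 (V 11 + V 28) (A 22 (V 28))) ;;
  28 ≔ V 28 + 1

/-- Copy the temporary row to the table. -/
def copyLoop : Program := 28 ≔ 0 ;; .loop (V 24 - V 28) copyStep

theorem copyLoop_spec {s : State} {l : List (Stp (Fin n))} {o : ℕ}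
    (hl : Enc (s.arr 19) (s.arr 20) (s.arr 21) (s.arr 22) 0 l) (ht : s.var 24 = l.length)
    (ho : s.var 11 = o) :
    copyLoop.Halts s ((l.length + 1) * 70) fun s' =>
      Enc (s'.arr 15) (s'.arr 16) (s'.arr 17) (s'.arr 18) o
        (l.map (raise (s.var 21) (s.var 23))) ∧
      ∀ i, i < o ∨ o + l.length ≤ i → s'.arr 15 i = s.arr 15 i ∧ s'.arr 16 i = s.arr 16 i ∧
        s'.arr 17 i = s.arr 17 i ∧ s'.arr 18 i = s.arr 18 i := by
  set c := s.var 21 with hc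
  set q := s.var 23 with hq
  refine ((Program.halts_straight (Q := fun s' => s'.arr = s.arr ∧ s'.var 28 = 0) rfl
    (by simp [Program.exec])).seq (T' := (l.length + 1) * 66) (Q' := _) ?_).imp (T := 2 + _)
    (by rw [show (l.length + 1) * 70 = (l.length + 1) * 66 + (l.length + 1) * 4 by ring]; omega)
    fun s' _ h => h
  rintro s1 hf1 ⟨ha, h28⟩
  have e11 : s1.var 11 = o := by rw [hf1.1 11 (by decide), ho]
  have e21 : s1.var 21 = c := hf1.1 21 (by decide)
  have e23 : s1.var 23 = q := hf1.1 23 (by decide)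
  have e24 : s1.var 24 = l.length := by rw [hf1.1 24 (by decide), ht]
  refine (Program.halts_loop (T := copyStep.cost)
    (Inv := fun i s' => s'.var 28 = i ∧
      Enc (s'.arr 15) (s'.arr 16) (s'.arr 17) (s'.arr 18) o ((l.take i).map (raise c q)) ∧
      ∀ i, i < o ∨ o + l.length ≤ i → s'.arr 15 i = s.arr 15 i ∧ s'.arr 16 i = s.arr 16 i ∧
        s'.arr 17 i = s.arr 17 i ∧ s'.arr 18 i = s.arr 18 i)
    l.length ?_ ?_ ?_).imp (Nat.mul_le_mul_left _ (by decide)) ?_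
  · exact ⟨h28, Enc.nil, fun i _ => by simp [ha]⟩
  · rintro i hi s2 hf2 ⟨h1, h2, h3⟩
    have f11 : s2.var 11 = o := by rw [hf2.1 11 (by decide), e11]
    have f21 : s2.var 21 = c := by rw [hf2.1 21 (by decide), e21]
    have f23 : s2.var 23 = q := by rw [hf2.1 23 (by decide), e23]
    have f24 : s2.var 24 = l.length := by rw [hf2.1 24 (by decide), e24]
    obtain ⟨g1, g2, g3, g4⟩ := hl i hi
    rw [zero_add] at g1 g2 g3 g4
    have k19 : s2.arr 19 = s.arr 19 := by rw [hf2.2 19 (by decide), ha]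
    have k20 : s2.arr 20 = s.arr 20 := by rw [hf2.2 20 (by decide), ha]
    have k21 : s2.arr 21 = s.arr 21 := by rw [hf2.2 21 (by decide), ha]
    have k22 : s2.arr 22 = s.arr 22 := by rw [hf2.2 22 (by decide), ha]
    refine ⟨by simp [h1, f24]; omega, Program.halts_straight rfl ?_⟩
    have hlen : ((l.take i).map (raise c q)).length = i := by simp; omega
    rw [List.take_succ_eq_append_getElem hi, List.map_append, List.map_singleton]
    have hif : c ≤ l[i].sf ↔ ¬ (l[i].sf + 1 - c = 0) := by omega
    refine ⟨?_, h2.snoc (a := raise c q l[i]) ?_ ?_, ?_⟩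
    · by_cases hcc : l[i].sf + 1 - c = 0 <;>
        simp [copyStep, Program.exec, h1, f11, f21, f23, k21, g3, hcc]
    · rw [hlen]
      intro x hx
      by_cases hcc : l[i].sf + 1 - c = 0 <;>
        simp [copyStep, Program.exec, h1, f11, f21, f23, k19, k20, k21, k22, g3, hcc, hx.ne]
    · rw [hlen]
      by_cases hcc : l[i].sf + 1 - c = 0 <;>
        simp [copyStep, Program.exec, h1, f11, f21, f23, k19, k20, k21, k22, g1, g2, g3, g4, raise,
          hif, hcc]
    · intro x hx
      have hne : x ≠ o + i := by omega
      rw [← (h3 x hx).1, ← (h3 x hx).2.1, ← (h3 x hx).2.2.1, ← (h3 x hx).2.2.2]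
      by_cases hcc : l[i].sf + 1 - c = 0 <;>
        simp [copyStep, Program.exec, h1, f11, f21, f23, k19, k20, k21, k22, g3, hcc, hne]
  · rintro s2 hf2 ⟨h1, h2, h3⟩
    have f24 : s2.var 24 = l.length := by rw [hf2.1 24 (by decide), e24]
    simp [h1, f24]
  · rintro s2 hf2 ⟨h1, h2, h3⟩
    rw [List.take_length] at h2
    exact ⟨h2, h3⟩

/-- Prepare the merge for the vertex `u` and its neighbor with the position `j`. -/
def candInit : Program :=
  16 ≔ A 7 (V 9) + V 14 ;;
  15 ≔ A 10 (V 16) ;;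
  -- The offset is `n` times the mask of all neighbours of `v` other than `u`: the full mask is
  -- 2^deg(v) - 1, and array 12 knows the bit of `u`.
  17 ≔ A 13 (V 15) + ((A 8 (A 9 (V 15)) - V 0) - A 8 (A 12 (V 16))) ;;
  18 ≔ V 17 + A 14 (V 17) ;;
  19 ≔ A 13 (V 9) + (V 10 - A 8 (V 14)) ;;
  20 ≔ V 19 + A 14 (V 19) ;;
  21 ≔ A 0 (V 9) ;;
  .ite (A 9 (V 15) - 1) (22 ≔ A 0 (V 15)) (22 ≔ 0) ;;
  .ite (V 10 - A 8 (V 14)) (23 ≔ V 21) (23 ≔ 0) ;;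
  23 ≔ V 23 + V 22 + (A 11 (V 16) - V 22) ;;
  .put 19 0 (V 9) ;; .put 20 0 (V 15) ;; .put 21 0 (V 21) ;; 24 ≔ 1

/-- Consider the orders for `u` that enter the neighbor with the position `j` first. -/
def cand : Program :=
  candInit ;; mergeLoop ;;
  -- Variable 12 is the best peak so far plus one, with 0 for none; the condition holds for the
  -- first candidate and for strictly better ones.
  .ite ((1 - V 12) + (V 12 - (V 23 + 1))) (12 ≔ V 23 + 1 ;; .put 14 (V 11) (V 24) ;; copyLoop)
    .skip

theorem candInit_spec {s : State} (hN : Neighbors T nb) (hS : Static T nb s) {u v : Fin n}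
    {m j : ℕ} (hm : m < 2 ^ (nb u).length) (hlt : (nb v).length < n)
    (h9 : s.var 9 = u) (h10 : s.var 10 = n * m) (h14 : s.var 14 = j) (hjn : j < n)
    (hj : j < (nb u).length) (hmj : m.testBit j = true) (hv : (nb u)[j] = v) :
    candInit.Halts s 100 fun s' =>
      s'.var 17 = row nb v (2 ^ (nb v).length - 1 - 2 ^ (nb v).idxOf u) ∧
      s'.var 18 = s'.var 17 + s.arr 14 (s'.var 17) ∧
      s'.var 19 = row nb u (m - 2 ^ j) ∧
      s'.var 20 = s'.var 19 + s.arr 14 (s'.var 19) ∧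
      s'.var 21 = T.vw u ∧ s'.var 23 = T.enterPeak u v (sel T nb u m) ∧ s'.var 24 = 1 ∧
      s'.arr 19 0 = u ∧ s'.arr 20 0 = v ∧ s'.arr 21 0 = T.vw u := by
  refine (Program.halts_straight rfl ?_).imp (T := candInit.cost) (by decide) fun _ _ h => h
  obtain ⟨a1, a2, a3⟩ := hS.adj u j hj
  rw [hv] at a1 a2 a3
  have huv : u ∈ nb v := by
    rw [hN.mem, T.graph.adj_comm, ← hN.mem, ← hv]
    exact List.getElem_mem hj
  have hr := List.idxOf_lt_length_of_mem huv
  have e1 : n * rows nb v + (n * 2 ^ (nb v).length - n - n * 2 ^ (nb v).idxOf u) =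
      row nb v (2 ^ (nb v).length - 1 - 2 ^ (nb v).idxOf u) := by
    rw [row, Nat.mul_sub, Nat.mul_sub, mul_one]
  have e2 : n * rows nb u + (n * m - n * 2 ^ j) = row nb u (m - 2 ^ j) := by
    rw [row, Nat.mul_sub]
  have hmem : v ∈ sel T nb u m := (mem_sel hN).2 ⟨j, hj, hv, hmj⟩
  have hidx : (nb u).idxOf v = j := by rw [← hv, (hN.nodup u).idxOf_getElem]
  have e3 : (((sel T nb u m).erase v).card = 0) ↔ n * m - n * 2 ^ j = 0 := by
    rw [Finset.card_eq_zero, ← sel_sub hN hmem,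
      sel_eq_empty hN (lt_of_le_of_lt (Nat.sub_le _ _) hm), hidx, ← Nat.mul_sub]
    simp [show n ≠ 0 by omega]
  have e4 : T.entry v = if (nb v).length - 1 = 0 then 0 else T.vw v := by
    rw [entry, ncard_neighborSet hN]
    simp only [Nat.sub_eq_zero_iff_le]
  rw [enterPeak, e4]
  simp only [e3]
  by_cases c1 : (nb v).length - 1 = 0 <;> by_cases c2 : n * m - n * 2 ^ j = 0 <;>
    simp [candInit, Program.exec, h9, h10, h14, hS.off, hS.base, a1, a2, a3, hS.deg,
      hS.pow _ hlt, hS.pow _ (hr.trans hlt), hS.pow _ hjn, hS.size, hS.vw, e1, e2, c1, c2]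
  all_goals rw [← e2, c2, add_zero]

theorem cand_spec {s : State} (hN : Neighbors T nb) (hS : Static T nb s)
    {tab : Fin n → ℕ → List (Stp (Fin n))} (hTab : Table nb tab s) {u v : Fin n}
    {m j : ℕ} (hm : m < 2 ^ (nb u).length) (hlt : ∀ w, (nb w).length < n)
    (h9 : s.var 9 = u) (h10 : s.var 10 = n * m) (h11 : s.var 11 = row nb u m) (h14 : s.var 14 = j)
    (hj : j < (nb u).length) (hmj : m.testBit j = true) (hv : (nb u)[j] = v)
    {P Q : List (Stp (Fin n))}
    (hP : P = tab v (2 ^ (nb v).length - 1 - 2 ^ (nb v).idxOf u)) (hQ : Q = tab u (m - 2 ^ j))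
    (hlen : P.length + Q.length + 1 < n) {e pk : ℕ} (he : e = T.enterPeak u v (sel T nb u m))
    (hpk : pk = peakFrom (T.vw u) e (mergeSteps P Q)) :
    cand.Halts s (n * 400) fun s' =>
      (s.var 12 ≠ 0 ∧ s.var 12 ≤ pk + 1 ∧ s'.var 12 = s.var 12 ∧ Table nb tab s') ∨
      ((s.var 12 = 0 ∨ pk + 1 < s.var 12) ∧ s'.var 12 = pk + 1 ∧
        Table nb (setRow tab u m (candidate u v (T.vw u) e (mergeSteps P Q))) s') := by
  have huv : u ∈ nb v := by
    rw [hN.mem, T.graph.adj_comm, ← hN.mem, ← hv]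
    exact List.getElem_mem hj
  have hr := List.idxOf_lt_length_of_mem huv
  have hm1 : 2 ^ (nb v).length - 1 - 2 ^ (nb v).idxOf u < 2 ^ (nb v).length :=
    lt_of_le_of_lt (Nat.sub_le _ _) (Nat.sub_lt (by positivity) one_pos)
  have hm2 : m - 2 ^ j < 2 ^ (nb u).length := lt_of_le_of_lt (Nat.sub_le _ _) hm
  obtain ⟨p1, p2, p3⟩ := hTab v _ hm1
  obtain ⟨q1, q2, q3⟩ := hTab u _ hm2
  rw [← hP] at p1 p2 p3
  rw [← hQ] at q1 q2 q3
  refine ((candInit_spec hN hS hm (hlt v) h9 h10 h14 (hj.trans (hlt u)) hj hmj hv).seq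
    (T' := (P.length + Q.length + 1) * 120 + (40 + (P.length + Q.length + 2) * 70)) (Q' := _)
    ?_).imp (by omega) fun s' _ h => h
  rintro s1 hf1 ⟨b17, b18, b19, b20, b21, b23, b24, t1, t2, t3⟩
  have hA14 : s1.arr 14 = s.arr 14 := hf1.2 14 (by decide)
  have hA15 : s1.arr 15 = s.arr 15 := hf1.2 15 (by decide)
  have hA16 : s1.arr 16 = s.arr 16 := hf1.2 16 (by decide)
  have hA17 : s1.arr 17 = s.arr 17 := hf1.2 17 (by decide)
  have hA18 : s1.arr 18 = s.arr 18 := hf1.2 18 (by decide)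
  rw [b17, p1] at b18
  rw [b19, q1] at b20
  refine (mergeLoop_spec (P := P) (Q := Q) (by rwa [hA15, hA16, hA17, hA18, b17])
    (by rwa [hA15, hA16, hA17, hA18, b19]) (by rw [b18, b17]) (by rw [b20, b19]) b24 b21
    b23).seq ?_
  rintro s2 hf2 ⟨c1, c2, c3, c4, c5, c6, -⟩
  rw [← he, ← hpk] at c3
  have d11 : s2.var 11 = row nb u m := by rw [hf2.1 11 (by decide), hf1.1 11 (by decide), h11]
  have d12 : s2.var 12 = s.var 12 := by rw [hf2.1 12 (by decide), hf1.1 12 (by decide)]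
  have d21 : s2.var 21 = T.vw u := by rw [hf2.1 21 (by decide), b21]
  have hTab2 : Table nb tab s2 := (hTab.frame hf1).frame hf2
  refine (Program.halts_ite (T := 27 + (P.length + Q.length + 2) * 70) ?_ ?_).imp
    (by
      have : ((1 - V 12) + (V 12 - (V 23 + 1)) : Expr).cost = 9 := rfl
      omega) fun s' _ h => h
  · intro hc
    simp only [Expr.eval_add', Expr.eval_sub', Expr.eval_one, Expr.eval_var, d12, c3] at hc
    refine ((Program.halts_straight (p := 12 ≔ V 23 + 1)
      (Q := fun s' => s'.arr = s2.arr ∧ s'.var 12 = pk + 1) rfl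
      (by simp [Program.exec, c3])).seq (T' := 10 + (P.length + Q.length + 2) * 70)
      (Q' := _) ?_).imp (T := 4 + _) (by omega) fun s' _ h => h
    rintro s3 hf3 ⟨ha3, hb3⟩
    have e11 : s3.var 11 = row nb u m := by rw [hf3.1 11 (by decide), d11]
    have e24 : s3.var 24 = 1 + (P.length + Q.length) := by rw [hf3.1 24 (by decide), c2]
    refine ((Program.halts_straight (p := .put 14 (V 11) (V 24))
      (Q := fun s' => s'.arr 14 = Function.update (s2.arr 14) (row nb u m)
        (1 + (P.length + Q.length))) rfl
      (by simp [Program.exec, ha3, e11, e24])).seq (T' := (P.length + Q.length + 2) * 70)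
      (Q' := _) ?_).imp (T := 3 + _) (by omega) fun s' _ h => h
    intro s4 hf4 h4
    have g11 : s4.var 11 = row nb u m := by rw [hf4.1 11 (by decide), e11]
    have g12 : s4.var 12 = pk + 1 := by rw [hf4.1 12 (by decide), hb3]
    have g21 : s4.var 21 = T.vw u := by rw [hf4.1 21 (by decide), hf3.1 21 (by decide), d21]
    have g23 : s4.var 23 = pk := by rw [hf4.1 23 (by decide), hf3.1 23 (by decide), c3]
    have g24 : s4.var 24 = 1 + (P.length + Q.length) := by rw [hf4.1 24 (by decide), e24]
    have ga : ∀ a, a ≠ 14 → s4.arr a = s2.arr a := fun a ha => by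
      rw [hf4.2 a (by simpa [Program.wa] using ha), ha3]
    -- Cell 0 of array 22 has an arbitrary value. As the `sf` of this step equals w(u), copying
    -- applies `raise` and puts the peak there.
    have hE : Enc (s4.arr 19) (s4.arr 20) (s4.arr 21) (s4.arr 22) 0
        (⟨u, v, T.vw u, s4.arr 22 0⟩ :: mergeSteps P Q) := by
      rw [ga 19 (by decide), ga 20 (by decide), ga 21 (by decide), ga 22 (by decide)]
      intro i hi
      cases i with
      | zero => simp [c4, c5, c6, t1, t2, t3]
      | succ i =>
        have := c1 i (by simpa using hi)
        simpa [add_comm] using this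
    refine (copyLoop_spec hE (by rw [List.length_cons, length_mergeSteps, g24, add_comm])
      g11).imp (by rw [List.length_cons, length_mergeSteps]) ?_
    rintro s5 hf5 ⟨k1, k2⟩
    rw [g21, g23] at k1
    have hcand : List.map (raise (T.vw u) pk) (⟨u, v, T.vw u, s4.arr 22 0⟩ :: mergeSteps P Q) =
        candidate u v (T.vw u) e (mergeSteps P Q) := by
      simp [candidate, raise, hpk]
    rw [hcand] at k1
    have hcl : (candidate u v (T.vw u) e (mergeSteps P Q)).length = 1 + (P.length + Q.length) := by
      rw [length_candidate, length_mergeSteps, add_comm]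
    refine Or.inr ⟨by omega, by rw [hf5.1 12 (by decide), g12], fun u' m' hm' => ?_⟩
    have hs5 : s5.arr 14 = s4.arr 14 := hf5.2 14 (by decide)
    rw [hs5, h4]
    by_cases heq : u' = u ∧ m' = m
    · obtain ⟨rfl, rfl⟩ := heq
      simp only [setRow, and_self, if_true]
      rw [hcl]
      exact ⟨by simp, by omega, k1⟩
    · simp only [setRow, if_neg heq]
      obtain ⟨r1, r2, r3⟩ := hTab2 u' m' hm'
      have hn0 : 0 < n := by omega
      refine ⟨?_, r2, r3.congr fun i hi => ?_⟩
      · rw [Function.update_of_ne, r1]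
        intro h
        exact heq (by
          have := row_inj (i := 0) (j := 0) hm' hm hn0 hn0 h
          exact ⟨this.1, this.2.1⟩)
      · rw [← ga 15 (by decide), ← ga 16 (by decide), ← ga 17 (by decide), ← ga 18 (by decide)]
        refine k2 _ ?_
        rw [List.length_cons, length_mergeSteps]
        by_contra hcon
        obtain ⟨i', hi'⟩ : ∃ i', row nb u' m' + i = row nb u m + i' :=
          ⟨row nb u' m' + i - row nb u m, by omega⟩
        have := row_inj hm' hm (hi.trans r2) (show i' < n by omega) hi'
        exact heq ⟨this.1, this.2.1⟩
  · intro hc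
    simp only [Expr.eval_add', Expr.eval_sub', Expr.eval_one, Expr.eval_var, d12, c3] at hc
    refine (Program.halts_straight (Q := fun s' => s' = s2) rfl rfl).imp
      (by simp only [Program.cost]; omega) ?_
    rintro s3 - rfl
    exact Or.inl ⟨by omega, by omega, d12, hTab2⟩

end Table

theorem Program.Halts.straight_seq {p q : Program} {s : State} (c : ℕ) {T T' : ℕ}
    (Q : State → Prop) {Q' : State → Prop} (hp : p.straight = true) (h : Q (p.exec s))
    (hc : p.cost ≤ c) (hT : c + T ≤ T') (h' : ∀ s', p.Frame s s' → Q s' → q.Halts s' T Q') :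
    (p.seq q).Halts s T' Q' :=
  ((Program.halts_straight hp h).seq h').imp (by omega) fun _ _ h => h

/-! ### Computing one row. -/

/-- Compute a row of the table from the other rows. -/
def computeRow : Program :=
  11 ≔ A 13 (V 9) + V 10 ;; 12 ≔ 0 ;; 13 ≔ V 10 ;; 14 ≔ A 9 (V 9) ;;
  .loop (V 14) (14 ≔ V 14 - 1 ;;
    .ite ((V 13 + 1) - A 8 (V 14)) (13 ≔ V 13 - A 8 (V 14) ;; cand) .skip)

section Table

variable {n : ℕ} (T : WeightedGraph (Fin n)) (nb : Fin n → List (Fin n))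

/-- A row is not too long, and optimal if its domain has at most `k` vertices. -/
def RowOk (k : ℕ) (u : Fin n) (m : ℕ) (l : List (Stp (Fin n))) : Prop :=
  l.length + 1 ≤ (T.dom u (sel T nb u m)).card ∧
    ((T.dom u (sel T nb u m)).card ≤ k → T.Optimal u (sel T nb u m) l)

variable {T nb} {tab : Fin n → ℕ → List (Stp (Fin n))}

theorem setRow_self (u : Fin n) (m : ℕ) : setRow tab u m (tab u m) = tab := by
  funext u' m'
  simp only [setRow]
  split_ifs with h
  · rw [h.1, h.2]
  · rfl

theorem setRow_setRow (u : Fin n) (m : ℕ) (l l' : List (Stp (Fin n))) :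
    setRow (setRow tab u m l) u m l' = setRow tab u m l' := by
  funext u' m'
  simp only [setRow]
  split_ifs <;> rfl

theorem setRow_of_ne {u u' : Fin n} {m m' : ℕ} {l : List (Stp (Fin n))} (h : u' ≠ u ∨ m' ≠ m) :
    setRow tab u m l u' m' = tab u' m' := by
  simp only [setRow]
  rw [if_neg]
  tauto

/-- The domains of the two rows to be merged partition the domain in question, so both are smaller.
This provides optimality up to size `k + 1`, and room for the merged order with its additional first
step. -/
theorem RowOk.of_mem (hT : T.graph.IsTree) (hN : Neighbors T nb) {k : ℕ}
    (hOk : ∀ u m, m < 2 ^ (nb u).length → RowOk T nb k u m (tab u m)) {u w : Fin n} {m : ℕ}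
    (hm : m < 2 ^ (nb u).length) (hw : w ∈ sel T nb u m) :
    (tab w (2 ^ (nb w).length - 1 - 2 ^ (nb w).idxOf u)).length +
        (tab u (m - 2 ^ (nb u).idxOf w)).length + 2 ≤ (T.dom u (sel T nb u m)).card ∧
      ((T.dom u (sel T nb u m)).card ≤ k + 1 →
        T.Optimal w ((T.nbrs w).erase u) (tab w (2 ^ (nb w).length - 1 - 2 ^ (nb w).idxOf u)) ∧
        T.Optimal u ((sel T nb u m).erase w) (tab u (m - 2 ^ (nb u).idxOf w))) := by
  have hadj := mem_nbrs.1 (sel_subset u m hw)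
  have hu : u ∈ sel T nb w (2 ^ (nb w).length - 1) := by
    rw [sel_full hN, mem_nbrs]
    exact hadj.symm
  have h1 := hOk w (2 ^ (nb w).length - 1 - 2 ^ (nb w).idxOf u)
    (lt_of_le_of_lt (Nat.sub_le _ _) (Nat.sub_lt (by positivity) one_pos))
  have h2 := hOk u (m - 2 ^ (nb u).idxOf w) (lt_of_le_of_lt (Nat.sub_le _ _) hm)
  rw [RowOk, sel_sub hN hu, sel_full hN] at h1
  rw [RowOk, sel_sub hN hw] at h2
  have h3 := card_dom hT (sel_subset u m) hw
  have h4 := card_dom_pos (G := T) w ((T.nbrs w).erase u)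
  have h5 := card_dom_pos (G := T) u ((sel T nb u m).erase w)
  exact ⟨by omega, fun h => ⟨h1.2 (by omega), h2.2 (by omega)⟩⟩

theorem computeRow_spec {s : State} (hT : T.graph.IsTree) (hN : Neighbors T nb)
    (hS : Static T nb s) (hTab : Table nb tab s) (hlt : ∀ w, (nb w).length < n) {k : ℕ}
    (hOk : ∀ u m, m < 2 ^ (nb u).length → RowOk T nb k u m (tab u m))
    {u : Fin n} {m : ℕ} (hm : m < 2 ^ (nb u).length) (h9 : s.var 9 = u) (h10 : s.var 10 = n * m) :
    computeRow.Halts s (((nb u).length + 1) * (n * 500)) fun s' =>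
      ∃ l, RowOk T nb (k + 1) u m l ∧ Table nb (setRow tab u m l) s' := by
  have hn : 0 < n := (Nat.zero_le _).trans_lt (hlt u)
  set P : Fin n → List (Stp (Fin n)) :=
    fun w => tab w (2 ^ (nb w).length - 1 - 2 ^ (nb w).idxOf u) with hP
  set Q : Fin n → List (Stp (Fin n)) := fun w => tab u (m - 2 ^ (nb u).idxOf w) with hQ
  set pk : Fin n → ℕ := fun w =>
    peakFrom (T.vw u) (T.enterPeak u w (sel T nb u m)) (mergeSteps (P w) (Q w)) with hpk
  set cd : Fin n → List (Stp (Fin n)) := fun w =>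
    candidate u w (T.vw u) (T.enterPeak u w (sel T nb u m)) (mergeSteps (P w) (Q w)) with hcd
  set d := (nb u).length with hd
  have hdn : (T.dom u (sel T nb u m)).card ≤ n := (Finset.card_le_univ _).trans (by simp)
  refine Program.Halts.straight_seq 6 (T := 9 + (d + 1) * (n * 400 + 40))
        (fun s' => s'.arr = s.arr ∧ s'.var 11 = row nb u m)
        rfl (by simp [Program.exec, h9, h10, hS.base, row]) (by decide) (by nlinarith) ?_
  rintro s1 hf1 ⟨ha1, h11⟩
  refine Program.Halts.straight_seq 2 (T := 7 + (d + 1) * (n * 400 + 40))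
        (fun s' => s'.arr = s.arr ∧ s'.var 12 = 0)
        rfl (by simp [Program.exec, ha1]) (by decide) (by omega) ?_
  rintro s2 hf2 ⟨ha2, h12⟩
  refine Program.Halts.straight_seq 2 (T := 5 + (d + 1) * (n * 400 + 40))
        (fun s' => s'.arr = s.arr ∧ s'.var 13 = n * (m % 2 ^ d))
        rfl (by simp [Program.exec, ha2, hf2.1 10 (by decide), hf1.1 10 (by decide), h10,
      Nat.mod_eq_of_lt hm]) (by decide) (by omega) ?_
  rintro s3 hf3 ⟨ha3, h13⟩
  refine Program.Halts.straight_seq 3 (T := 2 + (d + 1) * (n * 400 + 40))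
        (fun s' => s'.arr = s.arr ∧ s'.var 14 = d)
        rfl (by simp [Program.exec, ha3, hf3.1 9 (by decide), hf2.1 9 (by decide),
          hf1.1 9 (by decide), h9, hS.deg, hd]) (by decide) (by omega) ?_
  rintro s4 hf4 ⟨ha4, h14⟩
  have hS4 : Static T nb s4 := (((hS.frame hf1).frame hf2).frame hf3).frame hf4
  have hTab4 : Table nb tab s4 := (((hTab.frame hf1).frame hf2).frame hf3).frame hf4
  have b9 : s4.var 9 = u := by
    rw [hf4.1 9 (by decide), hf3.1 9 (by decide), hf2.1 9 (by decide), hf1.1 9 (by decide), h9]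
  have b10 : s4.var 10 = n * m := by
    rw [hf4.1 10 (by decide), hf3.1 10 (by decide), hf2.1 10 (by decide), hf1.1 10 (by decide), h10]
  have b11 : s4.var 11 = row nb u m := by
    rw [hf4.1 11 (by decide), hf3.1 11 (by decide), hf2.1 11 (by decide), h11]
  have b12 : s4.var 12 = 0 := by rw [hf4.1 12 (by decide), hf3.1 12 (by decide), h12]
  have b13 : s4.var 13 = n * (m % 2 ^ d) := by rw [hf4.1 13 (by decide), h13]
  -- The bits are inspected from the top. Either none was set so far and the row is untouched, or
  -- the row holds the candidate of least peak among the neighbours inspected.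
  refine (Program.halts_loop (T := n * 400 + 30)
    (Inv := fun i s' => s'.var 14 = d - i ∧ s'.var 13 = n * (m % 2 ^ (d - i)) ∧
      ∃ l, Table nb (setRow tab u m l) s' ∧
        ((s'.var 12 = 0 ∧ l = tab u m ∧ ∀ j < d, d - i ≤ j → ¬ m.testBit j = true) ∨
        ∃ v ∈ sel T nb u m, s'.var 12 = pk v + 1 ∧ l = cd v ∧
          ∀ j (hj : j < d), d - i ≤ j → m.testBit j = true → pk v ≤ pk (nb u)[j]))
    d ?_ ?_ ?_).imp (by
      have : (V 14).cost = 1 := rfl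
      rw [this]
      exact (Nat.mul_le_mul_left (d + 1) (show n * 400 + 30 + 1 + 1 ≤ n * 400 + 40 by omega)).trans
        (Nat.le_add_left _ _)) ?_
  · exact ⟨h14, b13, _, by rwa [setRow_self], Or.inl ⟨b12, rfl, fun j h1 h2 => by omega⟩⟩
  · rintro i hi s5 hf5 ⟨h1, h2, l, h3, h4⟩
    refine ⟨by simp [h1]; omega, ?_⟩
    have hS5 := hS4.frame hf5
    have c9 : s5.var 9 = u := by rw [hf5.1 9 (by decide), b9]
    have c10 : s5.var 10 = n * m := by rw [hf5.1 10 (by decide), b10]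
    have c11 : s5.var 11 = row nb u m := by rw [hf5.1 11 (by decide), b11]
    obtain ⟨j, hj⟩ : ∃ j, j = d - (i + 1) := ⟨_, rfl⟩
    have hji : d - i = j + 1 := by clear h4; omega
    have hjd : j < d := by clear h4; omega
    rw [hji] at h2
    refine Program.Halts.straight_seq 4 (T := n * 400 + 20)
        (fun s' => s'.arr = s5.arr ∧ s'.var 14 = j)
        rfl (by simp [Program.exec, h1, hji]) (by decide) (by omega) ?_
    rintro s6 hf6 ⟨ha6, h14'⟩
    have hpow : s6.arr 8 j = n * 2 ^ j := by rw [ha6]; exact hS5.pow j (hjd.trans (hlt u))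
    have d13 : s6.var 13 = n * (m % 2 ^ (j + 1)) := by rw [hf6.1 13 (by decide), h2]
    have d12 : s6.var 12 = s5.var 12 := hf6.1 12 (by decide)
    have hmod := mod_two_pow_succ m j
    have hmlt : m % 2 ^ j < 2 ^ j := Nat.mod_lt _ (by positivity)
    have hcond : ((V 13 + 1) - A 8 (V 14) : Expr).eval s6 = 0 ↔ ¬ m.testBit j = true := by
      simp only [Expr.eval_sub', Expr.eval_add', Expr.eval_var, Expr.eval_cell, Expr.eval_one,
        d13, h14', hpow, hmod]
      rw [Nat.sub_eq_zero_iff_le]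
      split_ifs with hb
      · simp only [hb, not_true, iff_false, not_le]
        rw [mul_add]
        omega
      · simp only [hb]
        simpa [Nat.succ_le_iff] using Nat.mul_lt_mul_of_pos_left hmlt hn
    refine (Program.halts_ite (T := n * 400 + 10) ?_ ?_).imp
      (by
        have : ((V 13 + 1) - A 8 (V 14) : Expr).cost = 6 := rfl
        omega) fun s' _ h => h
    · intro hc
      have hb : m.testBit j = true := by
        by_contra hb
        exact hc (hcond.2 hb)
      rw [if_pos hb] at hmod
      refine Program.Halts.straight_seq 5 (T := n * 400)
        (fun s' => s'.arr = s6.arr ∧ s'.var 13 = n * (m % 2 ^ j))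
        rfl (by
          simp only [Program.exec, State.setVar_arr, State.setVar_var, if_true, Expr.eval_sub',
            Expr.eval_var, Expr.eval_cell, d13, h14', hpow, hmod, true_and]
          rw [mul_add]
          omega) (by decide) (by omega) ?_
      rintro s7 hf7 ⟨ha7, h13'⟩
      obtain ⟨v, hv⟩ : ∃ v, (nb u)[j] = v := ⟨_, rfl⟩
      have hmem : v ∈ sel T nb u m := (mem_sel hN).2 ⟨j, hjd, hv, hb⟩
      have hvu : v ≠ u := (mem_nbrs.1 (sel_subset u m hmem)).ne'
      have hidx : (nb u).idxOf v = j := by rw [← hv, (hN.nodup u).idxOf_getElem]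
      have h2j := two_pow_le_of_testBit hb
      have hpos : 0 < 2 ^ j := by positivity
      have hlen := (RowOk.of_mem hT hN hOk hm hmem).1
      have e12 : s7.var 12 = s5.var 12 := by rw [hf7.1 12 (by decide), d12]
      have hrl : (l.length + 1 ≤ n) := ((h3 u m hm).2.1.trans_eq' (by simp [setRow]))
      refine (cand_spec (P := P v) (Q := Q v) (pk := pk v) hN
        (((hS5.frame hf6)).frame hf7) ((h3.frame hf6).frame hf7) hm hlt
        (by rw [hf7.1 9 (by decide), hf6.1 9 (by decide), c9])
        (by rw [hf7.1 10 (by decide), hf6.1 10 (by decide), c10])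
        (by rw [hf7.1 11 (by decide), hf6.1 11 (by decide), c11])
        (by rw [hf7.1 14 (by decide), h14']) hjd hb hv
        -- The rows that are read differ from the row being written, so earlier candidates have not
        -- spoiled them.
        (by rw [setRow_of_ne (Or.inl hvu)])
        (by rw [setRow_of_ne (Or.inr (by omega)), ← hidx])
        (by simp only [hP, hQ]; omega) rfl rfl).imp le_rfl ?_
      rintro s8 hf8 hres
      rw [e12] at hres
      have f14 : s8.var 14 = d - (i + 1) := by
        rw [hf8.1 14 (by decide), hf7.1 14 (by decide), h14', hj]
      have f13 : s8.var 13 = n * (m % 2 ^ (d - (i + 1))) := by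
        rw [hf8.1 13 (by decide), h13', hj]
      refine ⟨f14, f13, ?_⟩
      rcases hres with ⟨r1, r2, r3, r4⟩ | ⟨r1, r2, r3⟩
      · refine ⟨l, r4, ?_⟩
        rcases h4 with ⟨q1, -, -⟩ | ⟨w, hw, q1, q2, q3⟩
        · exact absurd q1 r1
        · refine Or.inr ⟨w, hw, by omega, q2, fun j' hj' hle hb' => ?_⟩
          by_cases hjj : j' = j
          · subst hjj
            rw [hv]
            omega
          · exact q3 j' hj' (by omega) hb'
      · refine ⟨cd v, by rwa [setRow_setRow] at r3, Or.inr ⟨v, hmem, r2, rfl, ?_⟩⟩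
        intro j' hj' hle hb'
        by_cases hjj : j' = j
        · subst hjj
          rw [hv]
        · rcases h4 with ⟨-, -, q3⟩ | ⟨w, hw, q1, q2, q3⟩
          · exact absurd hb' (q3 j' hj' (by omega))
          · have := q3 j' hj' (by omega) hb'
            omega
    · intro hc
      have hb := hcond.1 hc
      rw [if_neg hb, add_zero] at hmod
      refine (Program.halts_straight (Q := fun s' => s' = s6) rfl rfl).imp
        (by simp only [Program.cost]; omega) ?_
      rintro s7 - rfl
      refine ⟨by rw [h14', hj], by rw [d13, hmod, hj], l, h3.frame hf6, ?_⟩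
      rw [d12]
      rcases h4 with ⟨q1, q2, q3⟩ | ⟨w, hw, q1, q2, q3⟩
      · refine Or.inl ⟨q1, q2, fun j' hj' hle => ?_⟩
        by_cases hjj : j' = j
        · rwa [hjj]
        · exact q3 j' hj' (by omega)
      · refine Or.inr ⟨w, hw, q1, q2, fun j' hj' hle hb' => ?_⟩
        by_cases hjj : j' = j
        · exact absurd (hjj ▸ hb') hb
        · exact q3 j' hj' (by omega) hb'
  · rintro s5 hf5 ⟨h1, -⟩
    simp [h1]
  · rintro s5 hf5 ⟨-, -, l, h3, h4⟩
    refine ⟨l, ?_, h3⟩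
    rcases h4 with ⟨-, rfl, h4⟩ | ⟨v, hv, -, rfl, h4⟩
    -- With no bit set the domain is `{u}`; the length bound forces the untouched row to be empty,
    -- which is optimal.
    · have hemp : sel T nb u m = ∅ := by
        ext v
        rw [mem_sel hN]
        simp only [Finset.notMem_empty, iff_false, not_exists, not_and]
        exact fun j hj _ => h4 j hj (by omega)
      have h1 := (hOk u m hm).1
      have h2 : (T.dom u (sel T nb u m)).card = 1 := by rw [hemp]; simp [dom]
      have h3 : tab u m = [] := List.length_eq_zero_iff.1 (by omega)
      refine ⟨h1, fun _ => ?_⟩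
      rw [h3, hemp]
      exact optimal_empty u
    · refine ⟨?_, fun hk => ?_⟩
      · have := (RowOk.of_mem hT hN hOk hm hv).1
        rw [length_candidate, length_mergeSteps]
        simp only [hP, hQ]
        omega
      · refine optimal_candidate hT (sel_subset u m) hv
          (fun w hw => ((RowOk.of_mem hT hN hOk hm hw).2 hk).1)
          (fun w hw => ((RowOk.of_mem hT hN hOk hm hw).2 hk).2) fun w hw => ?_
        obtain ⟨j, hj, rfl, hb⟩ := (mem_sel hN).1 hw
        exact h4 j hj (by omega) hb

end Table

/-! ### The rounds that fill the table. -/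

/-- Compute all rows for a vertex. -/
def computeRows : Program :=
  10 ≔ 0 ;; .loop (A 8 (A 9 (V 9)) - V 10) (computeRow ;; 10 ≔ V 10 + V 0)

/-- Compute all rows for all vertices. -/
def computeAll : Program := 9 ≔ 0 ;; .loop (V 0 - V 9) (computeRows ;; 9 ≔ V 9 + 1)

/-- Compute the table. -/
def computeTable : Program := 4 ≔ V 0 ;; .loop (V 4) (4 ≔ V 4 - 1 ;; computeAll)

section Table

variable {n : ℕ} (T : WeightedGraph (Fin n)) (nb : Fin n → List (Fin n))

/-- The state holds a table that is optimal for all domains with at most `k` vertices, and with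
one more vertex for the rows in `D`. -/
def Computed (k : ℕ) (D : Fin n → ℕ → Prop) (s : State) : Prop :=
  ∃ tab, Table nb tab s ∧ ∀ u m, m < 2 ^ (nb u).length →
    RowOk T nb k u m (tab u m) ∧ (D u m → RowOk T nb (k + 1) u m (tab u m))

variable {T nb}

/-- Rows already improved in the current round remain valid inputs, so the rows may be visited in
any order and overwritten in place. -/
theorem RowOk.mono {k : ℕ} {u : Fin n} {m : ℕ} {l : List (Stp (Fin n))}
    (h : RowOk T nb (k + 1) u m l) : RowOk T nb k u m l := ⟨h.1, fun h' => h.2 (by omega)⟩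

theorem Computed.imp {k : ℕ} {D D' : Fin n → ℕ → Prop} {s : State} (h : Computed T nb k D s)
    (hD : ∀ u m, m < 2 ^ (nb u).length → D' u m → D u m) : Computed T nb k D' s := by
  obtain ⟨tab, h1, h2⟩ := h
  exact ⟨tab, h1, fun u m hm => ⟨(h2 u m hm).1, fun h => (h2 u m hm).2 (hD u m hm h)⟩⟩

theorem Computed.frame {k : ℕ} {D : Fin n → ℕ → Prop} {s s' : State} {p : Program}
    (h : Computed T nb k D s) (hf : p.Frame s s')
    (ha : ∀ a ∈ [14, 15, 16, 17, 18], a ∉ p.wa := by decide) : Computed T nb k D s' := by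
  obtain ⟨tab, h1, h2⟩ := h
  exact ⟨tab, h1.frame hf ha, h2⟩

variable (hT : T.graph.IsTree) (hN : Neighbors T nb) (hlt : ∀ w, (nb w).length < n)
  {Δ : ℕ} (hΔ : ∀ w, (nb w).length ≤ Δ)
include hT hN hlt hΔ

/-- In the nested loops the constant grows from 500 for one row to 600, 620 and 640; the increments
absorb the tests and assignments of the loops. -/
theorem computeRows_spec {s : State} (hS : Static T nb s) {k : ℕ} {u : Fin n}
    (h9 : s.var 9 = u) (hC : Computed T nb k (fun u' _ => u' < u) s) :
    computeRows.Halts s ((2 ^ Δ + 1) * ((Δ + 1) * 600) * n)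
      (Computed T nb k fun u' _ => u' < u ∨ u' = u) := by
  have hn : 0 < n := (Nat.zero_le _).trans_lt (hlt u)
  refine Program.Halts.straight_seq 2 (T := (2 ^ Δ + 1) * ((Δ + 1) * (n * 500) + 12))
    (fun s' => s'.arr = s.arr ∧ s'.var 10 = 0)
    rfl (by simp [Program.exec]) (by decide) ?_ ?_
  · have h1 : 1 ≤ 2 ^ Δ := Nat.one_le_two_pow
    have h2 : (Δ + 1) * 600 * n = (Δ + 1) * (n * 500) + (Δ + 1) * n * 100 := by ring
    have h3 : 1 ≤ (Δ + 1) * n := Nat.mul_pos (by omega) hn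
    rw [mul_assoc, h2]
    nlinarith
  rintro s1 hf1 ⟨ha1, h10⟩
  have hS1 := hS.frame hf1
  have hC1 := hC.frame hf1
  have b9 : s1.var 9 = u := by rw [hf1.1 9 (by decide), h9]
  refine (Program.halts_loop (T := (Δ + 1) * (n * 500) + 4)
    (Inv := fun i s' => s'.var 10 = n * i ∧
      Computed T nb k (fun u' m' => u' < u ∨ u' = u ∧ m' < i) s')
    (2 ^ (nb u).length) ?_ ?_ ?_).imp ?_ ?_
  · exact ⟨by rw [h10, mul_zero], hC1.imp fun u' m' _ h => by simpa using h⟩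
  · rintro i hi s2 hf2 ⟨h1, tab, h2, h3⟩
    have hS2 := hS1.frame hf2
    have c9 : s2.var 9 = u := by rw [hf2.1 9 (by decide), b9]
    constructor
    · simp only [Expr.eval_sub', Expr.eval_cell, Expr.eval_var, c9, hS2.deg, hS2.pow _ (hlt u), h1]
      rw [← Nat.mul_sub]
      have : 0 < 2 ^ (nb u).length - i := by omega
      positivity
    refine ((computeRow_spec hT hN hS2 h2 hlt (fun u m hm => (h3 u m hm).1) hi c9 h1).seq (T' := 4)
      (Q' := _) ?_).imp (Nat.add_le_add_right (Nat.mul_le_mul_right _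
        (Nat.succ_le_succ (hΔ u))) 4) fun _ _ h => h
    rintro s3 hf3 ⟨l, hl, hTab⟩
    refine (Program.halts_straight (Q := fun s' => s'.var 10 = n * (i + 1)) rfl
      (by simp [Program.exec, hf3.1 10 (by decide), hf3.1 0 (by decide), h1, hS2.size,
        mul_add])).imp
      (by decide) ?_
    rintro s4 hf4 h4
    refine ⟨h4, setRow tab u i l, hTab.frame hf4, fun u' m' hm' => ?_⟩
    by_cases heq : u' = u ∧ m' = i
    · obtain ⟨rfl, rfl⟩ := heq
      simp only [setRow, and_self, if_true]
      exact ⟨hl.mono, fun _ => hl⟩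
    · rw [setRow_of_ne (by tauto)]
      refine ⟨(h3 u' m' hm').1, fun h => (h3 u' m' hm').2 ?_⟩
      rcases h with h | ⟨rfl, h⟩
      · exact Or.inl h
      · exact Or.inr ⟨rfl, by omega⟩
  · rintro s2 hf2 ⟨h1, -⟩
    have hS2 := hS1.frame hf2
    have c9 : s2.var 9 = u := by rw [hf2.1 9 (by decide), b9]
    simp [c9, hS2.deg, hS2.pow _ (hlt u), h1]
  · have : (A 8 (A 9 (V 9)) - V 10).cost = 5 := rfl
    rw [this]
    exact Nat.mul_le_mul (Nat.succ_le_succ (Nat.pow_le_pow_right (by norm_num) (hΔ u))) (by omega)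
  · rintro s2 hf2 ⟨h1, h2⟩
    refine h2.imp fun u' m' hm' h => ?_
    rcases h with h | rfl
    · exact Or.inl h
    · exact Or.inr ⟨rfl, hm'⟩

theorem computeAll_spec {s : State} (hn : 0 < n) (hS : Static T nb s) {k : ℕ}
    (hC : Computed T nb k (fun _ _ => False) s) :
    computeAll.Halts s ((2 ^ Δ + 1) * ((Δ + 1) * 620) * ((n + 1) * n))
      (Computed T nb (k + 1) fun _ _ => False) := by
  refine Program.Halts.straight_seq 2
    (T := (n + 1) * ((2 ^ Δ + 1) * ((Δ + 1) * 600) * n + 8))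
    (fun s' => s'.var 9 = 0) rfl (by simp [Program.exec]) (by decide) ?_ ?_
  · have h1 : 1 ≤ (2 ^ Δ + 1) * (Δ + 1) := Nat.mul_pos (Nat.succ_pos _) (Nat.succ_pos _)
    have h2 : 1 * ((n + 1) * n) ≤ (2 ^ Δ + 1) * (Δ + 1) * ((n + 1) * n) :=
      Nat.mul_le_mul_right _ h1
    have h3 : (2 ^ Δ + 1) * ((Δ + 1) * 620) * ((n + 1) * n) = (n + 1) * ((2 ^ Δ + 1) *
      ((Δ + 1) * 600) * n) + 20 * ((2 ^ Δ + 1) * (Δ + 1) * ((n + 1) * n)) := by ring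
    rw [h3, mul_add]
    nlinarith
  rintro s1 hf1 h9
  have hS1 := hS.frame hf1
  refine (Program.halts_loop (T := (2 ^ Δ + 1) * ((Δ + 1) * 600) * n + 4)
    (Inv := fun i s' => s'.var 9 = i ∧ Computed T nb k (fun u' _ => u' < i) s') n ?_ ?_ ?_).imp
    ?_ ?_
  · exact ⟨h9, (hC.frame hf1).imp fun u' m' _ h => by simp at h⟩
  · rintro i hi s2 hf2 ⟨h1, h2⟩
    have hS2 := hS1.frame hf2
    refine ⟨by simp [h1, hS2.size]; omega, ?_⟩
    refine ((computeRows_spec hT hN hlt hΔ hS2 (u := ⟨i, hi⟩) h1 h2).seq (T' := 4)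
      (Q' := _) ?_).imp le_rfl fun _ _ h => h
    rintro s3 hf3 h3
    refine (Program.halts_straight (Q := fun s' => s'.var 9 = i + 1) rfl
      (by simp [Program.exec, hf3.1 9 (by decide), h1])).imp (by decide) ?_
    rintro s4 hf4 h4
    refine ⟨h4, (h3.frame hf4).imp fun u' m' _ h => ?_⟩
    rw [Fin.lt_def, Fin.ext_iff]
    exact Nat.lt_succ_iff_lt_or_eq.1 h
  · rintro s2 hf2 ⟨h1, -⟩
    simp [h1, (hS1.frame hf2).size]
  · have : (V 0 - V 9).cost = 3 := rfl
    rw [this]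
  · rintro s2 hf2 ⟨h1, tab, h2, h3⟩
    exact ⟨tab, h2, fun u m hm => ⟨(h3 u m hm).2 u.2, False.elim⟩⟩

/-- The empty rows at the beginning are optimal for domains with one vertex, and each round raises
the admissible size by one. Thus `n` rounds suffice, and the domains need not be sorted by size. -/
theorem computeTable_spec {s : State} (hn : 0 < n) (hS : Static T nb s)
    (h14 : ∀ i, s.arr 14 i = 0) :
    computeTable.Halts s ((2 ^ Δ + 1) * ((Δ + 1) * 640) * ((n + 1) * ((n + 1) * n))) fun s' =>
      ∃ tab, Table nb tab s' ∧
        ∀ u m, m < 2 ^ (nb u).length → T.Optimal u (sel T nb u m) (tab u m) := by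
  refine Program.Halts.straight_seq 2
    (T := (n + 1) * ((2 ^ Δ + 1) * ((Δ + 1) * 620) * ((n + 1) * n) + 6))
    (fun s' => s'.var 4 = n) rfl (by simp [Program.exec, hS.size]) (by decide) ?_ ?_
  · have h1 : 1 ≤ (2 ^ Δ + 1) * (Δ + 1) * ((n + 1) * n) :=
      Nat.mul_pos (Nat.mul_pos (Nat.succ_pos _) (Nat.succ_pos _)) (Nat.mul_pos (Nat.succ_pos _) hn)
    have h2 : (n + 1) * 1 ≤ (n + 1) * ((2 ^ Δ + 1) * (Δ + 1) * ((n + 1) * n)) :=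
      Nat.mul_le_mul_left _ h1
    have h3 : (2 ^ Δ + 1) * ((Δ + 1) * 640) * ((n + 1) * ((n + 1) * n)) = (n + 1) * ((2 ^ Δ + 1) *
      ((Δ + 1) * 620) * ((n + 1) * n)) +
        20 * ((n + 1) * ((2 ^ Δ + 1) * (Δ + 1) * ((n + 1) * n))) := by ring
    rw [h3, mul_add]
    omega
  rintro s1 hf1 h4
  have hS1 := hS.frame hf1
  refine (Program.halts_loop (T := (2 ^ Δ + 1) * ((Δ + 1) * 620) * ((n + 1) * n) + 4)
    (Inv := fun i s' => s'.var 4 = n - i ∧ Computed T nb (i + 1) (fun _ _ => False) s') n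
    ?_ ?_ ?_).imp ?_ ?_
  · refine ⟨h4, fun _ _ => [], fun u m hm => ⟨?_, hn, Enc.nil⟩, fun u m hm =>
      ⟨⟨?_, fun hc => ?_⟩, False.elim⟩⟩
    · rw [hf1.2 14 (by decide), h14]
      rfl
    · exact card_dom_pos u _
    · rw [Finset.eq_empty_of_forall_notMem (s := sel T nb u m) fun w hw => ?_]
      · exact optimal_empty u
      · have h1 := card_dom hT (sel_subset u m) hw
        have h2 := card_dom_pos (G := T) w ((T.nbrs w).erase u)
        have h3 := card_dom_pos (G := T) u ((sel T nb u m).erase w)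
        omega
  · rintro i hi s2 hf2 ⟨h1, h2⟩
    refine ⟨by simp [h1]; omega, ?_⟩
    refine Program.Halts.straight_seq 4
      (T := (2 ^ Δ + 1) * ((Δ + 1) * 620) * ((n + 1) * n))
      (fun s' => s'.var 4 = n - (i + 1)) rfl (by simp [Program.exec, h1]; omega) (by decide)
      (by omega) ?_
    rintro s3 hf3 h3
    refine (computeAll_spec hT hN hlt hΔ hn ((hS1.frame hf2).frame hf3) (h2.frame hf3)).imp
      le_rfl ?_
    rintro s4 hf4 h4
    exact ⟨by rw [hf4.1 4 (by decide), h3], h4⟩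
  · rintro s2 hf2 ⟨h1, -⟩
    simp [h1]
  · have : (V 4).cost = 1 := rfl
    rw [this]
  · rintro s2 hf2 ⟨h1, tab, h2, h3⟩
    refine ⟨tab, h2, fun u m hm => (h3 u m hm).1.2 ?_⟩
    exact ((Finset.card_le_univ _).trans (by simp)).trans (Nat.le_succ n)

end Table

/-! ## Reading the tree -/

section Setup

variable {n : ℕ}

/-- The neighbors of `u` in the order of the list of the edges. -/
def nbOf (L : List (Fin n × Fin n)) (u : Fin n) : List (Fin n) :=
  L.filterMap fun p => if p.1 = u then some p.2 else if p.2 = u then some p.1 else none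

/-- Questions about the list of neighbours are thereby reduced to the list of edges. -/
theorem map_nbOf (L : List (Fin n × Fin n)) (u : Fin n) :
    (nbOf L u).map (fun v => s(u, v)) =
      (L.map fun p => s(p.1, p.2)).filter fun e => decide (u ∈ e) := by
  induction L with
  | nil => rfl
  | cons p L ih =>
    simp only [nbOf] at ih ⊢
    rw [List.filterMap_cons, List.map_cons, List.filter_cons, ← ih]
    by_cases h1 : p.1 = u
    · simp [h1]
    · by_cases h2 : p.2 = u
      · simp [h1, h2, Sym2.eq_swap]
      · simp [h1, h2, Ne.symm h1, Ne.symm h2]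

theorem mem_nbOf {L : List (Fin n × Fin n)} {u v : Fin n} :
    v ∈ nbOf L u ↔ s(u, v) ∈ L.map fun p => s(p.1, p.2) := by
  have h : v ∈ nbOf L u ↔ s(u, v) ∈ (nbOf L u).map fun v => s(u, v) := by
    rw [List.mem_map]
    exact ⟨fun h => ⟨v, h, rfl⟩, fun ⟨w, hw, h⟩ => by rwa [← Sym2.congr_right.1 h]⟩
  rw [h, map_nbOf, List.mem_filter]
  simp

theorem nodup_nbOf {L : List (Fin n × Fin n)} (h : (L.map fun p => s(p.1, p.2)).Nodup)
    (u : Fin n) : (nbOf L u).Nodup :=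
  List.Nodup.of_map (fun v => s(u, v)) (by rw [map_nbOf]; exact h.filter _)

theorem nbOf_append (L L' : List (Fin n × Fin n)) (u : Fin n) :
    nbOf (L ++ L') u = nbOf L u ++ nbOf L' u := List.filterMap_append

variable {T : WeightedGraph (Fin n)} {L : List (Fin n × Fin n)}

theorem neighbors_nbOf (hL : T.ListsEdges L) : Neighbors T (nbOf L) where
  nodup := nodup_nbOf hL.1
  mem := by
    intro u v
    rw [mem_nbOf, hL.2]
    rfl

/-- The input does not state the number of edges; the program relies on its being n - 1. -/
theorem length_edges (hT : T.graph.IsTree) (hL : T.ListsEdges L) : L.length + 1 = n := by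
  classical
  have h1 : (L.map fun p => s(p.1, p.2)).toFinset = T.graph.edgeFinset := by
    ext e
    rw [List.mem_toFinset, hL.2, SimpleGraph.mem_edgeFinset]
  have h2 := List.toFinset_card_of_nodup hL.1
  rw [h1, List.length_map] at h2
  have := hT.card_edgeFinset
  rw [h2] at this
  simpa using this

theorem Neighbors.length_lt {nb : Fin n → List (Fin n)} (hN : Neighbors T nb) (u : Fin n) :
    (nb u).length < n := by
  rw [length_nb hN]
  simpa using Finset.card_lt_univ_of_notMem (s := T.nbrs u) (x := u) (by simp [mem_nbrs])

/-! ### The programs that read the input. -/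

/-- Compute the offsets and the powers of two. -/
def setupPowers : Program :=
  4 ≔ 0 ;; 5 ≔ 0 ;; 6 ≔ V 0 ;;
  .loop (V 0 - V 4)
    (.put 7 (V 4) (V 5) ;; .put 8 (V 4) (V 6) ;; 5 ≔ V 5 + V 0 ;; 6 ≔ V 6 + V 6 ;; 4 ≔ V 4 + 1)

/-- Append the endpoints of an edge to the lists of each other's neighbors. -/
def addEdge : Program :=
  9 ≔ A 1 (V 4) ;; 15 ≔ A 2 (V 4) ;; 22 ≔ A 3 (V 4) ;;
  16 ≔ A 7 (V 9) + A 9 (V 9) ;; 17 ≔ A 7 (V 15) + A 9 (V 15) ;;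
  .put 10 (V 16) (V 15) ;; .put 11 (V 16) (V 22) ;; .put 12 (V 16) (A 9 (V 15)) ;;
  .put 10 (V 17) (V 9) ;; .put 11 (V 17) (V 22) ;; .put 12 (V 17) (A 9 (V 9)) ;;
  .put 9 (V 9) (A 9 (V 9) + 1) ;; .put 9 (V 15) (A 9 (V 15) + 1) ;; 4 ≔ V 4 + 1

/-- Compute the lists of neighbors. -/
def setupEdges : Program := 4 ≔ 0 ;; .loop ((V 0 - 1) - V 4) addEdge

/-- Compute the layout of the table. -/
def setupRows : Program :=
  4 ≔ 0 ;; 5 ≔ 0 ;;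
  .loop (V 0 - V 4) (.put 13 (V 4) (V 5) ;; 5 ≔ V 5 + A 8 (A 9 (V 4)) ;; 4 ≔ V 4 + 1)

theorem setupPowers_spec {s : State} (h0 : s.var 0 = n) :
    setupPowers.Halts s ((n + 1) * 40) fun s' =>
      (∀ i < n, s'.arr 7 i = n * i) ∧ ∀ i < n, s'.arr 8 i = n * 2 ^ i := by
  refine Program.Halts.straight_seq 2 (T := (n + 1) * 38)
    (fun s' => s'.var 4 = 0) rfl (by simp [Program.exec]) (by decide) (by omega) ?_
  rintro s1 hf1 h4
  refine Program.Halts.straight_seq 2 (T := (n + 1) * 36)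
    (fun s' => s'.var 5 = 0) rfl (by simp [Program.exec]) (by decide) (by omega) ?_
  rintro s2 hf2 h5
  refine Program.Halts.straight_seq 2 (T := (n + 1) * 34)
    (fun s' => s'.var 6 = n) rfl (by simp [Program.exec, hf2.1 0 (by decide), hf1.1 0 (by decide),
      h0]) (by decide) (by omega) ?_
  rintro s3 hf3 h6
  have b0 : s3.var 0 = n := by
    rw [hf3.1 0 (by decide), hf2.1 0 (by decide), hf1.1 0 (by decide), h0]
  refine (Program.halts_loop (T := 20)
    (Inv := fun i s' => s'.var 4 = i ∧ s'.var 5 = n * i ∧ s'.var 6 = n * 2 ^ i ∧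
      (∀ j < i, s'.arr 7 j = n * j) ∧ ∀ j < i, s'.arr 8 j = n * 2 ^ j) n ?_ ?_ ?_).imp
    (Nat.mul_le_mul_left _ (by decide)) ?_
  · exact ⟨by rw [hf3.1 4 (by decide), hf2.1 4 (by decide), h4], by
      rw [hf3.1 5 (by decide), h5, mul_zero], by rw [h6, pow_zero, mul_one], by simp, by simp⟩
  · rintro i hi s4 hf4 ⟨h1, h2, h3, h4, h5⟩
    have c0 : s4.var 0 = n := by rw [hf4.1 0 (by decide), b0]
    refine ⟨by simp [c0, h1]; omega, ?_⟩
    refine (Program.halts_straight rfl ?_).imp (T := Program.cost _) (by decide) fun _ _ h => h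
    refine ⟨by simp [Program.exec, h1], by simp [Program.exec, h2, c0, mul_add],
      by simp [Program.exec, h3, pow_succ, ← mul_two, mul_assoc], fun j hj => ?_, fun j hj => ?_⟩
    · rcases Nat.lt_succ_iff_lt_or_eq.1 hj with hj | rfl
      · simp [Program.exec, h1, hj.ne, h4 j hj]
      · simp [Program.exec, h1, h2]
    · rcases Nat.lt_succ_iff_lt_or_eq.1 hj with hj | rfl
      · simp [Program.exec, h1, hj.ne, h5 j hj]
      · simp [Program.exec, h1, h3]
  · rintro s4 hf4 ⟨h1, -⟩
    simp [hf4.1 0 (by decide), b0, h1]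
  · exact fun s4 _ h => ⟨h.2.2.2.1, h.2.2.2.2⟩

variable (T) in
/-- The state holds the lists of neighbors for the edges in `L`. -/
structure Lists (L : List (Fin n × Fin n)) (s : State) : Prop where
  deg (u : Fin n) : s.arr 9 u = (nbOf L u).length
  adj (u : Fin n) (j : ℕ) (h : j < (nbOf L u).length) : s.arr 10 (n * u + j) = (nbOf L u)[j] ∧
    s.arr 11 (n * u + j) = T.ew s(u, (nbOf L u)[j]) ∧
    s.arr 12 (n * u + j) = (nbOf L (nbOf L u)[j]).idxOf u

theorem index_inj {u v i j : ℕ} (hi : i < n) (hj : j < n) (h : n * u + i = n * v + j) :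
    u = v ∧ i = j := by
  have e1 : (n * u + i) / n = u := by
    rw [Nat.mul_add_div (by omega), Nat.div_eq_of_lt hi, add_zero]
  have e2 : (n * v + j) / n = v := by
    rw [Nat.mul_add_div (by omega), Nat.div_eq_of_lt hj, add_zero]
  have e3 : u = v := by rw [← e1, h, e2]
  subst e3
  omega

/-- When `ab` is added, the position of `a` in the list of `b` is the old length of that list, and
conversely. Later additions append at the end and do not change positions. -/
theorem addEdge_spec {s : State} {i : ℕ} {a b : Fin n} (h7 : ∀ i < n, s.arr 7 i = n * i)
    (h : Lists T L s) (hab : a ≠ b) (hmem : b ∉ nbOf L a) (hlt : ∀ u, (nbOf L u).length < n)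
    (h4 : s.var 4 = i) (h1 : s.arr 1 i = a) (h2 : s.arr 2 i = b) (h3 : s.arr 3 i = T.ew s(a, b)) :
    addEdge.Halts s 100 fun s' => s'.var 4 = i + 1 ∧ Lists T (L ++ [(a, b)]) s' := by
  refine (Program.halts_straight rfl ?_).imp (T := Program.cost _) (by decide) fun _ _ h => h
  have hba : (b : ℕ) ≠ a := fun h => hab (Fin.ext h.symm)
  have ha : nbOf (L ++ [(a, b)]) a = nbOf L a ++ [b] := by simp [nbOf]
  have hb : nbOf (L ++ [(a, b)]) b = nbOf L b ++ [a] := by simp [nbOf, hab]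
  have hu : ∀ u, u ≠ a → u ≠ b → nbOf (L ++ [(a, b)]) u = nbOf L u := fun u h1 h2 => by
    simp [nbOf, h1.symm, h2.symm]
  have hmem' : a ∉ nbOf L b := by
    rwa [mem_nbOf, Sym2.eq_swap, ← mem_nbOf]
  have e9 : ∀ u : Fin n, (addEdge.exec s).arr 9 u = (nbOf (L ++ [(a, b)]) u).length := by
    intro u
    by_cases h1' : u = a
    · subst h1'
      simp [addEdge, Program.exec, h4, h1, h2, h.deg, ha, hba, hba.symm]
    · by_cases h2' : u = b
      · subst h2'
        simp [addEdge, Program.exec, h4, h1, h2, h.deg, hb, hba]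
      · have h1'' : (u : ℕ) ≠ a := fun h => h1' (Fin.ext h)
        have h2'' : (u : ℕ) ≠ b := fun h => h2' (Fin.ext h)
        simp [addEdge, Program.exec, h4, h1, h2, h.deg, hu u h1' h2', h1'', h2'']
  have k10 : (addEdge.exec s).arr 10 = Function.update (Function.update (s.arr 10)
      (n * a + (nbOf L a).length) b) (n * b + (nbOf L b).length) a := by
    simp [addEdge, Program.exec, h4, h1, h2, h.deg, h7]
  have k11 : (addEdge.exec s).arr 11 = Function.update (Function.update (s.arr 11)
      (n * a + (nbOf L a).length) (T.ew s(a, b))) (n * b + (nbOf L b).length) (T.ew s(a, b)) := by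
    simp [addEdge, Program.exec, h4, h1, h2, h3, h.deg, h7]
  have k12 : (addEdge.exec s).arr 12 = Function.update (Function.update (s.arr 12)
      (n * a + (nbOf L a).length) (nbOf L b).length) (n * b + (nbOf L b).length)
      (nbOf L a).length := by
    simp [addEdge, Program.exec, h4, h1, h2, h.deg, h7]
  refine ⟨by simp [addEdge, Program.exec, h4], e9, fun u j hj => ?_⟩
  rw [k10, k11, k12]
  by_cases hjl : j < (nbOf L u).length
  · have hne : ∀ c, n * (u : ℕ) + j ≠ n * (c : Fin n) + (nbOf L c).length := by
      intro c hc
      obtain ⟨h1, h2⟩ := index_inj (hjl.trans (hlt u)) (hlt c) hc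
      rw [Fin.ext h1] at hjl
      omega
    have hget : (nbOf (L ++ [(a, b)]) u)[j] = (nbOf L u)[j] := by
      simp only [nbOf_append]
      rw [List.getElem_append_left hjl]
    have hin : u ∈ nbOf L (nbOf L u)[j] := by
      rw [mem_nbOf, Sym2.eq_swap, ← mem_nbOf]
      exact List.getElem_mem hjl
    rw [Function.update_of_ne (hne b), Function.update_of_ne (hne a),
      Function.update_of_ne (hne b), Function.update_of_ne (hne a),
      Function.update_of_ne (hne b), Function.update_of_ne (hne a), hget, nbOf_append,
      List.idxOf_append_of_mem hin]
    exact h.adj u j hjl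
  · by_cases h1' : u = a
    · subst h1'
      have hj' : j = (nbOf L u).length := by
        rw [ha, List.length_append, List.length_singleton] at hj
        omega
      subst hj'
      have hget : (nbOf (L ++ [(u, b)]) u)[(nbOf L u).length] = b := by simp [ha]
      have hne : n * (u : ℕ) + (nbOf L u).length ≠ n * b + (nbOf L b).length := by
        intro hc
        exact hba (index_inj (hlt u) (hlt b) hc).1.symm
      rw [Function.update_of_ne hne, Function.update_self, Function.update_of_ne hne,
        Function.update_self, Function.update_of_ne hne, Function.update_self, hget, hb,
        List.idxOf_append_of_notMem hmem']
      simp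
    · by_cases h2' : u = b
      · subst h2'
        have hj' : j = (nbOf L u).length := by
          rw [hb, List.length_append, List.length_singleton] at hj
          omega
        subst hj'
        have hget : (nbOf (L ++ [(a, u)]) u)[(nbOf L u).length] = a := by simp [hb]
        rw [Function.update_self, Function.update_self, Function.update_self, hget, ha,
          List.idxOf_append_of_notMem hmem, Sym2.eq_swap]
        simp
      · rw [hu u h1' h2'] at hj
        exact absurd hj hjl

theorem setupEdges_spec {s : State} (hT : T.graph.IsTree) (hL : T.ListsEdges L) (h0 : s.var 0 = n)
    (h7 : ∀ i < n, s.arr 7 i = n * i) (h9 : ∀ i, s.arr 9 i = 0)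
    (hin : ∀ i (h : i < L.length), s.arr 1 i = (L[i].1 : ℕ) ∧ s.arr 2 i = (L[i].2 : ℕ) ∧
      s.arr 3 i = T.ew s(L[i].1, L[i].2)) :
    setupEdges.Halts s ((n + 1) * 120) (Lists T L) := by
  have hlen := length_edges hT hL
  refine Program.Halts.straight_seq 2 (T := n * 106)
    (fun s' => s'.var 4 = 0) rfl (by simp [Program.exec]) (by decide) (by omega) ?_
  rintro s1 hf1 h4
  refine (Program.halts_loop (T := 100)
    (Inv := fun i s' => s'.var 4 = i ∧ Lists T (L.take i) s') L.length ?_ ?_ ?_).imp ?_ ?_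
  · refine ⟨h4, fun u => ?_, fun u j hj => ?_⟩
    · rw [hf1.2 9 (by decide), h9]
      rfl
    · simp [nbOf] at hj
  · rintro i hi s2 hf2 ⟨h1, h2⟩
    have c0 : s2.var 0 = n := by rw [hf2.1 0 (by decide), hf1.1 0 (by decide), h0]
    refine ⟨by simp [c0, h1]; omega, ?_⟩
    obtain ⟨g1, g2, g3⟩ := hin i hi
    have hadj : T.graph.Adj L[i].1 L[i].2 := by
      rw [← SimpleGraph.mem_edgeSet, ← hL.2]
      exact List.mem_map.2 ⟨L[i], List.getElem_mem hi, rfl⟩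
    have htake : L.take (i + 1) = L.take i ++ [(L[i].1, L[i].2)] :=
      List.take_succ_eq_append_getElem hi
    have hnd : ((L.take (i + 1)).map fun p => s(p.1, p.2)).Nodup :=
      hL.1.sublist ((List.take_sublist _ _).map _)
    rw [htake, List.map_append, List.nodup_append] at hnd
    rw [htake]
    refine addEdge_spec (fun j hj => ?_) h2 hadj.ne ?_ (fun u => ?_) h1 ?_ ?_ ?_
    · rw [hf2.2 7 (by decide), hf1.2 7 (by decide), h7 j hj]
    · rw [mem_nbOf]
      exact fun hc => hnd.2.2 _ hc _ (by simp) rfl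
    · refine lt_of_le_of_lt (List.Sublist.length_le ?_) ((neighbors_nbOf hL).length_lt u)
      exact (List.take_sublist _ _).filterMap _
    · rw [hf2.2 1 (by decide), hf1.2 1 (by decide), g1]
    · rw [hf2.2 2 (by decide), hf1.2 2 (by decide), g2]
    · rw [hf2.2 3 (by decide), hf1.2 3 (by decide), g3]
  · rintro s2 hf2 ⟨h1, -⟩
    simp [h1, hf2.1 0 (by decide), hf1.1 0 (by decide), h0]
    omega
  · rw [hlen]
    exact Nat.mul_le_mul_left _ (by decide)
  · rintro s2 hf2 ⟨-, h2⟩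
    rwa [List.take_length] at h2

theorem setupRows_spec {s : State} (hlt : ∀ u, (nbOf L u).length < n) (h0 : s.var 0 = n)
    (h8 : ∀ i < n, s.arr 8 i = n * 2 ^ i) (hL : Lists T L s) :
    setupRows.Halts s ((n + 1) * 40) fun s' => ∀ u : Fin n, s'.arr 13 u = n * rows (nbOf L) u := by
  refine Program.Halts.straight_seq 2 (T := (n + 1) * 38)
    (fun s' => s'.var 4 = 0) rfl (by simp [Program.exec]) (by decide) (by omega) ?_
  rintro s1 hf1 h4
  refine Program.Halts.straight_seq 2 (T := (n + 1) * 36)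
    (fun s' => s'.var 5 = 0) rfl (by simp [Program.exec]) (by decide) (by omega) ?_
  rintro s2 hf2 h5
  refine (Program.halts_loop (T := 20)
    (Inv := fun i s' => s'.var 4 = i ∧ s'.var 5 = n * rows (nbOf L) i ∧
      ∀ j < i, s'.arr 13 j = n * rows (nbOf L) j) n ?_ ?_ ?_).imp
    (Nat.mul_le_mul_left _ (by decide)) ?_
  · exact ⟨by rw [hf2.1 4 (by decide), h4], by rw [h5]; rfl, by simp⟩
  · rintro i hi s3 hf3 ⟨h1, h2, h3⟩
    have c0 : s3.var 0 = n := by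
      rw [hf3.1 0 (by decide), hf2.1 0 (by decide), hf1.1 0 (by decide), h0]
    have c8 : s3.arr 8 = s.arr 8 := by
      rw [hf3.2 8 (by decide), hf2.2 8 (by decide), hf1.2 8 (by decide)]
    have c9 : s3.arr 9 = s.arr 9 := by
      rw [hf3.2 9 (by decide), hf2.2 9 (by decide), hf1.2 9 (by decide)]
    have hw := width_val (nb := nbOf L) ⟨i, hi⟩
    have hd := hL.deg ⟨i, hi⟩
    simp only at hw hd
    refine ⟨by simp [c0, h1]; omega, ?_⟩
    refine (Program.halts_straight rfl ?_).imp (T := Program.cost _) (by decide) fun _ _ h => h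
    refine ⟨by simp [Program.exec, h1], ?_, fun j hj => ?_⟩
    · simp [Program.exec, h1, h2, c8, c9, hd, h8 _ (hlt _), rows_succ, hw, mul_add]
    · rcases Nat.lt_succ_iff_lt_or_eq.1 hj with hj | rfl
      · simp [Program.exec, h1, hj.ne, h3 j hj]
      · simp [Program.exec, h1, h2]
  · rintro s3 hf3 ⟨h1, -⟩
    simp [hf3.1 0 (by decide), hf2.1 0 (by decide), hf1.1 0 (by decide), h0, h1]
  · exact fun s3 _ h u => h.2.2 u u.2

/-- Read the tree. -/
def setup : Program := setupPowers ;; setupEdges ;; setupRows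

theorem setup_spec (hT : T.graph.IsTree) (hL : T.ListsEdges L) :
    setup.Halts (T.input L) ((n + 1) * 200) (Static T (nbOf L)) := by
  have hlt := (neighbors_nbOf hL).length_lt
  refine ((setupPowers_spec (n := n) (by simp [input])).seq (T' := (n + 1) * 160) (Q' := _)
    ?_).imp (by omega) fun _ _ h => h
  rintro s1 hf1 ⟨h7, h8⟩
  have hA : ∀ a, a ≠ 7 → a ≠ 8 → s1.arr a = (T.input L).arr a := fun a h1 h2 => hf1.2 a (by
    simp [setupPowers, Program.wa, h1, h2])
  refine ((setupEdges_spec hT hL (by rw [hf1.1 0 (by decide)]; rfl) h7 ?_ ?_).seq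
    (T' := (n + 1) * 40) (Q' := _) ?_).imp (by omega) fun _ _ h => h
  · intro i
    rw [hA 9 (by decide) (by decide)]
    rfl
  · intro i hi
    rw [hA 1 (by decide) (by decide), hA 2 (by decide) (by decide), hA 3 (by decide) (by decide)]
    simp [input, hi]
  rintro s2 hf2 hLs
  have b0 : s2.var 0 = n := by rw [hf2.1 0 (by decide), hf1.1 0 (by decide)]; rfl
  refine (setupRows_spec hlt b0 (fun i hi => by rw [hf2.2 8 (by decide), h8 i hi]) hLs).imp
    le_rfl ?_
  rintro s3 hf3 h13
  constructor
  · rw [hf3.1 0 (by decide), b0]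
  · intro u
    rw [hf3.2 0 (by decide), hf2.2 0 (by decide), hA 0 (by decide) (by decide)]
    simp [input]
  · intro u
    rw [hf3.2 7 (by decide), hf2.2 7 (by decide), h7 u u.2]
  · intro j hj
    rw [hf3.2 8 (by decide), hf2.2 8 (by decide), h8 j hj]
  · rw [hf3.2 9 (by decide)]
    exact hLs.deg
  · rw [hf3.2 10 (by decide), hf3.2 11 (by decide), hf3.2 12 (by decide)]
    exact hLs.adj
  · exact h13

end Setup

/-! ## Writing the strategy -/

section Output

variable {n : ℕ}

/-- The three arrays hold the moves in `ms`, starting at cell `o`. -/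
def Writes (X Y C : ℕ → ℕ) (o : ℕ) (ms : List (Move (Fin n))) : Prop :=
  ∀ i (h : i < ms.length), X (o + i) = ms[i].src ∧ Y (o + i) = ms[i].dst ∧ C (o + i) = ms[i].count

section Writes

variable {X Y C X' Y' C' : ℕ → ℕ} {o : ℕ} {ms ms' : List (Move (Fin n))}

theorem Writes.nil : Writes X Y C o ([] : List (Move (Fin n))) := by
  intro i h
  simp at h

theorem Writes.congr (h : Writes X Y C o ms) (h' : ∀ i, o ≤ i → i < o + ms.length →
    X' i = X i ∧ Y' i = Y i ∧ C' i = C i) : Writes X' Y' C' o ms := by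
  intro i hi
  obtain ⟨h1, h2, h3⟩ := h' (o + i) (by omega) (by omega)
  rw [h1, h2, h3]
  exact h i hi

theorem Writes.append (h : Writes X Y C o ms) (h' : Writes X Y C (o + ms.length) ms') :
    Writes X Y C o (ms ++ ms') := by
  intro i hi
  rw [List.length_append] at hi
  by_cases hil : i < ms.length
  · rw [List.getElem_append_left hil]
    exact h i hil
  · rw [List.getElem_append_right (by omega)]
    have := h' (i - ms.length) (by omega)
    rwa [show o + ms.length + (i - ms.length) = o + i by omega] at this

theorem Writes.single {m : Move (Fin n)} (h : X o = m.src ∧ Y o = m.dst ∧ C o = m.count) :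
    Writes X Y C o [m] := by
  intro i hi
  obtain rfl : i = 0 := by simpa using hi
  simpa using h

end Writes

/-- The arrays `P` and `D` hold the parents and the depths of the vertices in `S` for the walks
`up` to the root. -/
structure Ups (S : Finset (Fin n)) (up : Fin n → List (Fin n × Fin n)) (P D : ℕ → ℕ) : Prop where
  depth (v : Fin n) : v ∈ S → D v = (up v).length
  parent (v : Fin n) : v ∈ S → up v = [] ∨ ∃ p ∈ S, P v = p ∧ up v = (v, p) :: up p

/-! ### Writing the walks of the spare searchers. -/

/-- Write the moves from the vertex in variable `15` to the root. -/
def emitUp : Program :=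
  29 ≔ V 15 ;;
  .loop (A 24 (V 29))
    (.put 4 (V 3) (V 29) ;; .put 5 (V 3) (A 23 (V 29)) ;; .put 6 (V 3) (V 6) ;; 3 ≔ V 3 + 1 ;;
      29 ≔ A 23 (V 29))

/-- Write the moves from the root to the vertex in variable `9`. -/
def emitDown : Program :=
  3 ≔ V 3 + A 24 (V 9) ;; 28 ≔ V 3 ;; 29 ≔ V 9 ;;
  .loop (A 24 (V 29))
    (28 ≔ V 28 - 1 ;; .put 4 (V 28) (A 23 (V 29)) ;; .put 5 (V 28) (V 29) ;; .put 6 (V 28) (V 6) ;;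
      29 ≔ A 23 (V 29))

theorem emitUp_spec {s : State} {S : Finset (Fin n)} {up : Fin n → List (Fin n × Fin n)}
    (hU : Ups S up (s.arr 23) (s.arr 24)) {z : Fin n} (hz : z ∈ S) (h15 : s.var 15 = z)
    {ms : List (Move (Fin n))} (h3 : s.var 3 = ms.length)
    (hw : Writes (s.arr 4) (s.arr 5) (s.arr 6) 0 ms) :
    emitUp.Halts s (((up z).length + 1) * 40) fun s' =>
      s'.var 3 = (ms ++ movesUp (s.var 6) (up z)).length ∧
      Writes (s'.arr 4) (s'.arr 5) (s'.arr 6) 0 (ms ++ movesUp (s.var 6) (up z)) := by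
  refine Program.Halts.straight_seq 2 (T := ((up z).length + 1) * 30)
    (fun s' => s'.arr = s.arr ∧ s'.var 29 = z) rfl (by simp [Program.exec, h15]) (by decide)
    (by omega) ?_
  rintro s1 hf1 ⟨ha1, h29⟩
  refine (Program.halts_loop (T := 20)
    (Inv := fun i s' => ∃ w ∈ S, ∃ pre, s'.var 29 = w ∧ up z = pre ++ up w ∧ pre.length = i ∧
      s'.var 3 = (ms ++ movesUp (s.var 6) pre).length ∧
      Writes (s'.arr 4) (s'.arr 5) (s'.arr 6) 0 (ms ++ movesUp (s.var 6) pre))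
    (up z).length ?_ ?_ ?_).imp (Nat.mul_le_mul_left _ (by decide)) ?_
  · refine ⟨z, hz, [], h29, rfl, rfl, ?_, ?_⟩
    · rw [hf1.1 3 (by decide), h3]
      simp [movesUp]
    · rw [ha1]
      simpa [movesUp] using hw
  · rintro i hi s2 hf2 ⟨w, hwS, pre, g1, g2, g3, g4, g5⟩
    have c6 : s2.var 6 = s.var 6 := by rw [hf2.1 6 (by decide), hf1.1 6 (by decide)]
    have c23 : s2.arr 23 = s.arr 23 := by rw [hf2.2 23 (by decide), ha1]
    have c24 : s2.arr 24 = s.arr 24 := by rw [hf2.2 24 (by decide), ha1]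
    have hlen := congrArg List.length g2
    rw [List.length_append] at hlen
    rcases hU.parent w hwS with h | ⟨p, hp, hPw, h⟩
    · rw [h, List.length_nil] at hlen
      omega
    refine ⟨by simp [g1, c24, hU.depth w hwS, h], ?_⟩
    refine (Program.halts_straight rfl ?_).imp (T := Program.cost _) (by decide) fun _ _ h => h
    refine ⟨p, hp, pre ++ [(w, p)], by simp [Program.exec, g1, c23, hPw], by simp [g2, h],
      by simp [g3], by simp [Program.exec, g4, movesUp, add_assoc], ?_⟩
    have hsplit : ms ++ movesUp (s.var 6) (pre ++ [(w, p)]) =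
        ms ++ movesUp (s.var 6) pre ++ [⟨w, p, s.var 6⟩] := by simp [movesUp]
    rw [hsplit]
    refine (g5.congr fun j _ hj => ?_).append (.single ?_)
    · have : j ≠ s2.var 3 := by omega
      simp [Program.exec, this]
    · rw [zero_add, ← g4]
      simp [Program.exec, g1, c6, c23, hPw]
  · rintro s2 hf2 ⟨w, hwS, pre, g1, g2, g3, g4, g5⟩
    have c24 : s2.arr 24 = s.arr 24 := by rw [hf2.2 24 (by decide), ha1]
    have hlen := congrArg List.length g2
    rw [List.length_append] at hlen
    simp only [Expr.eval_cell, Expr.eval_var, g1, c24, hU.depth w hwS]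
    omega
  · rintro s2 hf2 ⟨w, hwS, pre, g1, g2, g3, g4, g5⟩
    have hlen := congrArg List.length g2
    rw [List.length_append] at hlen
    have : up w = [] := List.length_eq_zero_iff.1 (by omega)
    rw [this, List.append_nil] at g2
    rw [g2]
    exact ⟨g4, g5⟩

/-- Parent pointers give the walk only in the upward direction. So as many cells as the depth says
are reserved first, and they are filled from the last to the first. -/
theorem emitDown_spec {s : State} {S : Finset (Fin n)} {up : Fin n → List (Fin n × Fin n)}
    (hU : Ups S up (s.arr 23) (s.arr 24)) {z : Fin n} (hz : z ∈ S) (h9 : s.var 9 = z)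
    {ms : List (Move (Fin n))} (h3 : s.var 3 = ms.length)
    (hw : Writes (s.arr 4) (s.arr 5) (s.arr 6) 0 ms) :
    emitDown.Halts s (((up z).length + 1) * 40) fun s' =>
      s'.var 3 = (ms ++ movesDown (s.var 6) (up z)).length ∧
      Writes (s'.arr 4) (s'.arr 5) (s'.arr 6) 0 (ms ++ movesDown (s.var 6) (up z)) := by
  refine Program.Halts.straight_seq 5 (T := 4 + ((up z).length + 1) * 30)
    (fun s' => s'.arr = s.arr ∧ s'.var 3 = ms.length + (up z).length) rfl
    (by simp [Program.exec, h3, h9, hU.depth z hz]) (by decide) (by omega) ?_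
  rintro s1 hf1 ⟨ha1, h3'⟩
  refine Program.Halts.straight_seq 2 (T := 2 + ((up z).length + 1) * 30)
    (fun s' => s'.arr = s.arr ∧ s'.var 28 = ms.length + (up z).length) rfl
    (by simp [Program.exec, ha1, h3']) (by decide) (by omega) ?_
  rintro s2 hf2 ⟨ha2, h28⟩
  refine Program.Halts.straight_seq 2 (T := ((up z).length + 1) * 30)
    (fun s' => s'.arr = s.arr ∧ s'.var 29 = z) rfl
    (by simp [Program.exec, ha2, hf2.1 9 (by decide), hf1.1 9 (by decide), h9]) (by decide)
    (by omega) ?_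
  rintro s3 hf3 ⟨ha3, h29⟩
  refine (Program.halts_loop (T := 20)
    (Inv := fun i s' => ∃ w ∈ S, ∃ pre, s'.var 29 = w ∧ up z = pre ++ up w ∧ pre.length = i ∧
      s'.var 28 = ms.length + (up w).length ∧
      Writes (s'.arr 4) (s'.arr 5) (s'.arr 6) 0 ms ∧
      Writes (s'.arr 4) (s'.arr 5) (s'.arr 6) (ms.length + (up w).length)
        (movesDown (s.var 6) pre))
    (up z).length ?_ ?_ ?_).imp (Nat.mul_le_mul_left _ (by decide)) ?_
  · refine ⟨z, hz, [], h29, rfl, rfl, by rw [hf3.1 28 (by decide), h28], by rwa [ha3], .nil⟩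
  · rintro i hi s4 hf4 ⟨w, hwS, pre, g1, g2, g3, g4, g5, g6⟩
    have c6 : s4.var 6 = s.var 6 := by
      rw [hf4.1 6 (by decide), hf3.1 6 (by decide), hf2.1 6 (by decide), hf1.1 6 (by decide)]
    have c23 : s4.arr 23 = s.arr 23 := by rw [hf4.2 23 (by decide), ha3]
    have c24 : s4.arr 24 = s.arr 24 := by rw [hf4.2 24 (by decide), ha3]
    have hlen := congrArg List.length g2
    rw [List.length_append] at hlen
    rcases hU.parent w hwS with h | ⟨p, hp, hPw, h⟩
    · rw [h, List.length_nil] at hlen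
      omega
    have hl1 : (up w).length = (up p).length + 1 := by rw [h, List.length_cons]
    have g4' : s4.var 28 - 1 = ms.length + (up p).length := by omega
    refine ⟨by simp [g1, c24, hU.depth w hwS, h], ?_⟩
    refine (Program.halts_straight rfl ?_).imp (T := Program.cost _) (by decide) fun _ _ h => h
    refine ⟨p, hp, pre ++ [(w, p)], by simp [Program.exec, g1, c23, hPw], by simp [g2, h],
      by simp [g3], by simp [Program.exec, g4'], g5.congr fun j _ hj => ?_, ?_⟩
    · have : j ≠ ms.length + (up p).length := by omega
      simp [Program.exec, g4', this]
    · have hsplit : movesDown (s.var 6) (pre ++ [(w, p)]) =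
          [⟨p, w, s.var 6⟩] ++ movesDown (s.var 6) pre := by simp [movesDown]
      rw [hsplit]
      refine Writes.append (.single ?_) ?_
      · simp [Program.exec, g4', g1, c6, c23, hPw]
      · rw [List.length_singleton, add_assoc, ← hl1]
        refine g6.congr fun j hj _ => ?_
        have : j ≠ ms.length + (up p).length := by omega
        simp [Program.exec, g4', this]
  · rintro s4 hf4 ⟨w, hwS, pre, g1, g2, g3, g4, g5, g6⟩
    have c24 : s4.arr 24 = s.arr 24 := by rw [hf4.2 24 (by decide), ha3]
    have hlen := congrArg List.length g2
    rw [List.length_append] at hlen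
    simp only [Expr.eval_cell, Expr.eval_var, g1, c24, hU.depth w hwS]
    omega
  · rintro s4 hf4 ⟨w, hwS, pre, g1, g2, g3, g4, g5, g6⟩
    have hlen := congrArg List.length g2
    rw [List.length_append] at hlen
    have : up w = [] := List.length_eq_zero_iff.1 (by omega)
    rw [this, List.length_nil, add_zero] at g6
    rw [this, List.append_nil] at g2
    rw [g2]
    refine ⟨?_, g5.append (by rwa [zero_add])⟩
    rw [hf4.1 3 (by decide), hf3.1 3 (by decide), hf2.1 3 (by decide), h3', List.length_append,
      length_movesDown, g2]

end Output

section Output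

variable {n : ℕ} {T : WeightedGraph (Fin n)}

/-! ### Entering a vertex and updating the guard. -/

theorem need_eq {S : Finset (Fin n)} {v : Fin n} (hv : v ∈ S) :
    T.need S v = if (T.nbrs v \ S).card = 0 then 0 else T.vw v := by
  split_ifs with h
  · rw [Finset.card_eq_zero, Finset.sdiff_eq_empty_iff_subset] at h
    rw [need, if_neg]
    rintro ⟨-, y, -, hy, hyS⟩
    exact hyS (h (mem_nbrs.2 hy))
  · obtain ⟨y, hy⟩ := Finset.card_pos.1 (Nat.pos_of_ne_zero h)
    rw [Finset.mem_sdiff, mem_nbrs] at hy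
    exact need_eq_vw hv hy.1 hy.2

section Enter

variable (hT : T.graph.IsTree) {S : Finset (Fin n)} (hS : T.Linked S) {x y : Fin n} (hx : x ∈ S)
  (hy : y ∉ S) (hxy : T.graph.Adj x y)
include hT hS hx hy hxy

omit hT hS hx in
theorem card_open_left : (T.nbrs x \ S).card = (T.nbrs x \ insert y S).card + 1 := by
  rw [Finset.sdiff_insert, Finset.card_erase_add_one]
  exact Finset.mem_sdiff.2 ⟨mem_nbrs.2 hxy, hy⟩

theorem card_open_right : (T.nbrs y).card = (T.nbrs y \ insert y S).card + 1 := by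
  have : T.nbrs y \ insert y S = (T.nbrs y).erase x := by
    ext z
    simp only [Finset.mem_sdiff, mem_nbrs, Finset.mem_insert, Finset.mem_erase, not_or]
    constructor
    · rintro ⟨h1, -, h2⟩
      exact ⟨fun h => h2 (h ▸ hx), h1⟩
    · rintro ⟨h1, h2⟩
      exact ⟨h2, h2.ne', fun hz => h1 (hS.adj_unique hT hx hy hz hxy h2.symm)⟩
  rw [this, Finset.card_erase_add_one (mem_nbrs.2 hxy.symm)]

theorem card_open_of_ne {v : Fin n} (hv : v ∈ S) (hvx : v ≠ x) :
    (T.nbrs v \ insert y S).card = (T.nbrs v \ S).card := by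
  congr 1
  ext z
  simp only [Finset.mem_sdiff, mem_nbrs, Finset.mem_insert, not_or]
  refine and_congr_right fun h => ⟨fun h => h.2, fun h' => ⟨?_, h'⟩⟩
  rintro rfl
  exact hvx (hS.adj_unique hT hx hy hv hxy h)

end Enter

/-- Write the move that enters a vertex, and update the guard. -/
def enterVertex : Program :=
  .put 23 (V 15) (V 9) ;; .put 24 (V 15) (A 24 (V 9) + 1) ;;
  .put 9 (V 9) (A 9 (V 9) - 1) ;; .put 9 (V 15) (A 9 (V 15) - 1) ;;
  .ite (A 9 (V 9)) .skip (5 ≔ V 5 - A 0 (V 9)) ;;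
  .put 4 (V 3) (V 9) ;; .put 5 (V 3) (V 15) ;; .put 6 (V 3) (V 1 - V 5) ;; 3 ≔ V 3 + 1 ;;
  .ite (A 9 (V 15)) (5 ≔ V 5 + A 0 (V 15)) .skip ;;
  6 ≔ V 1 - V 5

/-- Write the moves for a step of the order. -/
def emitStep : Program :=
  (9 ≔ A 15 (V 7) ;; 15 ≔ A 16 (V 7) ;; 7 ≔ V 7 + 1 ;; 6 ≔ V 1 - V 5) ;;
  .ite (V 6) emitDown .skip ;; enterVertex ;; .ite (V 6) emitUp .skip

variable (T) in
/-- The state after the vertices of `S` have been entered by the moves `ms`. -/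
structure Progress (k : ℕ) (up : Fin n → List (Fin n × Fin n)) (S : Finset (Fin n))
    (ms : List (Move (Fin n))) (s : State) : Prop where
  linked : T.Linked S
  vw (u : Fin n) : s.arr 0 u = T.vw u
  bound : s.var 1 = k
  guard : s.var 5 = T.guard Finset.univ S
  deg (v : Fin n) : s.arr 9 v = if v ∈ S then (T.nbrs v \ S).card else (T.nbrs v).card
  ups : Ups S up (s.arr 23) (s.arr 24)
  short (v : Fin n) : v ∈ S → (up v).length < S.card
  count : s.var 3 = ms.length
  writes : Writes (s.arr 4) (s.arr 5) (s.arr 6) 0 ms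

/-- Array 9 initially holds the degrees and now counts the neighbours not yet entered; a vertex of
`S` needs its guard as long as its count is positive. Between its two updates variable 5 is the new
guard without the share of `y`. These searchers stay behind, and all others slide. -/
theorem enterVertex_spec (hT : T.graph.IsTree) {k : ℕ} {up : Fin n → List (Fin n × Fin n)}
    {S : Finset (Fin n)} {ms : List (Move (Fin n))} {s : State} (h : Progress T k up S ms s)
    {x y : Fin n} (hx : x ∈ S) (hy : y ∉ S) (hxy : T.graph.Adj x y) (h9 : s.var 9 = x)
    (h15 : s.var 15 = y) :
    enterVertex.Halts s 100 fun s' => s'.var 6 = k - T.guard Finset.univ (insert y S) ∧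
      Progress T k (Function.update up y ((y, x) :: up x)) (insert y S)
        (ms ++ [⟨x, y, k - (T.guard Finset.univ (insert y S) - T.entry y)⟩]) s' := by
  refine (Program.halts_straight rfl ?_).imp (T := Program.cost _) (by decide) fun _ _ h => h
  have hne : (x : ℕ) ≠ y := fun h => hxy.ne (Fin.ext h)
  have hyx : (y : ℕ) ≠ x := hne.symm
  have dx := h.deg x
  have dy := h.deg y
  rw [if_pos hx, card_open_left hy hxy] at dx
  rw [if_neg hy, card_open_right hT h.linked hx hy hxy] at dy
  have hnx := need_eq (T := T) (Finset.mem_insert_of_mem (b := y) hx)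
  have hny := need_eq (T := T) (Finset.mem_insert_self y S)
  rw [need_insert_self hT h.linked hx hy hxy] at hny
  have hg := guard_insert hT h.linked hx hy hxy
  have hle := entry_le_guard_insert hT h.linked hx hy hxy
  set cx := (T.nbrs x \ insert y S).card with hcx
  set cy := (T.nbrs y \ insert y S).card with hcy
  have hG : (if cx = 0 then T.guard Finset.univ S - T.vw x else T.guard Finset.univ S) =
      T.guard Finset.univ (insert y S) - T.entry y := by
    split_ifs with hc <;> simp only [hc, if_true, if_false] at hnx <;> omega
  have hG' : T.guard Finset.univ (insert y S) - T.entry y + (if cy = 0 then 0 else T.vw y) =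
      T.guard Finset.univ (insert y S) := by
    rw [← hny]
    omega
  have v5 : (enterVertex.exec s).var 5 = T.guard Finset.univ (insert y S) := by
    rw [← hG', ← hG]
    by_cases c1 : cx = 0 <;> by_cases c2 : cy = 0 <;>
      simp [enterVertex, Program.exec, h9, h15, dx, dy, hne, hyx, c1, c2, h.vw, h.guard]
  have a9 : (enterVertex.exec s).arr 9 = Function.update (Function.update (s.arr 9) x cx) y cy := by
    by_cases c1 : cx = 0 <;> by_cases c2 : cy = 0 <;>
      simp [enterVertex, Program.exec, h9, h15, dx, dy, hne, hyx, c1, c2]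
  have a0 : (enterVertex.exec s).arr 0 = s.arr 0 := by
    by_cases c1 : cx = 0 <;> by_cases c2 : cy = 0 <;>
      simp [enterVertex, Program.exec, h9, h15, dx, dy, hne, hyx, c1, c2]
  have a23 : (enterVertex.exec s).arr 23 = Function.update (s.arr 23) y x := by
    by_cases c1 : cx = 0 <;> by_cases c2 : cy = 0 <;>
      simp [enterVertex, Program.exec, h9, h15, dx, dy, hne, hyx, c1, c2]
  have a24 : (enterVertex.exec s).arr 24 =
      Function.update (s.arr 24) y ((up x).length + 1) := by
    by_cases c1 : cx = 0 <;> by_cases c2 : cy = 0 <;>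
      simp [enterVertex, Program.exec, h9, h15, dx, dy, hne, hyx, c1, c2, h.ups.depth x hx]
  have a4 : (enterVertex.exec s).arr 4 = Function.update (s.arr 4) ms.length x := by
    by_cases c1 : cx = 0 <;> by_cases c2 : cy = 0 <;>
      simp [enterVertex, Program.exec, h9, h15, dx, dy, hne, hyx, c1, c2, h.count]
  have a5 : (enterVertex.exec s).arr 5 = Function.update (s.arr 5) ms.length y := by
    by_cases c1 : cx = 0 <;> by_cases c2 : cy = 0 <;>
      simp [enterVertex, Program.exec, h9, h15, dx, dy, hne, hyx, c1, c2, h.count]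
  have a6 : (enterVertex.exec s).arr 6 = Function.update (s.arr 6) ms.length
      (k - (T.guard Finset.univ (insert y S) - T.entry y)) := by
    rw [← hG]
    by_cases c1 : cx = 0 <;> by_cases c2 : cy = 0 <;>
      simp [enterVertex, Program.exec, h9, h15, dx, dy, hne, hyx, c1, c2, h.count, h.bound,
        h.guard, h.vw]
  have v1 : (enterVertex.exec s).var 1 = k := by
    by_cases c1 : cx = 0 <;> by_cases c2 : cy = 0 <;>
      simp [enterVertex, Program.exec, h9, h15, dx, dy, hne, hyx, c1, c2, h.bound]
  have v3 : (enterVertex.exec s).var 3 = ms.length + 1 := by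
    by_cases c1 : cx = 0 <;> by_cases c2 : cy = 0 <;>
      simp [enterVertex, Program.exec, h9, h15, dx, dy, hne, hyx, c1, c2, h.count]
  have v6 : (enterVertex.exec s).var 6 =
      (enterVertex.exec s).var 1 - (enterVertex.exec s).var 5 := by
    simp [enterVertex, Program.exec]
  refine ⟨by rw [v6, v1, v5], h.linked.enter hx hxy, ?_, v1, v5, fun v => ?_, ⟨fun v hv => ?_,
    fun v hv => ?_⟩, fun v hv => ?_, by simp [v3], ?_⟩
  · rw [a0]
    exact h.vw
  · rw [a9]
    by_cases hvy : v = y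
    · subst hvy
      simp [hcy]
    · have hvy' : (v : ℕ) ≠ y := fun h => hvy (Fin.ext h)
      rw [Function.update_of_ne hvy']
      by_cases hvx : v = x
      · subst hvx
        simp [hcx, hx]
      · have hvx' : (v : ℕ) ≠ x := fun h => hvx (Fin.ext h)
        rw [Function.update_of_ne hvx', h.deg v]
        simp only [Finset.mem_insert, hvy, false_or]
        split_ifs with hvS
        · rw [card_open_of_ne hT h.linked hx hy hxy hvS hvx]
        · rfl
  · rw [a24]
    by_cases hvy : v = y
    · subst hvy
      simp
    · have hvy' : (v : ℕ) ≠ y := fun h => hvy (Fin.ext h)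
      rw [Function.update_of_ne hvy', Function.update_of_ne hvy]
      exact h.ups.depth v ((Finset.mem_insert.1 hv).resolve_left hvy)
  · rw [a23]
    by_cases hvy : v = y
    · subst hvy
      refine Or.inr ⟨x, Finset.mem_insert_of_mem hx, by simp, ?_⟩
      rw [Function.update_self, Function.update_of_ne hxy.ne]
    · have hvy' : (v : ℕ) ≠ y := fun h => hvy (Fin.ext h)
      rw [Function.update_of_ne hvy', Function.update_of_ne hvy]
      refine (h.ups.parent v ((Finset.mem_insert.1 hv).resolve_left hvy)).imp_right ?_
      rintro ⟨p, hp, h1, h2⟩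
      refine ⟨p, Finset.mem_insert_of_mem hp, h1, ?_⟩
      rw [Function.update_of_ne fun h : p = y => hy (h ▸ hp), h2]
  · rw [Finset.card_insert_of_notMem hy]
    by_cases hvy : v = y
    · subst hvy
      have := h.short x hx
      simp [this]
    · rw [Function.update_of_ne hvy]
      have := h.short v ((Finset.mem_insert.1 hv).resolve_left hvy)
      omega
  · refine (h.writes.congr fun j _ hj => ?_).append (.single ?_)
    · have : j ≠ ms.length := by omega
      simp [a4, a5, a6, this]
    · simp [a4, a5, a6]

theorem Progress.rewrite {k : ℕ} {up : Fin n → List (Fin n × Fin n)} {S : Finset (Fin n)}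
    {ms ms' : List (Move (Fin n))} {s s' : State} {p : Program} (h : Progress T k up S ms s)
    (hf : p.Frame s s') (hc : s'.var 3 = ms'.length)
    (hw : Writes (s'.arr 4) (s'.arr 5) (s'.arr 6) 0 ms')
    (hv : ∀ x ∈ [1, 5], x ∉ p.wv := by decide)
    (ha : ∀ a ∈ [0, 9, 23, 24], a ∉ p.wa := by decide) : Progress T k up S ms' s' := by
  constructor
  · exact h.linked
  · rw [hf.2 0 (ha 0 (by decide))]; exact h.vw
  · rw [hf.1 1 (hv 1 (by decide))]; exact h.bound
  · rw [hf.1 5 (hv 5 (by decide))]; exact h.guard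
  · rw [hf.2 9 (ha 9 (by decide))]; exact h.deg
  · rw [hf.2 23 (ha 23 (by decide)), hf.2 24 (ha 24 (by decide))]; exact h.ups
  · exact h.short
  · exact hc
  · exact hw

theorem emitStep_spec (hT : T.graph.IsTree) {k : ℕ} {up : Fin n → List (Fin n × Fin n)}
    {S : Finset (Fin n)} {ms : List (Move (Fin n))} {s : State} (h : Progress T k up S ms s)
    {x y : Fin n} (hx : x ∈ S) (hy : y ∉ S) (hxy : T.graph.Adj x y)
    (h15 : s.arr 15 (s.var 7) = x) (h16 : s.arr 16 (s.var 7) = y) :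
    emitStep.Halts s (n * 80 + 150) fun s' => s'.var 7 = s.var 7 + 1 ∧
      Progress T k (Function.update up y ((y, x) :: up x)) (insert y S)
        (ms ++ T.stepMoves k up S x y) s' := by
  have hSn : S.card ≤ n := (Finset.card_le_univ _).trans (by simp)
  have hSn' : (insert y S).card ≤ n := (Finset.card_le_univ _).trans (by simp)
  refine Program.Halts.straight_seq 20 (T := n * 80 + 130)
    (fun s' => s'.arr = s.arr ∧ s'.var 9 = x ∧ s'.var 15 = y ∧ s'.var 7 = s.var 7 + 1 ∧
      s'.var 6 = k - T.guard Finset.univ S) rfl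
    (by simp [Program.exec, h15, h16, h.bound, h.guard]) (by decide) (by omega) ?_
  rintro s1 hf1 ⟨ha1, b9, b15, b7, b6⟩
  have h1 : Progress T k up S ms s1 := h.rewrite hf1 (by rw [hf1.1 3 (by decide), h.count])
    (by rw [ha1]; exact h.writes)
  have hshort := h.short x hx
  refine (Program.Halts.seq (T := 2 + (1 + n * 40)) (T' := n * 40 + 110)
    (Q := Progress T k up S (ms ++ if k - T.guard Finset.univ S = 0 then [] else
      movesDown (k - T.guard Finset.univ S) (up x)))
    (Program.halts_ite (fun hc => ?_) fun hc => ?_) ?_).imp (by omega) fun _ _ h => h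
  · rw [Expr.eval_var, b6] at hc
    rw [if_neg hc]
    refine (emitDown_spec h1.ups hx b9 h1.count h1.writes).imp (by omega) ?_
    rintro s2 hf2 ⟨g1, g2⟩
    rw [b6] at g1 g2
    exact h1.rewrite hf2 g1 g2
  · rw [Expr.eval_var, b6] at hc
    rw [if_pos hc, List.append_nil]
    exact (Program.halts_straight (p := .skip) (Q := fun s' => s' = s1) rfl rfl).imp
      (by simp only [Program.cost]; omega) fun s2 _ h => h ▸ h1
  rintro s2 hf2 h2
  have c9 : s2.var 9 = x := by rw [hf2.1 9 (by decide), b9]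
  have c15 : s2.var 15 = y := by rw [hf2.1 15 (by decide), b15]
  have c7 : s2.var 7 = s.var 7 + 1 := by rw [hf2.1 7 (by decide), b7]
  refine ((enterVertex_spec hT h2 hx hy hxy c9 c15).seq (T' := 2 + (1 + n * 40)) (Q' := _)
    ?_).imp (by omega) fun _ _ h => h
  rintro s3 hf3 ⟨d6, h3⟩
  have d7 : s3.var 7 = s.var 7 + 1 := by rw [hf3.1 7 (by decide), c7]
  have d15 : s3.var 15 = y := by rw [hf3.1 15 (by decide), c15]
  have hshort' := h3.short y (Finset.mem_insert_self _ _)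
  refine Program.halts_ite (fun hc => ?_) fun hc => ?_
  · rw [Expr.eval_var, d6] at hc
    refine (emitUp_spec h3.ups (Finset.mem_insert_self _ _) d15 h3.count h3.writes).imp
      (by omega) ?_
    rintro s4 hf4 ⟨g1, g2⟩
    rw [d6, Function.update_self] at g1 g2
    refine ⟨by rw [hf4.1 7 (by decide), d7], ?_⟩
    rw [stepMoves, if_neg hc, ← List.append_assoc, ← List.append_assoc]
    exact h3.rewrite hf4 g1 g2
  · rw [Expr.eval_var, d6] at hc
    refine (Program.halts_straight (p := .skip) (Q := fun s' => s' = s3) rfl rfl).imp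
      (by simp only [Program.cost]; omega) ?_
    rintro s4 - rfl
    refine ⟨d7, ?_⟩
    rw [stepMoves, if_pos hc, List.append_nil, ← List.append_assoc]
    exact h3

/-! ### Writing the whole strategy. -/

/-- Write the strategy for the order in the full row of the root. -/
def emitAll : Program :=
  (7 ≔ A 13 (V 2) + (A 8 (A 9 (V 2)) - V 0) ;; 8 ≔ V 7 + A 14 (V 7) ;; 3 ≔ 0 ;;
    .ite (A 9 (V 2)) (5 ≔ A 0 (V 2)) (5 ≔ 0) ;; .put 24 (V 2) 0) ;;
  .loop (V 8 - V 7) emitStep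

theorem row_full {nb : Fin n → List (Fin n)} (u : Fin n) :
    n * rows nb u + (n * 2 ^ (nb u).length - n) = row nb u (2 ^ (nb u).length - 1) := by
  rw [row, Nat.mul_sub, mul_one]

theorem emitAll_spec (hT : T.graph.IsTree) {nb : Fin n → List (Fin n)} (hN : Neighbors T nb)
    {s : State} (hS : Static T nb s) {tab : Fin n → ℕ → List (Stp (Fin n))}
    (hTab : Table nb tab s) {k : ℕ} {r : Fin n} (h1 : s.var 1 = k) (h2 : s.var 2 = r)
    {l : List (Fin n × Fin n)}
    (hl : l = (tab r (2 ^ (nb r).length - 1)).map fun s => (s.x, s.y))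
    (hrun : T.Run Finset.univ k {r} l Finset.univ) :
    emitAll.Halts s ((n + 1) * (n * 80 + 190)) fun s' =>
      s'.var 1 = k ∧ s'.var 2 = r ∧
      s'.var 3 = (T.strategy k (fun _ => []) {r} l).length ∧
      Writes (s'.arr 4) (s'.arr 5) (s'.arr 6) 0 (T.strategy k (fun _ => []) {r} l) := by
  set o := row nb r (2 ^ (nb r).length - 1) with ho
  obtain ⟨t1, t2, t3⟩ := hTab r (2 ^ (nb r).length - 1) (Nat.sub_lt (by positivity) one_pos)
  have hll : (tab r (2 ^ (nb r).length - 1)).length = l.length := by rw [hl, List.length_map]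
  rw [hll] at t1 t2
  rw [← ho] at t1
  refine Program.Halts.straight_seq 30 (T := (n + 1) * (n * 80 + 160))
    (fun s' => s'.var 7 = o ∧ s'.var 8 = o + l.length ∧ s'.var 3 = 0 ∧
      s'.var 5 = (if (nb r).length = 0 then 0 else T.vw r) ∧
      s'.arr 24 = Function.update (s.arr 24) r 0) rfl ?_ (by decide) (by nlinarith) ?_
  · have e : s.arr 13 r + (s.arr 8 (s.arr 9 r) - s.var 0) = o := by
      rw [hS.base, hS.deg, hS.pow _ (hN.length_lt r), hS.size, row_full]
    by_cases hc : s.arr 9 r = 0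
    · rw [hc] at e
      simp [Program.exec, h2, e, t1, hc, ← hS.deg]
    · simp [Program.exec, h2, e, t1, hc, hS.vw, ← hS.deg]
  rintro s1 hf1 ⟨b7, b8, b3, b5, b24⟩
  have b0 : s1.arr 0 = s.arr 0 := hf1.2 0 (by decide)
  have b9 : s1.arr 9 = s.arr 9 := hf1.2 9 (by decide)
  have b15 : s1.arr 15 = s.arr 15 := hf1.2 15 (by decide)
  have b16 : s1.arr 16 = s.arr 16 := hf1.2 16 (by decide)
  have b1 : s1.var 1 = k := by rw [hf1.1 1 (by decide), h1]
  have b2 : s1.var 2 = r := by rw [hf1.1 2 (by decide), h2]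
  refine (Program.halts_loop (T := n * 80 + 150)
    (Inv := fun i s' => s'.var 7 = o + i ∧ ∃ up S ms, Progress T k up S ms s' ∧
      T.Run Finset.univ k S (l.drop i) Finset.univ ∧
      ms ++ T.strategy k up S (l.drop i) = T.strategy k (fun _ => []) {r} l)
    l.length ?_ ?_ ?_).imp ?_ ?_
  · refine ⟨b7, fun _ => [], {r}, [], ⟨linked_singleton r, ?_, b1, ?_, fun v => ?_,
      ⟨fun v hv => ?_, fun v _ => Or.inl rfl⟩, ?_, b3, .nil⟩, hrun, rfl⟩
    · rw [b0]
      exact hS.vw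
    · rw [b5, guard_eq_sum, Finset.sum_eq_single r (fun v _ hv => need_eq_zero (by simpa using hv))
        (by simp), need_eq (Finset.mem_singleton_self r), length_nb hN]
      rw [Finset.sdiff_singleton_eq_erase, Finset.erase_eq_of_notMem]
      simp [mem_nbrs]
    · rw [b9, hS.deg, length_nb hN]
      split_ifs with hv
      · rw [Finset.mem_singleton.1 hv, Finset.sdiff_singleton_eq_erase, Finset.erase_eq_of_notMem]
        simp [mem_nbrs]
      · rfl
    · rw [b24, Finset.mem_singleton.1 hv]
      simp
    · simp
  · rintro i hi s2 hf2 ⟨c7, up, S, ms, hP, hr, hst⟩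
    refine ⟨by simp [c7, hf2.1 8 (by decide), b8]; omega, ?_⟩
    rw [List.drop_eq_getElem_cons hi] at hr hst
    obtain ⟨e1, -, e3, e4, -, e6⟩ := hr
    have hlt' : i < (tab r (2 ^ (nb r).length - 1)).length := by omega
    obtain ⟨g1, g2, -⟩ := t3 i hlt'
    have hli : l[i] = ((tab r (2 ^ (nb r).length - 1))[i].x,
        (tab r (2 ^ (nb r).length - 1))[i].y) := by simp [hl]
    refine (emitStep_spec hT hP e1 e3 e4 ?_ ?_).imp le_rfl ?_
    · rw [hf2.2 15 (by decide), b15, c7, g1, hli]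
    · rw [hf2.2 16 (by decide), b16, c7, g2, hli]
    · rintro s3 hf3 ⟨d7, h3⟩
      refine ⟨by rw [d7, c7, add_assoc], _, _, _, h3, e6, ?_⟩
      rw [List.append_assoc]
      exact hst
  · rintro s2 hf2 ⟨c7, -⟩
    simp [c7, hf2.1 8 (by decide), b8]
  · have : (V 8 - V 7).cost = 3 := rfl
    rw [this]
    exact Nat.mul_le_mul (by omega) (by omega)
  · rintro s2 hf2 ⟨c7, up, S, ms, hP, hr, hst⟩
    rw [List.drop_length, strategy, List.append_nil] at hst
    rw [← hst]
    exact ⟨hP.bound, by rw [hf2.1 2 (by decide), b2], hP.count, hP.writes⟩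

end Output

/-! ### Choosing the starting vertex, and the complete program. -/

/-- Compute the number of searchers that are needed for the full row of a vertex. -/
def rowPeak : Program :=
  (17 ≔ A 13 (V 9) + (A 8 (A 9 (V 9)) - V 0) ;; 18 ≔ V 17 + A 14 (V 17) ;; 23 ≔ 0) ;;
  .loop (V 18 - V 17) (23 ≔ V 23 + (A 18 (V 17) - V 23) ;; 17 ≔ V 17 + 1)

/-- Find a starting vertex that needs the smallest number of searchers. -/
def chooseRoot : Program :=
  (1 ≔ 0 ;; 2 ≔ 0 ;; 5 ≔ 0 ;; 9 ≔ 0) ;;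
  .loop (V 0 - V 9)
    (rowPeak ;;
      -- Variable 5 is the best peak plus one, so that 0 can mean that no vertex has been tried.
      (.ite ((1 - V 5) + (V 5 - (V 23 + 1))) (5 ≔ V 23 + 1 ;; 1 ≔ V 23 ;; 2 ≔ V 9) .skip ;;
      9 ≔ V 9 + 1))

/-- Compute an optimal connected search strategy of a tree. -/
def searchTree : Program := setup ;; computeTable ;; chooseRoot ;; emitAll

section Choose

variable {n : ℕ} {T : WeightedGraph (Fin n)} {nb : Fin n → List (Fin n)}
  {tab : Fin n → ℕ → List (Stp (Fin n))} {s : State}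

theorem rowPeak_spec (hN : Neighbors T nb) (hS : Static T nb s) (hTab : Table nb tab s)
    {u : Fin n} (h9 : s.var 9 = u) :
    rowPeak.Halts s (n * 20 + 20) fun s' =>
      s'.var 23 = peakFrom 0 0 (tab u (2 ^ (nb u).length - 1)) := by
  obtain ⟨t1, t2, t3⟩ := hTab u (2 ^ (nb u).length - 1) (Nat.sub_lt (by positivity) one_pos)
  set l := tab u (2 ^ (nb u).length - 1) with hl
  have e : s.arr 13 u + (s.arr 8 (s.arr 9 u) - s.var 0) = row nb u (2 ^ (nb u).length - 1) := by
    rw [hS.base, hS.deg, hS.pow _ (hN.length_lt u), hS.size, row_full]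
  refine Program.Halts.straight_seq 20 (T := n * 20)
    (fun s' => s'.var 17 = row nb u (2 ^ (nb u).length - 1) ∧
      s'.var 18 = row nb u (2 ^ (nb u).length - 1) + l.length ∧ s'.var 23 = 0) rfl
    (by simp [Program.exec, h9, e, t1]) (by decide) (by omega) ?_
  rintro s1 hf1 ⟨b17, b18, b23⟩
  refine (Program.halts_loop (T := 12)
    (Inv := fun i s' => s'.var 17 = row nb u (2 ^ (nb u).length - 1) + i ∧
      s'.var 23 = peakFrom 0 0 (l.take i)) l.length ?_ ?_ ?_).imp ?_ ?_
  · exact ⟨b17, b23⟩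
  · rintro i hi s2 hf2 ⟨h1, h2⟩
    refine ⟨by simp [h1, hf2.1 18 (by decide), b18]; omega, ?_⟩
    refine (Program.halts_straight rfl ?_).imp (T := Program.cost _) (by decide) fun _ _ h => h
    refine ⟨by simp [Program.exec, h1, add_assoc], ?_⟩
    obtain ⟨-, -, -, g4⟩ := t3 i hi
    rw [List.take_succ_eq_append_getElem hi, peakFrom_snoc, if_pos (Nat.zero_le _), ← h2, ← g4]
    simp [Program.exec, h1, hf2.2 18 (by decide), hf1.2 18 (by decide)]
    omega
  · rintro s2 hf2 ⟨h1, -⟩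
    simp [h1, hf2.1 18 (by decide), b18]
  · have : (V 18 - V 17).cost = 3 := rfl
    rw [this]
    exact Nat.mul_le_mul (by omega) (by omega)
  · rintro s2 hf2 ⟨-, h2⟩
    rwa [List.take_length] at h2

theorem chooseRoot_spec (hn : 0 < n) (hN : Neighbors T nb) (hS : Static T nb s)
    (hTab : Table nb tab s) :
    chooseRoot.Halts s ((n + 1) * (n * 20 + 70)) fun s' => ∃ r : Fin n, s'.var 2 = r ∧
      s'.var 1 = peakFrom 0 0 (tab r (2 ^ (nb r).length - 1)) ∧
      ∀ u, s'.var 1 ≤ peakFrom 0 0 (tab u (2 ^ (nb u).length - 1)) := by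
  refine Program.Halts.straight_seq 20 (T := (n + 1) * (n * 20 + 50))
    (fun s' => s'.arr = s.arr ∧ s'.var 5 = 0 ∧ s'.var 9 = 0) rfl (by simp [Program.exec])
    (by decide) (by nlinarith) ?_
  rintro s1 hf1 ⟨ha1, b5, b9⟩
  have hS1 := hS.frame hf1
  have hTab1 := hTab.frame hf1
  refine (Program.halts_loop (T := n * 20 + 46)
    (Inv := fun i s' => s'.var 9 = i ∧ (i = 0 ∧ s'.var 5 = 0 ∨ s'.var 5 = s'.var 1 + 1 ∧
      (∃ r : Fin n, s'.var 2 = r ∧ s'.var 1 = peakFrom 0 0 (tab r (2 ^ (nb r).length - 1))) ∧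
      ∀ u : Fin n, u < i → s'.var 1 ≤ peakFrom 0 0 (tab u (2 ^ (nb u).length - 1))))
    n ?_ ?_ ?_).imp ?_ ?_
  · exact ⟨b9, Or.inl ⟨rfl, b5⟩⟩
  · rintro i hi s2 hf2 ⟨h1, h2⟩
    have hS2 := hS1.frame hf2
    have hTab2 := hTab1.frame hf2
    refine ⟨by simp [h1, hS2.size]; omega, ?_⟩
    refine ((rowPeak_spec hN hS2 hTab2 (u := ⟨i, hi⟩) h1).seq (T' := 26) (Q' := _)
      ?_).imp (by omega) fun _ _ h => h
    rintro s3 hf3 h23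
    have c9 : s3.var 9 = i := by rw [hf3.1 9 (by decide), h1]
    have c1 : s3.var 1 = s2.var 1 := hf3.1 1 (by decide)
    have c2 : s3.var 2 = s2.var 2 := hf3.1 2 (by decide)
    have c5 : s3.var 5 = s2.var 5 := hf3.1 5 (by decide)
    rw [← c1, ← c2, ← c5] at h2
    clear c1 c2 c5
    refine (Program.halts_straight rfl ?_).imp (T := Program.cost _) (by decide) fun _ _ h => h
    by_cases hc : (1 - s3.var 5) + (s3.var 5 - (s3.var 23 + 1)) = 0
    · have hex : ((Program.ite ((1 - V 5) + (V 5 - (V 23 + 1)))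
          (5 ≔ V 23 + 1 ;; 1 ≔ V 23 ;; 2 ≔ V 9) .skip ;; 9 ≔ V 9 + 1).exec s3) =
          s3.setVar 9 (i + 1) := by
        have : ((1 - V 5) + (V 5 - (V 23 + 1))).eval s3 = 0 := hc
        simp only [Program.exec, this, if_true]
        simp [c9]
      rw [hex]
      refine ⟨by simp, Or.inr ?_⟩
      rcases h2 with ⟨-, h2⟩ | ⟨k1, k2, k3⟩
      · omega
      · refine ⟨by simpa using k1, by simpa using k2, fun u hu => ?_⟩
        rcases Nat.lt_succ_iff_lt_or_eq.1 hu with hu | hu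
        · simpa using k3 u hu
        · obtain rfl : u = ⟨i, hi⟩ := Fin.ext hu
          rw [← h23]
          simp
          omega
    · have hex : ((Program.ite ((1 - V 5) + (V 5 - (V 23 + 1)))
          (5 ≔ V 23 + 1 ;; 1 ≔ V 23 ;; 2 ≔ V 9) .skip ;; 9 ≔ V 9 + 1).exec s3) =
          (((s3.setVar 5 (s3.var 23 + 1)).setVar 1 (s3.var 23)).setVar 2 i).setVar 9 (i + 1) := by
        have : ¬ ((1 - V 5) + (V 5 - (V 23 + 1))).eval s3 = 0 := hc
        simp only [Program.exec, this, if_false]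
        simp [c9]
      rw [hex]
      refine ⟨by simp, Or.inr ⟨by simp, ⟨⟨i, hi⟩, by simp, by simpa using h23⟩, fun u hu => ?_⟩⟩
      rcases Nat.lt_succ_iff_lt_or_eq.1 hu with hu | hu
      · rcases h2 with ⟨h2, -⟩ | ⟨k1, k2, k3⟩
        · omega
        · have := k3 u hu
          simp
          omega
      · obtain rfl : u = ⟨i, hi⟩ := Fin.ext hu
        simp [h23]
  · rintro s2 hf2 ⟨h1, -⟩
    simp [h1, (hS1.frame hf2).size]
  · have : (V 0 - V 9).cost = 3 := rfl
    rw [this]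
  · rintro s2 hf2 ⟨-, h2⟩
    rcases h2 with ⟨h2, -⟩ | ⟨-, ⟨r, k1, k2⟩, k3⟩
    · omega
    · exact ⟨r, k1, k2, fun u => k3 u u.2⟩

end Choose

theorem searchTree_spec {n : ℕ} {T : WeightedGraph (Fin n)} {L : List (Fin n × Fin n)}
    (hT : T.graph.IsTree) {Δ : ℕ} (hΔ : ∀ v, (T.graph.neighborSet v).ncard ≤ Δ)
    (hL : T.ListsEdges L) :
    searchTree.Halts (T.input L) ((2 ^ Δ + 1) * ((Δ + 1) * 4000) * n ^ 3) fun s' =>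
      ∃ (v₀ : Fin n) (ms : List (Move (Fin n))), s'.Outputs T.connectedSearchNumber v₀ ms ∧
        T.IsConnectedSearch T.connectedSearchNumber v₀ ms ∧
        T.IsMonotone T.connectedSearchNumber v₀ ms := by
  have hlen := length_edges hT hL
  have hn : 0 < n := by omega
  have hN := neighbors_nbOf hL
  refine ((setup_spec hT hL).seq (T' := (2 ^ Δ + 1) * ((Δ + 1) * 640) * ((n + 1) * ((n + 1) * n)) +
    ((n + 1) * (n * 20 + 70) + (n + 1) * (n * 80 + 190))) (Q' := _) ?_).imp ?_ fun _ _ h => h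
  rotate_left
  · obtain ⟨m, rfl⟩ := Nat.exists_eq_add_of_lt hn
    have hK : 1 ≤ (2 ^ Δ + 1) * (Δ + 1) := Nat.mul_pos (Nat.succ_pos _) (Nat.succ_pos _)
    have e1 : (2 ^ Δ + 1) * ((Δ + 1) * 640) * ((0 + m + 1 + 1) * ((0 + m + 1 + 1) * (0 + m + 1))) =
      (2 ^ Δ + 1) * (Δ + 1) * (640 * ((m + 2) * ((m + 2) * (m + 1)))) := by ring
    have e2 : (2 ^ Δ + 1) * ((Δ + 1) * 4000) * (0 + m + 1) ^ 3 =
      (2 ^ Δ + 1) * (Δ + 1) * (4000 * (m + 1) ^ 3) := by ring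
    rw [e1, e2]
    generalize (2 ^ Δ + 1) * (Δ + 1) = K at hK
    -- With n = m + 1 and n + 1 ≤ 2n, the table costs at most 2560 n³ per unit of `K`. The remaining
    -- 1440 n³ cover reading, choosing the root and writing, which take only quadratic time.
    have e3 : 640 * ((m + 2) * ((m + 2) * (m + 1))) + 1440 * (m + 1) ^ 3 ≤ 4000 * (m + 1) ^ 3 := by
      ring_nf
      omega
    have e4 : (0 + m + 1 + 1) * 200 + ((0 + m + 1 + 1) * ((0 + m + 1) * 20 + 70) +
        (0 + m + 1 + 1) * ((0 + m + 1) * 80 + 190)) ≤ 1440 * (m + 1) ^ 3 := by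
      ring_nf
      nlinarith [Nat.zero_le (m ^ 3), Nat.zero_le (m ^ 2)]
    calc _ ≤ K * (640 * ((m + 2) * ((m + 2) * (m + 1)))) + 1 * (1440 * (m + 1) ^ 3) := by omega
      _ ≤ K * (640 * ((m + 2) * ((m + 2) * (m + 1)))) + K * (1440 * (m + 1) ^ 3) :=
        Nat.add_le_add_left (Nat.mul_le_mul_right _ hK) _
      _ = K * (640 * ((m + 2) * ((m + 2) * (m + 1))) + 1440 * (m + 1) ^ 3) := by ring
      _ ≤ _ := Nat.mul_le_mul_left _ e3
  rintro s1 hf1 hS1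
  refine ((computeTable_spec hT hN hN.length_lt (fun w => ncard_neighborSet hN w ▸ hΔ w) hn hS1
    fun i => ?_).seq ?_)
  · rw [hf1.2 14 (by decide)]
    rfl
  rintro s2 hf2 ⟨tab, hTab, hopt⟩
  have hS2 := hS1.frame hf2
  refine (chooseRoot_spec hn hN hS2 hTab).seq ?_
  rintro s3 hf3 ⟨r, h2, h1, hmin⟩
  have hopt' : ∀ u, T.Optimal u (T.nbrs u) (tab u (2 ^ (nbOf L u).length - 1)) := fun u => by
    have := hopt u (2 ^ (nbOf L u).length - 1) (Nat.sub_lt (by positivity) one_pos)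
    rwa [sel_full hN] at this
  obtain ⟨l, hl⟩ : ∃ l, l = (tab r (2 ^ (nbOf L r).length - 1)).map fun s => (s.x, s.y) := ⟨_, rfl⟩
  have hrun : T.Run Finset.univ (s3.var 1) {r} l Finset.univ := by
    have := (hopt' r).run (p := s3.var 1) fun st hst =>
      (peakFrom_le_iff.1 h1.ge).2 st hst (Nat.zero_le _)
    rwa [dom_nbrs hT, ← hl] at this
  have hcs : T.connectedSearchNumber = s3.var 1 := by
    -- A run from any `r'` needs at least the peak of the full row of `r'`, and `r` has the smallest
    -- such peak.
    refine connectedSearchNumber_eq hT hrun fun k' r' l' h' => (hmin r').trans ?_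
    refine peakFrom_le_iff.2 ⟨Nat.zero_le _, fun st hst _ => ?_⟩
    exact (hopt' r').sp_le (by rwa [dom_nbrs hT]) st hst
  refine (emitAll_spec hT hN (hS2.frame hf3) (hTab.frame hf3) rfl h2 hl hrun).imp le_rfl ?_
  rintro s4 hf4 ⟨k1, k2, k3, k4⟩
  rw [hcs]
  refine ⟨r, _, ⟨k1, k2, k3, fun i hi => ?_⟩, isConnectedSearch_strategy hT hrun⟩
  simpa using k4 i hi

end ConnSearch

theorem theorem4p5 :
    ∃ P : ConnSearch.Program, ∀ Δ : ℕ, ∃ C : ℝ,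
      ∀ (n : ℕ) (T : ConnSearch.WeightedGraph (Fin n)) (L : List (Fin n × Fin n)),
        T.graph.IsTree → (∀ v, (T.graph.neighborSet v).ncard ≤ Δ) → T.ListsEdges L →
        ∃ (t : ℕ) (s : ConnSearch.State) (v₀ : Fin n) (ms : List (ConnSearch.Move (Fin n))),
          P.Runs (T.input L) t s ∧
          (t : ℝ) ≤ C * ((n : ℝ) ^ 3 * Real.log n + 1) ∧
          s.Outputs T.connectedSearchNumber v₀ ms ∧
          T.IsConnectedSearch T.connectedSearchNumber v₀ ms ∧
          T.IsMonotone T.connectedSearchNumber v₀ ms := by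
  refine ⟨ConnSearch.searchTree, fun Δ => ⟨2 * ((2 ^ Δ + 1) * ((Δ + 1) * 4000)), ?_⟩⟩
  intro n T L hT hΔ hL
  obtain ⟨t, s, h1, h2, v₀, ms, h3, h4, h5⟩ := ConnSearch.searchTree_spec hT hΔ hL
  refine ⟨t, s, v₀, ms, h1, ?_, h3, h4, h5⟩
  have h6 : (t : ℝ) ≤ (2 ^ Δ + 1) * ((Δ + 1) * 4000) * (n : ℝ) ^ 3 := by exact_mod_cast h2
  -- The summand 1 is needed at n = 1, where the logarithm vanishes; from n = 2 on, log n is at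
  -- least 1/2. This is the factor 2 in the constant.
  have h7 : (n : ℝ) ^ 3 ≤ 2 * ((n : ℝ) ^ 3 * Real.log n + 1) := by
    rcases Nat.lt_or_ge n 2 with hn | hn
    · interval_cases n <;> norm_num
    · have hlog : (1 / 2 : ℝ) ≤ Real.log n := by
        have h2 : Real.log 2 ≤ Real.log n :=
          Real.log_le_log (by norm_num) (by exact_mod_cast hn)
        have := Real.log_two_gt_d9
        linarith
      have hpos : (0 : ℝ) ≤ (n : ℝ) ^ 3 := by positivity
      nlinarith
  calc (t : ℝ) ≤ (2 ^ Δ + 1) * ((Δ + 1) * 4000) * (n : ℝ) ^ 3 := h6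
    _ ≤ (2 ^ Δ + 1) * ((Δ + 1) * 4000) * (2 * ((n : ℝ) ^ 3 * Real.log n + 1)) :=
      mul_le_mul_of_nonneg_left h7 (by positivity)
    _ = _ := by ring
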